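/- **Theorem 3 (Consistency of $\widehat\Sigma_1$).** For each number of nodes $N$ let $W=(w_{ij})\in\mathbb R^{N\times N}$ be a weight matrix, let the nodes be partitioned into nonempty sets $\mathcal S_1,\dots,\mathcal S_K$ ($K$ may depend on $N$), $N_k=|\mathcal S_k|$, $\alpha_k=N_k/N$, and let $$y=\rho_0Wy+X\beta_0+\mathcal E ,\qquad \theta_0=(\rho_0,\beta_0^\top)^\top\in\mathbb R^{p+1}\ \text{fixed},\ |\rho_0|<1 .$$ *Errors (C1).* The entries $\varepsilon_1,\dots,\varepsilon_N$ of $\mathcal E$ are i.i.d. $N(0,\sigma_\varepsilon^2)$ with a fixed $\sigma_\varepsilon^2>0$ (so they are centred and sub-Gaussian and $E\varepsilon_i^3=0$). *Covariates.* The rows $X_1,\dots,X_N\in\mathbb R^p$ of $X$ are i.i.d. with a fixed law that has mean zero and finite fourth moments, and are independent of $\mathcal E$. *Network (C3).* For all large $N$, $W$ is the transition matrix of an irreducible aperiodic Markov chain on $\{1,\dots,N\}$; its stationary distribution $\pi$ satisfies $\sum_i\pi_i^2=O(N^{-1/2-\delta})$ for some $0<\delta\le 1/2$; and $|\lambda_{\max}(W+W^\top)|=O(\log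 N)$. For $\theta=(\rho,\beta^\top)^\top$ put $S=I-\rho W$, $D=\{I+\rho^2\mathrm{diag}(W^\top W)\}^{-1}$, $\dot D=\partial D/\partial\rho=-2\rho D^2\mathrm{diag}(W^\top W)$, $F(\theta)=DS^\top(Sy-X\beta)$, $Q_k(\theta)=N_k^{-1}\sum_{i\in\mathcal S_k}F_i(\theta)^2$, and let $\dot Q_k$ be the gradient of $Q_k$. Define $$\Sigma_{1kl}=\sqrt{N_kN_l}\,\mathrm{cov}\{\dot Q_k(\theta_0),\dot Q_l(\theta_0)\},\qquad \Sigma_1=\sum_{k,l=1}^K\sqrt{\alpha_k\alpha_l}\,\Sigma_{1kl}.$$ With $J_k=\sum_{i\in\mathcal S_k}e_ie_i^\top$ let $\Xi_k^\dagger=(S^\top S\dot D-S^\top WD-W^\top SD)J_kD$, $V_{1k}=DS^\top J_k$, $V_{2k}=\widetilde MJ_kDS^\top$, $\widetilde M=\dot DS^\top S\dot D-\dot DS^\top WD-\dot DW^\top SD-DW^\top S\dot D+DW^\top WD-DS^\top W\dot D$, $T_{1k}=y^\top W^\top SDJ_kDS^\top$, $T_{2k}=y^\top S^\top WDJ_kDS^\top$,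 $T_{3k}=X^\top SDJ_kDS^\top$, $\widehat\sigma_\varepsilon^2=N^{-1}\|Sy-X\beta\|^2$, $\widehat\sigma^2=N^{-1}\|Sy\|^2$, all evaluated at $\theta=\widehat\theta$, where $\widehat\theta$ is any estimator of $\theta_0$ with $N^{\kappa}(\widehat\theta-\theta_0)=O_p(1)$ for some $\kappa>0$ (for instance a $\sqrt N$-consistent one). Let $\widehat\Sigma_1=\sum_{k,l}\sqrt{\alpha_k\alpha_l}\,\widehat\Sigma_{1kl}$, where $\widehat\Sigma_{1kl}$ has the blocks $$\widehat\Sigma_{1kl,\rho}=\tfrac{4}{\sqrt{N_kN_l}}\big[\widehat\sigma_\varepsilon^4\{\mathrm{tr}(\Xi_k^\dagger\Xi_l^\dagger)+\mathrm{tr}(V_{1k}^\top V_{2l})+\widehat\sigma^{-2}(T_{1k}T_{2l}^\top+T_{2k}T_{1l}^\top)\}+\widehat\sigma_\varepsilon^2T_{1k}T_{1l}^\top\big],$$ $$\widehat\Sigma_{1kl,\rho\beta}=\tfrac{4\widehat\sigma_\varepsilon^2}{\sqrt{N_kN_l}}T_{1k}T_{3l}^\top,\qquad \widehat\Sigma_{1kl,\beta\rho}=\widehat\Sigma_{1lk,\rho\beta}^\top,\qquad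 \widehat\Sigma_{1kl,\beta}=\tfrac{4\widehat\sigma_\varepsilon^2}{\sqrt{N_kN_l}}T_{3k}T_{3l}^\top .$$ Then $\widehat\Sigma_1-\Sigma_1\to_p 0$ as $N\to\infty$, both when the covariance in $\Sigma_{1kl}$ is taken over the errors for the given covariates $X$ and when it is the unconditional covariance over $(X,\mathcal E)$. -/

import Mathlib

open MeasureTheory ProbabilityTheory Filter Topology Matrix
open scoped NNReal ENNReal

noncomputable section

namespace SAR

/-- The index type of the parameter vector `θ = (ρ, β)` of length `p + 1`: the coordinate
`Sum.inl ()` is the network effect `ρ`, the coordinates `Sum.inr j` are those of `β`. -/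
abbrev Idx (p : ℕ) : Type := Unit ⊕ Fin p

/-- The network effect `ρ` of the parameter vector. -/
def rho {p : ℕ} (θ : Idx p → ℝ) : ℝ := θ (Sum.inl ())

/-- The regression coefficient `β` of the parameter vector. -/
def beta {p : ℕ} (θ : Idx p → ℝ) : Fin p → ℝ := fun j => θ (Sum.inr j)

section Network

variable {N : ℕ}

/-- The largest eigenvalue of a symmetric real matrix. -/
def lambdaMax (A : Matrix (Fin N) (Fin N) ℝ) : ℝ := sSup (spectrum ℝ A)

/-- `W` is the transition matrix of a Markov chain on the `N` nodes. -/
structure IsStochastic (W : Matrix (Fin N) (Fin N) ℝ) : Prop where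
  nonneg : ∀ i j, 0 ≤ W i j
  row_sum : ∀ i, ∑ j, W i j = 1

/-- Every state has period one: the greatest common divisor of the possible return times is `1`. -/
def IsAperiodic (W : Matrix (Fin N) (Fin N) ℝ) : Prop :=
  ∀ i, ∀ d : ℕ, (∀ m : ℕ, 0 < m → 0 < (W ^ m) i i → d ∣ m) → d = 1

/-- `π` is a stationary distribution of the chain with transition matrix `W`. -/
structure IsStationary (W : Matrix (Fin N) (Fin N) ℝ) (π : Fin N → ℝ) : Prop where
  nonneg : ∀ i, 0 ≤ π i
  sum_eq_one : ∑ i, π i = 1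
  invariant : Wᵀ *ᵥ π = π

end Network

/-- The conditions on the network structure, for a sequence of weight matrices indexed by the
number `N` of nodes.  `connectivity`: `W N` is the transition matrix of an irreducible aperiodic
Markov chain, whose stationary distribution satisfies `∑ πᵢ² = O(N^(-1/2-δ))` for some
`0 < δ ≤ 1/2`.  `uniformity`: `|λ_max(W + Wᵀ)| = O(log N)`. -/
structure NetworkCondition (W : (N : ℕ) → Matrix (Fin N) (Fin N) ℝ) : Prop where
  connectivity :
    (∀ᶠ N in atTop, IsStochastic (W N) ∧ (W N).IsIrreducible ∧ IsAperiodic (W N)) ∧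
    ∃ (π : (N : ℕ) → Fin N → ℝ) (δ : ℝ), 0 < δ ∧ δ ≤ 1 / 2 ∧
      (∀ᶠ N in atTop, IsStationary (W N) (π N)) ∧
      (fun N : ℕ => ∑ i, π N i ^ 2) =O[atTop] (fun N : ℕ => (N : ℝ) ^ (-(1 / 2 : ℝ) - δ))
  uniformity :
    (fun N : ℕ => |lambdaMax (W N + (W N)ᵀ)|) =O[atTop] (fun N : ℕ => Real.log (N : ℝ))

section Objective

variable {N p K : ℕ}

/-- `S = I - ρ W`. -/
def S (W : Matrix (Fin N) (Fin N) ℝ) (ρ : ℝ) : Matrix (Fin N) (Fin N) ℝ := 1 - ρ • W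

/-- `D = {I + ρ² diag(Wᵀ W)}⁻¹`. -/
def D (W : Matrix (Fin N) (Fin N) ℝ) (ρ : ℝ) : Matrix (Fin N) (Fin N) ℝ :=
  Matrix.diagonal fun i => (1 + ρ ^ 2 * (Wᵀ * W) i i)⁻¹

/-- `∂D/∂ρ = -2 ρ D² diag(Wᵀ W)`. -/
def Ddot (W : Matrix (Fin N) (Fin N) ℝ) (ρ : ℝ) : Matrix (Fin N) (Fin N) ℝ :=
  (-2 * ρ) • (D W ρ ^ 2 * Matrix.diagonal (Matrix.diag (Wᵀ * W)))

/-- The solution `y = S⁻¹ (X β + ε)` of the spatial autoregression `y = ρ W y + X β + ε`. -/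
def response (W : Matrix (Fin N) (Fin N) ℝ) (θ : Idx p → ℝ) (X : Matrix (Fin N) (Fin p) ℝ)
    (e : Fin N → ℝ) : Fin N → ℝ :=
  (S W (rho θ))⁻¹ *ᵥ (X *ᵥ beta θ + e)

/-- `F(θ) = D Sᵀ (S y - X β)`. -/
def F (W : Matrix (Fin N) (Fin N) ℝ) (y : Fin N → ℝ) (X : Matrix (Fin N) (Fin p) ℝ)
    (θ : Idx p → ℝ) : Fin N → ℝ :=
  (D W (rho θ) * (S W (rho θ))ᵀ) *ᵥ (S W (rho θ) *ᵥ y - X *ᵥ beta θ)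

/-- The set of nodes on worker `k`, when node `i` is stored on worker `part i`. -/
def nodes (part : Fin N → Fin K) (k : Fin K) : Finset (Fin N) :=
  Finset.univ.filter fun i => part i = k

/-- `N_k`, the number of nodes on worker `k`. -/
def size (part : Fin N → Fin K) (k : Fin K) : ℝ := ((nodes part k).card : ℝ)

/-- `α_k = N_k / N`. -/
def weight (part : Fin N → Fin K) (k : Fin K) : ℝ := size part k / (N : ℝ)

/-- The local least squares objective `Q_k(θ) = N_k⁻¹ ∑_{i ∈ S_k} F_i(θ)²`. -/
def Q (W : Matrix (Fin N) (Fin N) ℝ) (part : Fin N → Fin K) (k : Fin K) (y : Fin N → ℝ)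
    (X : Matrix (Fin N) (Fin p) ℝ) (θ : Idx p → ℝ) : ℝ :=
  (size part k)⁻¹ * ∑ i ∈ nodes part k, F W y X θ i ^ 2

/-- The partial derivative of `Q_k` with respect to the parameter coordinate `a`. -/
def Qdot (W : Matrix (Fin N) (Fin N) ℝ) (part : Fin N → Fin K) (k : Fin K) (y : Fin N → ℝ)
    (X : Matrix (Fin N) (Fin p) ℝ) (θ : Idx p → ℝ) (a : Idx p) : ℝ :=
  fderiv ℝ (Q W part k y X) θ (Pi.single a 1)

/-- `Σ₁ₖₗ = √(N_k N_l) cov{Q̇_k(θ₀), Q̇_l(θ₀)}`, for covariates `X` and errors `e` that are random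
elements on the probability space `(Ω, P)`. -/
def Sigma1kl (W : Matrix (Fin N) (Fin N) ℝ) (part : Fin N → Fin K) (θ₀ : Idx p → ℝ)
    {Ω : Type*} [MeasurableSpace Ω] (P : Measure Ω)
    (X : Ω → Matrix (Fin N) (Fin p) ℝ) (e : Ω → Fin N → ℝ) (k l : Fin K) :
    Matrix (Idx p) (Idx p) ℝ :=
  Matrix.of fun a b => √(size part k * size part l) *
    covariance (fun ω => Qdot W part k (response W θ₀ (X ω) (e ω)) (X ω) θ₀ a)
      (fun ω => Qdot W part l (response W θ₀ (X ω) (e ω)) (X ω) θ₀ b) P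

/-- `Σ₁ = ∑_{k,l} √(α_k α_l) Σ₁ₖₗ`. -/
def Sigma1 (W : Matrix (Fin N) (Fin N) ℝ) (part : Fin N → Fin K) (θ₀ : Idx p → ℝ)
    {Ω : Type*} [MeasurableSpace Ω] (P : Measure Ω)
    (X : Ω → Matrix (Fin N) (Fin p) ℝ) (e : Ω → Fin N → ℝ) : Matrix (Idx p) (Idx p) ℝ :=
  ∑ k, ∑ l, √(weight part k * weight part l) • Sigma1kl W part θ₀ P X e k l

/-- `Σ₁` for a given (fixed) covariate matrix `x`: the covariances are taken with respect to the
errors only, which are independent centred normal with variance `v`. -/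
def Sigma1Given (W : Matrix (Fin N) (Fin N) ℝ) (part : Fin N → Fin K) (θ₀ : Idx p → ℝ)
    (v : ℝ≥0) (x : Matrix (Fin N) (Fin p) ℝ) : Matrix (Idx p) (Idx p) ℝ :=
  Sigma1 W part θ₀ (Measure.pi fun _ : Fin N => gaussianReal 0 v) (fun _ => x) (fun e => e)

end Objective

section Estimator

variable {N p K : ℕ}

/-- `σ̂_ε² = N⁻¹ ‖S(ρ) y - X β‖²`, the sample estimate of the error variance. -/
def sigmaEpsSq (W : Matrix (Fin N) (Fin N) ℝ) (y : Fin N → ℝ) (X : Matrix (Fin N) (Fin p) ℝ)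
    (θ : Idx p → ℝ) : ℝ :=
  (N : ℝ)⁻¹ * ∑ i, (S W (rho θ) *ᵥ y - X *ᵥ beta θ) i ^ 2

/-- `σ̂² = N⁻¹ ‖S(ρ) y‖²`, the sample estimate of `σ̃² = β₀ᵀ Σ_X β₀ + σ_ε²`. -/
def sigmaSq (W : Matrix (Fin N) (Fin N) ℝ) (y : Fin N → ℝ) (θ : Idx p → ℝ) : ℝ :=
  (N : ℝ)⁻¹ * ∑ i, (S W (rho θ) *ᵥ y) i ^ 2

/-- `J_k = ∑_{i ∈ S_k} e_i e_iᵀ`. -/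
def J (part : Fin N → Fin K) (k : Fin K) : Matrix (Fin N) (Fin N) ℝ :=
  Matrix.diagonal fun i => if part i = k then 1 else 0

/-- `Ξ†_k = (Sᵀ S Ḋ - Sᵀ W D - Wᵀ S D) J_k D`. -/
def XiDag (W : Matrix (Fin N) (Fin N) ℝ) (part : Fin N → Fin K) (k : Fin K) (ρ : ℝ) :
    Matrix (Fin N) (Fin N) ℝ :=
  ((S W ρ)ᵀ * S W ρ * Ddot W ρ - (S W ρ)ᵀ * W * D W ρ - Wᵀ * S W ρ * D W ρ)
    * J part k * D W ρ

/-- `V₁ₖ = D Sᵀ J_k`. -/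
def V1 (W : Matrix (Fin N) (Fin N) ℝ) (part : Fin N → Fin K) (k : Fin K) (ρ : ℝ) :
    Matrix (Fin N) (Fin N) ℝ :=
  D W ρ * (S W ρ)ᵀ * J part k

/-- `M̃ = Ḋ Sᵀ S Ḋ - Ḋ Sᵀ W D - Ḋ Wᵀ S D - D Wᵀ S Ḋ + D Wᵀ W D - D Sᵀ W Ḋ`. -/
def Mtilde (W : Matrix (Fin N) (Fin N) ℝ) (ρ : ℝ) : Matrix (Fin N) (Fin N) ℝ :=
  Ddot W ρ * (S W ρ)ᵀ * S W ρ * Ddot W ρ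
    - Ddot W ρ * (S W ρ)ᵀ * W * D W ρ
    - Ddot W ρ * Wᵀ * S W ρ * D W ρ
    - D W ρ * Wᵀ * S W ρ * Ddot W ρ
    + D W ρ * Wᵀ * W * D W ρ
    - D W ρ * (S W ρ)ᵀ * W * Ddot W ρ

/-- `V₂ₗ = M̃ J_l D Sᵀ`. -/
def V2 (W : Matrix (Fin N) (Fin N) ℝ) (part : Fin N → Fin K) (l : Fin K) (ρ : ℝ) :
    Matrix (Fin N) (Fin N) ℝ :=
  Mtilde W ρ * J part l * D W ρ * (S W ρ)ᵀ

/-- The row vector `T₁ₖ = yᵀ Wᵀ S D J_k D Sᵀ`. -/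
def T1 (W : Matrix (Fin N) (Fin N) ℝ) (part : Fin N → Fin K) (k : Fin K) (y : Fin N → ℝ)
    (ρ : ℝ) : Fin N → ℝ :=
  y ᵥ* (Wᵀ * S W ρ * D W ρ * J part k * D W ρ * (S W ρ)ᵀ)

/-- The row vector `T₂ₖ = yᵀ Sᵀ W D J_k D Sᵀ`. -/
def T2 (W : Matrix (Fin N) (Fin N) ℝ) (part : Fin N → Fin K) (k : Fin K) (y : Fin N → ℝ)
    (ρ : ℝ) : Fin N → ℝ :=
  y ᵥ* ((S W ρ)ᵀ * W * D W ρ * J part k * D W ρ * (S W ρ)ᵀ)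

/-- The `p × N` matrix `T₃ₖ = Xᵀ S D J_k D Sᵀ`. -/
def T3 (W : Matrix (Fin N) (Fin N) ℝ) (part : Fin N → Fin K) (k : Fin K)
    (X : Matrix (Fin N) (Fin p) ℝ) (ρ : ℝ) : Matrix (Fin p) (Fin N) ℝ :=
  Xᵀ * S W ρ * D W ρ * J part k * D W ρ * (S W ρ)ᵀ

/-- The diagonal entry of the estimator of `Σ₁ₖₗ` that belongs to `ρ`:
`4 (N_k N_l)^(-1/2) [σ̂_ε⁴ {tr(Ξ†_k Ξ†_l) + tr(V₁ₖᵀ V₂ₗ) + σ̂⁻² (T₁ₖ T₂ₗᵀ + T₂ₖ T₁ₗᵀ)} + σ̂_ε² T₁ₖ T₁ₗᵀ]`. -/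
def hatRho (W : Matrix (Fin N) (Fin N) ℝ) (part : Fin N → Fin K) (y : Fin N → ℝ)
    (X : Matrix (Fin N) (Fin p) ℝ) (θ : Idx p → ℝ) (k l : Fin K) : ℝ :=
  4 / √(size part k * size part l) *
    (sigmaEpsSq W y X θ ^ 2 *
        ((XiDag W part k (rho θ) * XiDag W part l (rho θ)).trace
          + ((V1 W part k (rho θ))ᵀ * V2 W part l (rho θ)).trace
          + (sigmaSq W y θ)⁻¹ *
            (T1 W part k y (rho θ) ⬝ᵥ T2 W part l y (rho θ)
              + T2 W part k y (rho θ) ⬝ᵥ T1 W part l y (rho θ)))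
      + sigmaEpsSq W y X θ * (T1 W part k y (rho θ) ⬝ᵥ T1 W part l y (rho θ)))

/-- The block row `(ρ, β)` of the estimator of `Σ₁ₖₗ`: `4 σ̂_ε² (N_k N_l)^(-1/2) T₁ₖ T₃ₗᵀ`. -/
def hatRhoBeta (W : Matrix (Fin N) (Fin N) ℝ) (part : Fin N → Fin K) (y : Fin N → ℝ)
    (X : Matrix (Fin N) (Fin p) ℝ) (θ : Idx p → ℝ) (k l : Fin K) : Fin p → ℝ :=
  (4 * sigmaEpsSq W y X θ / √(size part k * size part l)) •
    (T1 W part k y (rho θ) ᵥ* (T3 W part l X (rho θ))ᵀ)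

/-- The block `(β, β)` of the estimator of `Σ₁ₖₗ`: `4 σ̂_ε² (N_k N_l)^(-1/2) T₃ₖ T₃ₗᵀ`. -/
def hatBeta (W : Matrix (Fin N) (Fin N) ℝ) (part : Fin N → Fin K) (y : Fin N → ℝ)
    (X : Matrix (Fin N) (Fin p) ℝ) (θ : Idx p → ℝ) (k l : Fin K) : Matrix (Fin p) (Fin p) ℝ :=
  (4 * sigmaEpsSq W y X θ / √(size part k * size part l)) •
    (T3 W part k X (rho θ) * (T3 W part l X (rho θ))ᵀ)

/-- The estimator of `Σ₁ₖₗ` computed from the data `(W, y, X)` at the parameter value `θ`.  Since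
`Σ₁ₖₗᵀ = Σ₁ₗₖ`, its `(β, ρ)` block is the transposed `(ρ, β)` block for the pair `(l, k)`. -/
def hatSigma1kl (W : Matrix (Fin N) (Fin N) ℝ) (part : Fin N → Fin K) (y : Fin N → ℝ)
    (X : Matrix (Fin N) (Fin p) ℝ) (θ : Idx p → ℝ) (k l : Fin K) : Matrix (Idx p) (Idx p) ℝ :=
  Matrix.fromBlocks
    (Matrix.of fun _ _ => hatRho W part y X θ k l)
    (Matrix.of fun _ j => hatRhoBeta W part y X θ k l j)
    (Matrix.of fun j _ => hatRhoBeta W part y X θ l k j)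
    (hatBeta W part y X θ k l)

/-- `Σ̂₁ = ∑_{k,l} √(α_k α_l) Σ̂₁ₖₗ`. -/
def hatSigma1 (W : Matrix (Fin N) (Fin N) ℝ) (part : Fin N → Fin K) (y : Fin N → ℝ)
    (X : Matrix (Fin N) (Fin p) ℝ) (θ : Idx p → ℝ) : Matrix (Idx p) (Idx p) ℝ :=
  ∑ k, ∑ l, √(weight part k * weight part l) • hatSigma1kl W part y X θ k l

end Estimator

/-- `Z_N = O_p(1)` as `N → ∞`. -/
def BoundedInProb {Ω : Type*} [MeasurableSpace Ω] (P : Measure Ω) (Z : ℕ → Ω → ℝ) : Prop :=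
  ∀ η : ℝ, 0 < η → ∃ C : ℝ, ∀ᶠ N in atTop, P {ω | C < |Z N ω|} ≤ ENNReal.ofReal η

end SAR

end

/-!
The workers disappear from both sides. Since `√(α_k α_l) √(N_k N_l) = N_k N_l / N` and
`∑ N_k Q̇_k` is the gradient of `‖F‖²`, the matrix `Σ₁` is `N⁻¹` times the covariance matrix of
the gradient of the global objective (`Sigma1_apply`); since `∑ J_k = I`, the estimator `Σ̂₁` is
the same expression with every `J_k` replaced by the identity (`hatSigma1_apply`). Both are then
independent of the partition.

At `θ₀` the coordinate `a` of the gradient is a quadratic polynomial `eᵀ A_a e + d_aᵀ e` of the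
errors (`score_eq_quad`), where `A_a` depends on the network only and
`d_a = -2 H B_a X b_a` with `H = S D² Sᵀ`, `B_ρ = W S⁻¹`, `b_ρ = β₀`, and `B = I` and a unit vector
`b` for a coordinate of `β`. Gaussian moments give the covariance of two such polynomials as
`v² {tr (A A') + tr (A A'ᵀ)} + v dᵀ d'` (`covariance_quad`). The normalized products `dᵀ d'` are
bilinear forms in the independent rows of `X`; in the mean they are traces of `B_aᵀ Hᵀ H B_b`, and
this leads to a nonrandom matrix (`limitSigma`), which is equal to the unconditional `Σ₁` because
the conditional mean `v tr A_a` of the score does not depend on `X`.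

The estimator approaches the same matrix. Its terms are traces of products of `S`, `W`, `D`, `Ḋ`,
and bilinear forms in `S⁻¹ (X β₀ + ε)`, `X β₀ + ε` and the columns of `X`, whose means are traces
again. That the limits agree is an algebraic identity (`trace_scoreMat_mul_self`,
`trace_scoreMat_mul_transpose`): `A_ρᵀ` is similar to `2 Ξ†`, and `tr (A_ρ A_ρᵀ)` splits into the
contributions of `V₁ᵀ V₂` and of `T₁ T₂ᵀ`, and a Gram term. This Gram term compensates for the
excess of `T₁ T₁ᵀ`, in which `y` carries the errors while `d_ρ` does not.

For the analysis, call a quantity moderate if it is bounded by a power of `log N`, and negligible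
if it decays faster than every power of `(log N)⁻¹`.
* For a matrix `W` with nonnegative entries, `‖W‖ ≤ 2 |λ_max (W + Wᵀ)|` (`IsStochastic.norm_le`),
  so the operator norms of `W`, `S`, `D`, `Ḋ` are moderate. A parameter error `O_p(N^(-κ))` is
  negligible, and sums and products of moderate quantities depend on it negligibly (`Close.map₂`).
  So `θ̂` may be replaced by `θ₀`; normalized traces and inner products of vectors of length
  `O(√N)` are controlled by operator norms.
* The resolvent `S⁻¹` need not have a moderate operator norm. Its rows have absolute sums at most
  `(1 - |ρ|)⁻¹`, which bounds `N⁻¹ ‖S⁻¹‖_F²`. Its Neumann series, cut at `√(log N)` terms, has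
  operator norm at most `(C log N)^√(log N)`, up to a factor `√(log N)`, and the remainder is at
  most `√N |ρ|^√(log N)` in Frobenius norm; hence `N^(-1/2) ‖S⁻¹‖` is negligible
  (`NetworkCondition.decay_norm_S_inv`). These two facts (`Thin`) suffice for the bilinear forms:
  the variance of `N⁻¹ xᵀ M y` is at most a constant times `N⁻² ‖M‖_F²`
  (`second_moment_bilinear_le`), and for `M = Bᵀ A C` this is at most
  `(N^(-1/2) ‖B‖)² ‖A‖² (N⁻¹ ‖C‖_F²)`.

Statements that hold with probability tending to one are statements along the filter `whp P` on
`ℕ × Ω`, so that the ordinary calculus of limits applies to them.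
-/

noncomputable section

namespace SAR

open Asymptotics

/-! ### Moderate growth and superpolynomial decay along a filter -/

section Growth

variable {ι : Type*} {l : Filter ι} {k : ι → ℝ}

/-- `f` grows at most like a power of the scale `k` along the filter `l`. It is the class of
multipliers of `SuperpolynomialDecay l k`. -/
def Moderate (l : Filter ι) (k : ι → ℝ) (f : ι → ℝ) : Prop :=
  ∃ m : ℕ, f =O[l] fun i => k i ^ m

lemma Moderate.mono {f g : ι → ℝ} (hg : Moderate l k g) (h : ∀ᶠ i in l, |f i| ≤ |g i|) :
    Moderate l k f := by
  obtain ⟨m, hm⟩ := hg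
  exact ⟨m, (IsBigO.of_bound 1 (by simpa using h)).trans hm⟩

lemma moderate_const (c : ℝ) : Moderate l k fun _ => c :=
  ⟨0, by simpa using isBigO_const_const c (one_ne_zero (α := ℝ)) l⟩

lemma isBigO_pow_pow (hk : Tendsto k l atTop) {m n : ℕ} (h : m ≤ n) :
    (fun i => k i ^ m) =O[l] fun i => k i ^ n := by
  refine IsBigO.of_bound 1 ?_
  filter_upwards [hk.eventually_ge_atTop 1] with i hi
  have : 0 ≤ k i := by linarith
  rw [one_mul, Real.norm_of_nonneg (by positivity), Real.norm_of_nonneg (by positivity)]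
  exact pow_le_pow_right₀ hi h

lemma Moderate.add (hk : Tendsto k l atTop) {f g : ι → ℝ} (hf : Moderate l k f)
    (hg : Moderate l k g) : Moderate l k fun i => f i + g i := by
  obtain ⟨m, hm⟩ := hf
  obtain ⟨n, hn⟩ := hg
  exact ⟨max m n, (hm.trans (isBigO_pow_pow hk (le_max_left _ _))).add
    (hn.trans (isBigO_pow_pow hk (le_max_right _ _)))⟩

lemma Moderate.mul {f g : ι → ℝ} (hf : Moderate l k f) (hg : Moderate l k g) :
    Moderate l k fun i => f i * g i := by
  obtain ⟨m, hm⟩ := hf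
  obtain ⟨n, hn⟩ := hg
  exact ⟨m + n, by simpa only [pow_add] using hm.mul hn⟩

lemma decay_of_abs_le {f g : ι → ℝ} (hg : SuperpolynomialDecay l k g)
    (h : ∀ᶠ i in l, |f i| ≤ |g i|) : SuperpolynomialDecay l k f :=
  hg.trans_eventually_abs_le h

lemma decay_mul_moderate {f g : ι → ℝ} (hf : SuperpolynomialDecay l k f) (hg : Moderate l k g) :
    SuperpolynomialDecay l k fun i => f i * g i := by
  obtain ⟨m, hm⟩ := hg
  obtain ⟨C, hC⟩ := hm.bound
  refine ((hf.mul_param_pow m).mul_const C).trans_eventually_abs_le ?_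
  filter_upwards [hC] with i hi
  simp only [Pi.mul_apply, Function.comp_apply, Pi.pow_apply]
  rw [abs_mul, abs_mul, abs_mul, mul_assoc]
  refine mul_le_mul_of_nonneg_left ?_ (abs_nonneg _)
  simp only [Real.norm_eq_abs] at hi
  refine hi.trans ?_
  rw [mul_comm]
  exact mul_le_mul_of_nonneg_left (le_abs_self C) (abs_nonneg _)

lemma moderate_mul_decay {f g : ι → ℝ} (hf : Moderate l k f) (hg : SuperpolynomialDecay l k g) :
    SuperpolynomialDecay l k fun i => f i * g i := by
  simpa only [mul_comm] using decay_mul_moderate hg hf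

lemma decay_moderate {f : ι → ℝ} (hf : SuperpolynomialDecay l k f) : Moderate l k f :=
  ⟨0, by simpa using (hf 0).isBigO_one ℝ⟩

lemma decay_sub {f g : ι → ℝ} (hf : SuperpolynomialDecay l k f)
    (hg : SuperpolynomialDecay l k g) : SuperpolynomialDecay l k fun i => f i - g i := by
  refine (hf.add (hg.const_mul (-1))).congr fun i => ?_
  simp only [Pi.add_apply]
  ring

lemma decay_zero : SuperpolynomialDecay l k fun _ => 0 :=
  superpolynomialDecay_zero l k

end Growth

/-! ### Families that agree up to superpolynomial decay -/

section Close

variable {ι : Type*} {l : Filter ι} {k : ι → ℝ}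
  {E F G : ι → Type*} [∀ i, SeminormedAddCommGroup (E i)] [∀ i, SeminormedAddCommGroup (F i)]
  [∀ i, SeminormedAddCommGroup (G i)]

/-- Two families `x`, `x'` in normed groups that may vary with the index: the reference family `x'`
has moderate growth, and the difference decays superpolynomially. -/
structure Close (l : Filter ι) (k : ι → ℝ) (x x' : ∀ i, E i) : Prop where
  moderate : Moderate l k fun i => ‖x' i‖
  decay : SuperpolynomialDecay l k fun i => ‖x i - x' i‖

lemma Close.moderate_left (hk : Tendsto k l atTop) {x x' : ∀ i, E i} (h : Close l k x x') :
    Moderate l k fun i => ‖x i‖ := by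
  refine ((decay_moderate h.decay).add hk h.moderate).mono (Eventually.of_forall fun i => ?_)
  rw [abs_of_nonneg (norm_nonneg _), abs_of_nonneg (by positivity)]
  simpa using norm_add_le (x i - x' i) (x' i)

lemma Close.refl {x : ∀ i, E i} (h : Moderate l k fun i => ‖x i‖) : Close l k x x :=
  ⟨h, by simpa only [sub_self, norm_zero] using decay_zero⟩

lemma Close.trans {x y z : ∀ i, E i} (h : Close l k x y) (h' : Close l k y z) : Close l k x z := by
  refine ⟨h'.moderate, decay_of_abs_le (h.decay.add h'.decay) (Eventually.of_forall fun i => ?_)⟩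
  simp only [Pi.add_apply]
  rw [abs_of_nonneg (norm_nonneg _), abs_of_nonneg (by positivity)]
  simpa using norm_add_le (x i - y i) (y i - z i)

lemma Close.congr' {x x' y y' : ∀ i, E i} (h : Close l k x x') (hx : ∀ᶠ i in l, x i = y i)
    (hx' : ∀ᶠ i in l, x' i = y' i) : Close l k y y' := by
  refine ⟨h.moderate.mono ?_, h.decay.congr' ?_⟩
  · filter_upwards [hx'] with i hi using by rw [hi]
  · filter_upwards [hx, hx'] with i hi hi' using by rw [hi, hi']

lemma Close.add (hk : Tendsto k l atTop) {x x' y y' : ∀ i, E i} (h : Close l k x x')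
    (h' : Close l k y y') : Close l k (fun i => x i + y i) fun i => x' i + y' i := by
  refine ⟨(h.moderate.add hk h'.moderate).mono (Eventually.of_forall fun i => ?_),
    decay_of_abs_le (h.decay.add h'.decay) (Eventually.of_forall fun i => ?_)⟩
  · rw [abs_of_nonneg (norm_nonneg _), abs_of_nonneg (by positivity)]
    exact norm_add_le _ _
  · simp only [Pi.add_apply]
    rw [abs_of_nonneg (norm_nonneg _), abs_of_nonneg (by positivity), add_sub_add_comm]
    exact norm_add_le _ _

/-- A family of additive maps that do not increase the norm preserves closeness. -/
lemma Close.map {x x' : ∀ i, E i} (h : Close l k x x') (T : ∀ i, E i → F i)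
    (hT : ∀ i a b, T i (a - b) = T i a - T i b) (hn : ∀ i a, ‖T i a‖ ≤ ‖a‖) :
    Close l k (fun i => T i (x i)) fun i => T i (x' i) := by
  refine ⟨h.moderate.mono (Eventually.of_forall fun i => ?_),
    decay_of_abs_le h.decay (Eventually.of_forall fun i => ?_)⟩
  · simpa using hn i (x' i)
  · simpa [hT] using hn i (x i - x' i)

/-- A family of biadditive maps with `‖B x y‖ ≤ ‖x‖ ‖y‖` preserves closeness. -/
lemma Close.map₂ (hk : Tendsto k l atTop) {x x' : ∀ i, E i} {y y' : ∀ i, F i}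
    (h : Close l k x x') (h' : Close l k y y') (B : ∀ i, E i → F i → G i)
    (hl : ∀ i a b c, B i (a - b) c = B i a c - B i b c)
    (hr : ∀ i a b c, B i a (b - c) = B i a b - B i a c)
    (hn : ∀ i a b, ‖B i a b‖ ≤ ‖a‖ * ‖b‖) :
    Close l k (fun i => B i (x i) (y i)) fun i => B i (x' i) (y' i) := by
  refine ⟨(h.moderate.mul h'.moderate).mono (Eventually.of_forall fun i => ?_),
    decay_of_abs_le ((decay_mul_moderate h.decay (h'.moderate_left hk)).add
      (moderate_mul_decay h.moderate h'.decay)) (Eventually.of_forall fun i => ?_)⟩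
  · rw [abs_of_nonneg (norm_nonneg _), abs_of_nonneg (by positivity)]
    exact hn _ _ _
  · simp only [Pi.add_apply]
    rw [abs_of_nonneg (norm_nonneg _), abs_of_nonneg (by positivity)]
    have e : B i (x i) (y i) - B i (x' i) (y' i)
        = B i (x i - x' i) (y i) + B i (x' i) (y i - y' i) := by
      rw [hl, hr]; abel
    rw [e]
    exact (norm_add_le _ _).trans (add_le_add (hn _ _ _) (hn _ _ _))

lemma Close.neg {x x' : ∀ i, E i} (h : Close l k x x') :
    Close l k (fun i => -x i) fun i => -x' i :=
  h.map (fun _ a => -a) (fun _ a b => by abel) fun _ a => (norm_neg a).le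

lemma Close.sub (hk : Tendsto k l atTop) {x x' y y' : ∀ i, E i} (h : Close l k x x')
    (h' : Close l k y y') : Close l k (fun i => x i - y i) fun i => x' i - y' i := by
  simpa only [sub_eq_add_neg] using h.add hk h'.neg

lemma Close.smul (hk : Tendsto k l atTop) [∀ i, NormedSpace ℝ (E i)] {c c' : ι → ℝ}
    {x x' : ∀ i, E i} (h : Close l k c c') (h' : Close l k x x') :
    Close l k (fun i => c i • x i) fun i => c' i • x' i :=
  h.map₂ hk h' (fun _ a b => a • b) (fun _ a b c => sub_smul a b c)
    (fun _ a b c => smul_sub a b c) fun _ a b => (norm_smul a b).le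

lemma Close.sum (hk : Tendsto k l atTop) {κ : Type*} (s : Finset κ) {x x' : κ → ∀ i, E i}
    (h : ∀ j ∈ s, Close l k (x j) (x' j)) :
    Close l k (fun i => ∑ j ∈ s, x j i) fun i => ∑ j ∈ s, x' j i := by
  classical
  induction s using Finset.induction_on with
  | empty =>
    simp only [Finset.sum_empty]
    exact Close.refl (by simpa using moderate_const 0)
  | insert a s ha ih =>
    simp only [Finset.sum_insert ha]
    exact (h a (by simp)).add hk (ih fun j hj => h j (by simp [hj]))

lemma Close.mul (hk : Tendsto k l atTop) {R : ι → Type*} [∀ i, SeminormedRing (R i)]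
    {x x' y y' : ∀ i, R i} (h : Close l k x x')
    (h' : Close l k y y') : Close l k (fun i => x i * y i) fun i => x' i * y' i :=
  h.map₂ hk h' (fun _ a b => a * b) (fun _ a b c => sub_mul a b c)
    (fun _ a b c => mul_sub a b c) fun _ a b => norm_mul_le a b

lemma close_const {E : Type*} [SeminormedAddCommGroup E] (c : E) :
    Close l k (fun _ => c) fun _ => c :=
  Close.refl (moderate_const _)

/-- Inversion near a nonzero constant. -/
lemma Close.inv {x : ι → ℝ} {c : ℝ} (hc : 0 < c)
    (h : Close l k x fun _ => c) : Close l k (fun i => (x i)⁻¹) fun _ => c⁻¹ := by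
  refine ⟨moderate_const _, decay_of_abs_le (h.decay.mul_const (2 / (c * c))) ?_⟩
  have h0 : Tendsto (fun i => |x i - c|) l (𝓝 0) := by simpa using h.decay 0
  filter_upwards [h0.eventually_lt_const (half_pos hc)] with i hi
  have hx : c / 2 < x i := by linarith [neg_abs_le (x i - c)]
  have hx0 : 0 < x i := by linarith
  rw [abs_of_nonneg (norm_nonneg _), abs_of_nonneg (by positivity), Real.norm_eq_abs,
    Real.norm_eq_abs]
  have e : (x i)⁻¹ - c⁻¹ = -(x i - c) / (x i * c) := by field_simp; ring
  rw [e, abs_div, abs_neg, abs_of_pos (mul_pos hx0 hc), div_eq_mul_inv]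
  refine mul_le_mul_of_nonneg_left ?_ (abs_nonneg _)
  rw [inv_eq_one_div, div_le_div_iff₀ (by positivity) (by positivity)]
  nlinarith

lemma close_of_decay {x : ι → ℝ} {c : ℝ} (h : SuperpolynomialDecay l k fun i => x i - c) :
    Close l k x fun _ => c :=
  ⟨moderate_const _, decay_of_abs_le h (Eventually.of_forall fun i => by simp)⟩

lemma Close.decay_sub {x x' : ι → ℝ} (h : Close l k x x') :
    SuperpolynomialDecay l k fun i => x i - x' i :=
  decay_of_abs_le h.decay (Eventually.of_forall fun i => by simp)

/-- Passage to a reference of which only the closeness to `y`, not the growth, is known. -/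
lemma Close.trans_decay {x y x' : ι → ℝ} (hk : Tendsto k l atTop) (h : Close l k x y)
    (h' : SuperpolynomialDecay l k fun i => y i - x' i) : Close l k x x' := by
  have hd : SuperpolynomialDecay l k fun i => ‖y i - x' i‖ :=
    decay_of_abs_le h' (Eventually.of_forall fun i => by simp)
  refine h.trans ⟨(h.moderate.add hk (decay_moderate hd)).mono (Eventually.of_forall fun i => ?_),
    hd⟩
  rw [abs_of_nonneg (norm_nonneg _), abs_of_nonneg (by positivity)]
  simpa using norm_sub_le (y i) (y i - x' i)

end Close

/-! ### Convergence with high probability as a filter -/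

section HighProbability

variable {Ω : Type*} [MeasurableSpace Ω] {P : Measure Ω}

/-- The filter on `ℕ × Ω` of the sets whose `N`-th section has a complement of (outer) measure
tending to `0`. Limits along this filter are limits in probability. -/
def whp (P : Measure Ω) : Filter (ℕ × Ω) where
  sets := {A | Tendsto (fun N : ℕ => P {ω | (N, ω) ∉ A}) atTop (𝓝 0)}
  univ_sets := by simp
  sets_of_superset := by
    intro A B hA hAB
    exact tendsto_of_tendsto_of_tendsto_of_le_of_le tendsto_const_nhds hA (fun _ => zero_le)
      fun N => measure_mono fun ω h h' => h (hAB h')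
  inter_sets := by
    intro A B hA hB
    have h := Tendsto.add hA hB
    rw [add_zero] at h
    refine tendsto_of_tendsto_of_tendsto_of_le_of_le tendsto_const_nhds h (fun _ => zero_le)
      fun N => (measure_mono ?_).trans (measure_union_le _ _)
    intro ω hω
    simp only [Set.mem_ofPred_eq, Set.mem_inter_iff, not_and_or] at hω
    exact hω

/-- The logarithmic scale `log N`. -/
def lg (q : ℕ × Ω) : ℝ := Real.log (q.1 : ℝ)

lemma eventually_whp {p : ℕ × Ω → Prop} :
    (∀ᶠ q in whp P, p q) ↔ Tendsto (fun N : ℕ => P {ω | ¬ p (N, ω)}) atTop (𝓝 0) := Iff.rfl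

lemma tendsto_fst_whp : Tendsto Prod.fst (whp P) atTop := by
  refine tendsto_atTop.2 fun M => ?_
  rw [eventually_whp]
  refine tendsto_const_nhds.congr' ?_
  filter_upwards [eventually_ge_atTop M] with N hN
  simp [hN]

lemma tendsto_log_natCast : Tendsto (fun N : ℕ => Real.log (N : ℝ)) atTop atTop :=
  Real.tendsto_log_atTop.comp tendsto_natCast_atTop_atTop

lemma tendsto_lg : Tendsto (lg (Ω := Ω)) (whp P) atTop :=
  tendsto_log_natCast.comp tendsto_fst_whp

lemma decay_fst {f : ℕ → ℝ}
    (h : SuperpolynomialDecay atTop (fun N : ℕ => Real.log (N : ℝ)) f) :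
    SuperpolynomialDecay (whp P) lg fun q => f q.1 :=
  fun m => (h m).comp tendsto_fst_whp

lemma moderate_fst {f : ℕ → ℝ} (h : Moderate atTop (fun N : ℕ => Real.log (N : ℝ)) f) :
    Moderate (whp P) lg fun q => f q.1 := by
  obtain ⟨m, hm⟩ := h
  exact ⟨m, hm.comp_tendsto tendsto_fst_whp⟩

lemma tendstoInMeasure_of_decay {Z : ℕ × Ω → ℝ} (h : SuperpolynomialDecay (whp P) lg Z) :
    TendstoInMeasure P (fun N ω => Z (N, ω)) atTop fun _ => 0 := by
  have h0 : Tendsto Z (whp P) (𝓝 0) := by simpa using h 0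
  intro r hr
  obtain rfl | hr' := eq_or_ne r ⊤
  · refine tendsto_const_nhds.congr fun N => ?_
    simp
  have := (tendsto_order.1 (h0.edist (tendsto_const_nhds (x := (0 : ℝ))))).2 r (by simpa using hr)
  rw [eventually_whp] at this
  simpa only [not_lt] using this

lemma decay_rpow_neg {κ : ℝ} (hκ : 0 < κ) :
    SuperpolynomialDecay atTop (fun N : ℕ => Real.log (N : ℝ)) fun N : ℕ => (N : ℝ) ^ (-κ) := by
  intro m
  have h := (isLittleO_log_rpow_rpow_atTop m hκ).tendsto_div_nhds_zero.comp
    tendsto_natCast_atTop_atTop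
  refine h.congr fun N => ?_
  simp only [Function.comp_apply]
  rw [Real.rpow_neg (Nat.cast_nonneg _), div_eq_mul_inv, Real.rpow_natCast]

/-- A quantity that is `O_p(N^(-κ))` for some `κ > 0` decays superpolynomially in `log N`. -/
lemma decay_of_boundedInProb {κ : ℝ} (hκ : 0 < κ) {Z : ℕ → Ω → ℝ}
    (h : BoundedInProb P fun N ω => (N : ℝ) ^ κ * Z N ω) :
    SuperpolynomialDecay (whp P) lg fun q => Z q.1 q.2 := by
  have hb : ∀ᶠ q in whp P, |((q.1 : ℝ)) ^ κ * Z q.1 q.2| ≤ lg q := by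
    rw [eventually_whp, ENNReal.tendsto_nhds_zero]
    intro η hη
    obtain ⟨η', hη', hle⟩ : ∃ η' : ℝ, 0 < η' ∧ ENNReal.ofReal η' ≤ η := by
      obtain rfl | hη2 := eq_or_ne η ⊤
      · exact ⟨1, one_pos, le_top⟩
      · exact ⟨η.toReal, ENNReal.toReal_pos hη.ne' hη2, ENNReal.ofReal_toReal_le⟩
    obtain ⟨C, hC⟩ := h η' hη'
    filter_upwards [hC, tendsto_log_natCast.eventually_ge_atTop C] with N hN hCN
    refine (measure_mono fun ω hω => ?_).trans (hN.trans hle)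
    simp only [Set.mem_ofPred_eq, not_le, lg] at hω ⊢
    linarith
  refine ((decay_fst (decay_rpow_neg hκ)).mul_param).trans_eventually_abs_le ?_
  filter_upwards [hb, tendsto_fst_whp.eventually_ge_atTop 1] with q hq hN
  have hN' : (0 : ℝ) < q.1 := by exact_mod_cast hN
  have hpos : (0 : ℝ) < (q.1 : ℝ) ^ κ := Real.rpow_pos_of_pos hN' κ
  simp only [Pi.mul_apply, Function.comp_apply]
  rw [abs_mul, abs_of_pos hpos] at hq
  rw [Real.rpow_neg hN'.le]
  refine le_trans ?_ (le_abs_self _)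
  rw [inv_mul_eq_div, le_div_iff₀ hpos, mul_comm]
  exact hq

/-- Chebyshev's inequality: second moments that decay superpolynomially force decay with high
probability. -/
lemma decay_of_second_moment [IsFiniteMeasure P] {Z : ℕ → Ω → ℝ} {r : ℕ → ℝ}
    (hr : SuperpolynomialDecay atTop (fun N : ℕ => Real.log (N : ℝ)) r)
    (h : ∀ᶠ N in atTop, MemLp (Z N) 2 P ∧ ∫ ω, Z N ω ^ 2 ∂P ≤ r N) :
    SuperpolynomialDecay (whp P) lg fun q => Z q.1 q.2 := by
  intro m
  rw [Metric.tendsto_nhds]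
  intro δ hδ
  rw [eventually_whp]
  have h1 : Tendsto (fun N : ℕ => ENNReal.ofReal
      ((δ ^ 2)⁻¹ * (Real.log (N : ℝ) ^ (2 * m) * r N))) atTop (𝓝 0) := by
    have := (ENNReal.tendsto_ofReal ((hr (2 * m)).const_mul (δ ^ 2)⁻¹))
    simpa using this
  refine tendsto_of_tendsto_of_tendsto_of_le_of_le' tendsto_const_nhds h1
    (Eventually.of_forall fun _ => zero_le) ?_
  filter_upwards [h, eventually_ge_atTop 1] with N ⟨hL, hI⟩ hN1
  have hlog : 0 ≤ Real.log (N : ℝ) := Real.log_nonneg (by exact_mod_cast hN1)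
  have hint : Integrable (fun ω => (Real.log (N : ℝ) ^ m * Z N ω) ^ 2) P :=
    (hL.const_mul _).integrable_sq
  have hM := mul_meas_ge_le_integral_of_nonneg (μ := P)
    (Eventually.of_forall fun ω => sq_nonneg (Real.log (N : ℝ) ^ m * Z N ω)) hint (δ ^ 2)
  have hset : {ω | ¬ dist (lg (N, ω) ^ m * Z N ω) 0 < δ}
      ⊆ {ω | δ ^ 2 ≤ (Real.log (N : ℝ) ^ m * Z N ω) ^ 2} := by
    intro ω hω
    simp only [Set.mem_ofPred_eq, not_lt, Real.dist_eq, sub_zero, lg] at hω ⊢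
    rw [← sq_abs (Real.log (N : ℝ) ^ m * Z N ω)]
    exact pow_le_pow_left₀ hδ.le hω 2
  refine (measure_mono hset).trans ?_
  rw [← ENNReal.ofReal_toReal (measure_ne_top P {ω | δ ^ 2 ≤ (Real.log (N : ℝ) ^ m * Z N ω) ^ 2})]
  refine ENNReal.ofReal_le_ofReal ?_
  rw [inv_mul_eq_div, le_div_iff₀ (by positivity), mul_comm]
  refine hM.trans ?_
  simp only [mul_pow]
  rw [integral_const_mul, ← pow_mul, mul_comm m 2]
  exact mul_le_mul_of_nonneg_left hI (by positivity)

end HighProbability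

/-! ### Operator and Frobenius norms of matrices -/

section MatrixNorm

open scoped Matrix.Norms.L2Operator

variable {N : ℕ}

lemma norm_transpose (A : Matrix (Fin N) (Fin N) ℝ) : ‖Aᵀ‖ = ‖A‖ := by
  rw [← conjTranspose_eq_transpose_of_trivial, l2_opNorm_conjTranspose]

/-- The vector `N^(-1/2) y` in Euclidean space, so that its squared norm is the mean of the squared
entries of `y`. -/
def scaled (y : Fin N → ℝ) : EuclideanSpace ℝ (Fin N) := (√(N : ℝ))⁻¹ • WithLp.toLp 2 y

lemma scaled_sub (y z : Fin N → ℝ) : scaled (y - z) = scaled y - scaled z := by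
  simp [scaled, smul_sub]

lemma scaled_smul (c : ℝ) (y : Fin N → ℝ) : scaled (c • y) = c • scaled y := by
  simp [scaled, smul_comm c]

lemma inner_scaled (y z : Fin N → ℝ) :
    inner ℝ (scaled y) (scaled z) = (N : ℝ)⁻¹ * (y ⬝ᵥ z) := by
  rw [scaled, scaled, real_inner_smul_left, real_inner_smul_right, ← mul_assoc, ← mul_inv,
    Real.mul_self_sqrt (Nat.cast_nonneg _), EuclideanSpace.inner_toLp_toLp, dotProduct_comm]
  simp

lemma norm_scaled_sq (y : Fin N → ℝ) : ‖scaled y‖ ^ 2 = (N : ℝ)⁻¹ * (y ⬝ᵥ y) := by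
  rw [← inner_scaled, real_inner_self_eq_norm_sq]

lemma norm_toLp_sq (y : Fin N → ℝ) : ‖WithLp.toLp 2 y‖ ^ 2 = y ⬝ᵥ y := by
  rw [EuclideanSpace.real_norm_sq_eq]
  simp [dotProduct, sq]

lemma dotProduct_mulVec_self_le (A : Matrix (Fin N) (Fin N) ℝ) (y : Fin N → ℝ) :
    (A *ᵥ y) ⬝ᵥ (A *ᵥ y) ≤ ‖A‖ ^ 2 * (y ⬝ᵥ y) := by
  rw [← norm_toLp_sq, ← norm_toLp_sq, ← mul_pow]
  exact pow_le_pow_left₀ (norm_nonneg _) (l2_opNorm_mulVec A (WithLp.toLp 2 y)) 2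

lemma abs_apply_le_norm (A : Matrix (Fin N) (Fin N) ℝ) (i j : Fin N) : |A i j| ≤ ‖A‖ := by
  have h := dotProduct_mulVec_self_le A (Pi.single j 1)
  rw [mulVec_single_one, dotProduct_single, Pi.single_eq_same, one_mul, mul_one] at h
  refine abs_le_of_sq_le_sq (le_trans ?_ h) (norm_nonneg _)
  rw [sq, dotProduct]
  exact Finset.single_le_sum (f := fun i => A.col j i * A.col j i)
    (fun i _ => mul_self_nonneg _) (Finset.mem_univ i)

lemma norm_normalized_trace_le (A : Matrix (Fin N) (Fin N) ℝ) :
    ‖(N : ℝ)⁻¹ * A.trace‖ ≤ ‖A‖ := by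
  have h : |A.trace| ≤ N * ‖A‖ := by
    refine (Finset.abs_sum_le_sum_abs _ _).trans ?_
    refine (Finset.sum_le_sum fun i _ => abs_apply_le_norm A i i).trans ?_
    simp
  rw [norm_mul, norm_inv, Real.norm_natCast, Real.norm_eq_abs]
  obtain hN | hN := (Nat.cast_nonneg N : (0 : ℝ) ≤ N).eq_or_lt
  · rw [← hN]; simp
  · rwa [inv_mul_le_iff₀ hN]

/-- The squared Frobenius norm. -/
def frobSq (A : Matrix (Fin N) (Fin N) ℝ) : ℝ := ∑ i, ∑ j, A i j ^ 2

lemma frobSq_nonneg (A : Matrix (Fin N) (Fin N) ℝ) : 0 ≤ frobSq A :=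
  Finset.sum_nonneg fun _ _ => Finset.sum_nonneg fun _ _ => sq_nonneg _

lemma frobSq_transpose (A : Matrix (Fin N) (Fin N) ℝ) : frobSq Aᵀ = frobSq A :=
  Finset.sum_comm

lemma frobSq_eq_sum_col (A : Matrix (Fin N) (Fin N) ℝ) :
    frobSq A = ∑ j, A.col j ⬝ᵥ A.col j := by
  rw [← frobSq_transpose]
  simp [frobSq, dotProduct, sq]

lemma trace_transpose_mul_self (A : Matrix (Fin N) (Fin N) ℝ) : (Aᵀ * A).trace = frobSq A := by
  rw [frobSq_eq_sum_col]; rfl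

lemma frobSq_mul_le (A B : Matrix (Fin N) (Fin N) ℝ) : frobSq (A * B) ≤ ‖A‖ ^ 2 * frobSq B := by
  rw [frobSq_eq_sum_col, frobSq_eq_sum_col, Finset.mul_sum]
  exact Finset.sum_le_sum fun j _ => dotProduct_mulVec_self_le A (B.col j)

lemma frobSq_one : frobSq (1 : Matrix (Fin N) (Fin N) ℝ) = N := by
  rw [← trace_transpose_mul_self]; simp

lemma norm_one_le : ‖(1 : Matrix (Fin N) (Fin N) ℝ)‖ ≤ 1 := by
  rw [← diagonal_one, l2_opNorm_diagonal]
  exact (pi_norm_le_iff_of_nonneg zero_le_one).2 fun i => by simp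

lemma norm_le_of_sq_le {A : Matrix (Fin N) (Fin N) ℝ} {c : ℝ} (hc : 0 ≤ c)
    (h : ∀ y, (A *ᵥ y) ⬝ᵥ (A *ᵥ y) ≤ c ^ 2 * (y ⬝ᵥ y)) : ‖A‖ ≤ c := by
  rw [l2_opNorm_def]
  refine ContinuousLinearMap.opNorm_le_bound _ hc fun y => ?_
  refine (sq_le_sq₀ (norm_nonneg _) (mul_nonneg hc (norm_nonneg _))).1 ?_
  rw [mul_pow]
  have := h y.ofLp
  rw [← norm_toLp_sq, ← norm_toLp_sq] at this
  exact this

lemma norm_le_sqrt_frobSq (A : Matrix (Fin N) (Fin N) ℝ) : ‖A‖ ≤ √(frobSq A) := by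
  refine norm_le_of_sq_le (Real.sqrt_nonneg _) fun y => ?_
  rw [Real.sq_sqrt (frobSq_nonneg A), frobSq, Finset.sum_mul, dotProduct]
  refine Finset.sum_le_sum fun i _ => ?_
  rw [← sq]
  have h := Finset.sum_mul_sq_le_sq_mul_sq Finset.univ (fun j => A i j) y
  simpa only [dotProduct, mulVec, ← sq] using h

lemma frobSq_le_of_row_sum {A : Matrix (Fin N) (Fin N) ℝ} {c : ℝ}
    (h : ∀ i, ∑ j, |A i j| ≤ c) : frobSq A ≤ N * c ^ 2 := by
  have : ∀ i : Fin N, ∑ j, A i j ^ 2 ≤ c ^ 2 := fun i => by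
    have h0 : 0 ≤ ∑ j, |A i j| := Finset.sum_nonneg fun _ _ => abs_nonneg _
    refine le_trans ?_ (pow_le_pow_left₀ h0 (h i) 2)
    refine le_trans (le_of_eq (by simp)) (Finset.sum_sq_le_sq_sum_of_nonneg
      (s := Finset.univ) (f := fun j => |A i j|) fun _ _ => abs_nonneg _)
  refine (Finset.sum_le_sum fun i _ => this i).trans (by simp)

end MatrixNorm

/-! ### Norm bounds for the weight matrix and its resolvent -/

section RowSums

attribute [local instance] Matrix.linftyOpNormedRing Matrix.linftyOpNormedAlgebra

variable {N : ℕ}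

lemma row_sum_le_linftyOpNorm (A : Matrix (Fin N) (Fin N) ℝ) (i : Fin N) :
    ∑ j, |A i j| ≤ ‖A‖ := by
  rw [linfty_opNorm_def]
  have h := Finset.le_sup (f := fun i => ∑ j, ‖A i j‖₊) (Finset.mem_univ i)
  have h' := NNReal.coe_le_coe.2 h
  simpa using h'

lemma linftyOpNorm_le {A : Matrix (Fin N) (Fin N) ℝ} {c : ℝ} (hc : 0 ≤ c)
    (h : ∀ i, ∑ j, |A i j| ≤ c) : ‖A‖ ≤ c := by
  lift c to ℝ≥0 using hc
  rw [linfty_opNorm_def, NNReal.coe_le_coe]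
  refine Finset.sup_le fun i _ => ?_
  rw [← NNReal.coe_le_coe]
  simpa using h i

lemma IsStochastic.linftyOpNorm_le_one {W : Matrix (Fin N) (Fin N) ℝ} (hW : IsStochastic W) :
    ‖W‖ ≤ 1 :=
  linftyOpNorm_le zero_le_one fun i => by simp [abs_of_nonneg (hW.nonneg i _), hW.row_sum i]

lemma IsStochastic.linftyOpNorm_smul_le {W : Matrix (Fin N) (Fin N) ℝ} (hW : IsStochastic W)
    (ρ : ℝ) : ‖ρ • W‖ ≤ |ρ| := by
  rw [norm_smul, Real.norm_eq_abs]
  exact mul_le_of_le_one_right (abs_nonneg _) hW.linftyOpNorm_le_one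

lemma IsStochastic.isUnit_S {W : Matrix (Fin N) (Fin N) ℝ} (hW : IsStochastic W) {ρ : ℝ}
    (hρ : |ρ| < 1) : IsUnit (S W ρ) :=
  isUnit_one_sub_of_norm_lt_one ((hW.linftyOpNorm_smul_le ρ).trans_lt hρ)

lemma IsStochastic.S_mul_inv {W : Matrix (Fin N) (Fin N) ℝ} (hW : IsStochastic W) {ρ : ℝ}
    (hρ : |ρ| < 1) : S W ρ * (S W ρ)⁻¹ = 1 :=
  mul_nonsing_inv _ ((isUnit_iff_isUnit_det _).1 (hW.isUnit_S hρ))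

lemma IsStochastic.S_inv_mul {W : Matrix (Fin N) (Fin N) ℝ} (hW : IsStochastic W) {ρ : ℝ}
    (hρ : |ρ| < 1) : (S W ρ)⁻¹ * S W ρ = 1 :=
  nonsing_inv_mul _ ((isUnit_iff_isUnit_det _).1 (hW.isUnit_S hρ))

lemma IsStochastic.linftyOpNorm_S_inv_le {W : Matrix (Fin N) (Fin N) ℝ} (hW : IsStochastic W)
    {ρ : ℝ} (hρ : |ρ| < 1) : ‖(S W ρ)⁻¹‖ ≤ (1 - |ρ|)⁻¹ := by
  have h1 : ‖(1 : Matrix (Fin N) (Fin N) ℝ)‖ ≤ 1 :=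
    linftyOpNorm_le zero_le_one fun i => by simp [one_apply, apply_ite abs]
  have e : (S W ρ)⁻¹ = 1 + (ρ • W) * (S W ρ)⁻¹ := by
    have h := hW.S_mul_inv hρ
    rw [S, sub_mul, one_mul, sub_eq_iff_eq_add] at h
    exact h
  have h2 : ‖(S W ρ)⁻¹‖ ≤ 1 + |ρ| * ‖(S W ρ)⁻¹‖ := by
    conv_lhs => rw [e]
    refine (norm_add_le _ _).trans (add_le_add h1 ((norm_mul_le _ _).trans ?_))
    exact mul_le_mul_of_nonneg_right (hW.linftyOpNorm_smul_le ρ) (norm_nonneg _)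
  have h3 : 0 < 1 - |ρ| := by linarith
  rw [← one_div (1 - |ρ|), le_div_iff₀ h3]
  linarith

lemma IsStochastic.row_sum_S_inv_mul_pow_le {W : Matrix (Fin N) (Fin N) ℝ} (hW : IsStochastic W)
    {ρ : ℝ} (hρ : |ρ| < 1) (L : ℕ) (i : Fin N) :
    ∑ j, |((S W ρ)⁻¹ * (ρ • W) ^ L) i j| ≤ (1 - |ρ|)⁻¹ * |ρ| ^ L := by
  have h3 : 0 < 1 - |ρ| := by linarith
  refine (row_sum_le_linftyOpNorm _ i).trans ((norm_mul_le _ _).trans ?_)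
  refine mul_le_mul (hW.linftyOpNorm_S_inv_le hρ) ?_ (norm_nonneg _) (by positivity)
  obtain rfl | hL := Nat.eq_zero_or_pos L
  · simpa using linftyOpNorm_le (N := N) zero_le_one
      fun i => by simp [one_apply, apply_ite abs]
  · exact (norm_pow_le' _ hL).trans
      (pow_le_pow_left₀ (norm_nonneg _) (hW.linftyOpNorm_smul_le ρ) L)

lemma S_inv_eq_geom_sum {W : Matrix (Fin N) (Fin N) ℝ} (hW : IsStochastic W)
    {ρ : ℝ} (hρ : |ρ| < 1) (L : ℕ) :
    (S W ρ)⁻¹ = ∑ m ∈ Finset.range L, (ρ • W) ^ m + (S W ρ)⁻¹ * (ρ • W) ^ L := by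
  have h := mul_neg_geom_sum (ρ • W) L
  have h2 := congrArg (fun M => (S W ρ)⁻¹ * M) h
  simp only [← mul_assoc] at h2
  rw [show (1 - ρ • W) = S W ρ from rfl, hW.S_inv_mul hρ, one_mul, mul_sub, mul_one] at h2
  rw [h2]; abel

end RowSums

section OperatorNorm

open scoped Matrix.Norms.L2Operator MatrixOrder

variable {N : ℕ}

lemma IsStochastic.frobSq_S_inv_le {W : Matrix (Fin N) (Fin N) ℝ} (hW : IsStochastic W)
    {ρ : ℝ} (hρ : |ρ| < 1) : frobSq (S W ρ)⁻¹ ≤ N * (1 - |ρ|)⁻¹ ^ 2 :=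
  frobSq_le_of_row_sum fun i => by simpa using hW.row_sum_S_inv_mul_pow_le hρ 0 i

/-- The operator norm of the resolvent: the first terms of the Neumann series are bounded through
powers of `‖W‖`, the remainder through its row sums. -/
lemma IsStochastic.norm_S_inv_le {W : Matrix (Fin N) (Fin N) ℝ} (hW : IsStochastic W)
    {ρ : ℝ} (hρ : |ρ| < 1) {w : ℝ} (hw : 1 ≤ w) (hWw : ‖W‖ ≤ w) (L : ℕ) :
    ‖(S W ρ)⁻¹‖ ≤ L * w ^ L + √N * ((1 - |ρ|)⁻¹ * |ρ| ^ L) := by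
  have h3 : 0 < 1 - |ρ| := by linarith
  rw [S_inv_eq_geom_sum hW hρ L]
  refine (norm_add_le _ _).trans (add_le_add ?_ ?_)
  · refine (norm_sum_le _ _).trans ?_
    refine (Finset.sum_le_card_nsmul _ _ (w ^ L) fun m hm => ?_).trans (by simp)
    have hs : ‖ρ • W‖ ≤ w := by
      rw [norm_smul, Real.norm_eq_abs]
      exact (mul_le_of_le_one_left (norm_nonneg _) hρ.le).trans hWw
    obtain rfl | hm0 := Nat.eq_zero_or_pos m
    · rw [pow_zero]
      exact norm_one_le.trans (one_le_pow₀ hw)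
    · refine (norm_pow_le' _ hm0).trans ((pow_le_pow_left₀ (norm_nonneg _) hs m).trans ?_)
      exact pow_le_pow_right₀ hw (Finset.mem_range.1 hm).le
  · refine (norm_le_sqrt_frobSq _).trans ?_
    refine Real.sqrt_le_iff.2 ⟨by positivity, ?_⟩
    rw [mul_pow, Real.sq_sqrt (Nat.cast_nonneg _)]
    exact frobSq_le_of_row_sum (hW.row_sum_S_inv_mul_pow_le hρ L)

/-- The Rayleigh quotient of a symmetric matrix is at most its largest eigenvalue. -/
lemma dotProduct_mulVec_le_lambdaMax {A : Matrix (Fin N) (Fin N) ℝ} (hA : A.IsHermitian)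
    (x : Fin N → ℝ) : x ⬝ᵥ A *ᵥ x ≤ lambdaMax A * (x ⬝ᵥ x) := by
  have hfin : BddAbove (spectrum ℝ A) := by
    rw [hA.spectrum_real_eq_range_eigenvalues]
    exact (Set.finite_range _).bddAbove
  have hle : A ≤ algebraMap ℝ (Matrix (Fin N) (Fin N) ℝ) (lambdaMax A) :=
    (le_algebraMap_iff_spectrum_le (hA : IsSelfAdjoint A)).2 fun x hx => le_csSup hfin hx
  have h := (Matrix.le_iff.1 hle).dotProduct_mulVec_nonneg x
  rw [sub_mulVec, dotProduct_sub, Algebra.algebraMap_eq_smul_one, smul_mulVec, one_mulVec,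
    dotProduct_smul, smul_eq_mul] at h
  simp only [star_trivial] at h
  linarith

/-- The entries of `W` being nonnegative, `|⟨z, W x⟩| ≤ c ⬝ᵥ W c` for `c = |z| + |x|`, and
`c ⬝ᵥ W c` is half of the quadratic form of `W + Wᵀ`. -/
lemma IsStochastic.norm_le {W : Matrix (Fin N) (Fin N) ℝ} (hW : IsStochastic W) :
    ‖W‖ ≤ 2 * |lambdaMax (W + Wᵀ)| := by
  set μ := |lambdaMax (W + Wᵀ)|
  have hH : (W + Wᵀ).IsHermitian := by
    rw [IsHermitian, conjTranspose_eq_transpose_of_trivial, transpose_add, transpose_transpose,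
      add_comm]
  have hquad : ∀ c : Fin N → ℝ, c ⬝ᵥ W *ᵥ c ≤ μ / 2 * (c ⬝ᵥ c) := fun c => by
    have h := dotProduct_mulVec_le_lambdaMax hH c
    rw [add_mulVec, dotProduct_add, mulVec_transpose, dotProduct_comm c (c ᵥ* W),
      ← dotProduct_mulVec] at h
    have hc : 0 ≤ c ⬝ᵥ c := Finset.sum_nonneg fun i _ => mul_self_nonneg _
    have := mul_le_mul_of_nonneg_right (le_abs_self (lambdaMax (W + Wᵀ))) hc
    linarith
  have hbil : ∀ z x : Fin N → ℝ, z ⬝ᵥ W *ᵥ x ≤ μ * (z ⬝ᵥ z + x ⬝ᵥ x) := fun z x => by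
    have h := hquad (fun i => |z i| + |x i|)
    have h1 : z ⬝ᵥ W *ᵥ x ≤ (fun i => |z i| + |x i|) ⬝ᵥ W *ᵥ (fun i => |z i| + |x i|) := by
      simp only [dotProduct, mulVec, Finset.mul_sum]
      refine Finset.sum_le_sum fun i _ => Finset.sum_le_sum fun j _ => ?_
      have a1 : z i * (W i j * x j) ≤ |z i| * (W i j * |x j|) := by
        refine (le_abs_self _).trans (le_of_eq ?_)
        rw [abs_mul, abs_mul, abs_of_nonneg (hW.nonneg i j)]
      refine a1.trans (mul_le_mul (by linarith [abs_nonneg (x i)])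
        (mul_le_mul_of_nonneg_left (by linarith [abs_nonneg (z j)]) (hW.nonneg i j))
        (mul_nonneg (hW.nonneg i j) (abs_nonneg _)) (by positivity))
    have h2 : (fun i => |z i| + |x i|) ⬝ᵥ (fun i => |z i| + |x i|)
        ≤ 2 * (z ⬝ᵥ z + x ⬝ᵥ x) := by
      simp only [dotProduct, ← Finset.sum_add_distrib, Finset.mul_sum]
      refine Finset.sum_le_sum fun i _ => ?_
      nlinarith [sq_nonneg (|z i| - |x i|), abs_mul_abs_self (z i), abs_mul_abs_self (x i)]
    have hμ : 0 ≤ μ / 2 := by positivity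
    nlinarith [mul_le_mul_of_nonneg_left h2 hμ]
  have hμ0 : 0 ≤ μ := abs_nonneg _
  refine norm_le_of_sq_le (by positivity) fun y => ?_
  -- the bilinear bound at `(t W y, y)`, for every `t`, gives the claim by optimizing over `t`
  set s := (W *ᵥ y) ⬝ᵥ (W *ᵥ y)
  have hs : 0 ≤ s := Finset.sum_nonneg fun i _ => mul_self_nonneg _
  have hy : 0 ≤ y ⬝ᵥ y := Finset.sum_nonneg fun i _ => mul_self_nonneg _
  have hb : ∀ t : ℝ, t * s ≤ μ * (t ^ 2 * s + y ⬝ᵥ y) := fun t => by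
    have h := hbil (t • (W *ᵥ y)) y
    simp only [smul_dotProduct, dotProduct_smul, smul_eq_mul] at h
    rw [sq, mul_assoc]
    exact h
  obtain h0 | h0 := hμ0.eq_or_lt
  · have := hb 1
    rw [← h0] at this ⊢
    linarith
  · have h := hb (1 / (2 * μ))
    have e : μ * ((1 / (2 * μ)) ^ 2 * s + y ⬝ᵥ y) = s / (4 * μ) + μ * (y ⬝ᵥ y) := by
      field_simp
      ring
    rw [e] at h
    have e2 : 1 / (2 * μ) * s = s / (4 * μ) + s / (4 * μ) := by field_simp; ring
    rw [e2] at h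
    have h' : s / (4 * μ) ≤ μ * (y ⬝ᵥ y) := by linarith
    rw [div_le_iff₀ (by positivity)] at h'
    linarith

lemma gram_diag_nonneg (W : Matrix (Fin N) (Fin N) ℝ) (i : Fin N) : 0 ≤ (Wᵀ * W) i i := by
  rw [mul_apply]
  exact Finset.sum_nonneg fun j _ => mul_self_nonneg (W j i)

lemma norm_diagonal_le {d : Fin N → ℝ} {c : ℝ} (hc : 0 ≤ c) (h : ∀ i, |d i| ≤ c) :
    ‖(diagonal d : Matrix (Fin N) (Fin N) ℝ)‖ ≤ c := by
  rw [l2_opNorm_diagonal]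
  exact (pi_norm_le_iff_of_nonneg hc).2 h

lemma norm_diagonal_gram_le (W : Matrix (Fin N) (Fin N) ℝ) :
    ‖diagonal (diag (Wᵀ * W))‖ ≤ ‖W‖ * ‖W‖ :=
  norm_diagonal_le (by positivity) fun i => (abs_apply_le_norm _ i i).trans
    ((norm_mul_le _ _).trans (by rw [norm_transpose]))

lemma norm_D_le (W : Matrix (Fin N) (Fin N) ℝ) (ρ : ℝ) : ‖D W ρ‖ ≤ 1 := by
  refine norm_diagonal_le zero_le_one fun i => ?_
  have h := gram_diag_nonneg W i
  have h' : 0 ≤ ρ ^ 2 * (Wᵀ * W) i i := by positivity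
  rw [abs_of_nonneg (by positivity)]
  exact inv_le_one_of_one_le₀ (by linarith)

lemma D_sub_D (W : Matrix (Fin N) (Fin N) ℝ) (ρ ρ' : ℝ) :
    D W ρ - D W ρ' = (ρ' ^ 2 - ρ ^ 2) • (D W ρ * diagonal (diag (Wᵀ * W)) * D W ρ') := by
  have h := gram_diag_nonneg W
  rw [D, D, diagonal_sub, diagonal_mul_diagonal, diagonal_mul_diagonal, ← diagonal_smul]
  congr 1
  ext i
  simp only [Pi.smul_apply, smul_eq_mul, diag_apply]
  have hi := h i
  generalize (Wᵀ * W) i i = g at hi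
  have h1 : 1 + ρ ^ 2 * g ≠ 0 := by positivity
  have h2 : 1 + ρ' ^ 2 * g ≠ 0 := by positivity
  rw [inv_sub_inv h1 h2, div_eq_mul_inv, mul_inv]
  ring

end OperatorNorm

/-! ### Growth of the network matrices -/

section NetworkGrowth

open scoped Matrix.Norms.L2Operator

/-- The scale `log N` along `atTop`. -/
abbrev logScale (N : ℕ) : ℝ := Real.log (N : ℝ)

lemma decay_pow_floor_sqrt {r : ℝ} (h0 : 0 ≤ r) (h1 : r < 1) :
    SuperpolynomialDecay atTop logScale fun N : ℕ => r ^ ⌊√(logScale N)⌋₊ := by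
  intro m
  have hfl : Tendsto (fun N : ℕ => ⌊√(logScale N)⌋₊) atTop atTop :=
    tendsto_nat_floor_atTop.comp (Real.tendsto_sqrt_atTop.comp tendsto_log_natCast)
  have h := ((tendsto_pow_const_mul_const_pow_of_abs_lt_one (2 * m)
    (by rwa [abs_of_nonneg h0])).const_mul ((2 : ℝ) ^ (2 * m))).comp hfl
  rw [mul_zero] at h
  refine squeeze_zero' ?_ ?_ h
  · filter_upwards [tendsto_log_natCast.eventually_ge_atTop 0] with N hN
    have : 0 ≤ logScale N := hN
    positivity
  · filter_upwards [tendsto_log_natCast.eventually_ge_atTop 1] with N hN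
    set s := √(logScale N) with hs
    have hs1 : 1 ≤ s := Real.one_le_sqrt.2 hN
    have hL : (1 : ℝ) ≤ (⌊s⌋₊ : ℝ) := by exact_mod_cast Nat.le_floor (by simpa using hs1)
    have hs2 : s ≤ 2 * (⌊s⌋₊ : ℝ) := by linarith [(Nat.lt_floor_add_one s).le]
    have e : logScale N ^ m = s ^ (2 * m) := by
      rw [pow_mul, hs, Real.sq_sqrt (zero_le_one.trans hN)]
    change _ ≤ (2 : ℝ) ^ (2 * m) * ((⌊s⌋₊ : ℝ) ^ (2 * m) * r ^ ⌊s⌋₊)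
    rw [← mul_assoc, ← mul_pow, e]
    exact mul_le_mul_of_nonneg_right (pow_le_pow_left₀ (by linarith) hs2 _) (pow_nonneg h0 _)

/-- With `t = log N`, the power `(C t)^√t` is negligible against `√N = exp (t / 2)`. -/
lemma decay_pow_div_sqrt {C : ℝ} (hC : 1 ≤ C) :
    SuperpolynomialDecay atTop logScale fun N : ℕ =>
      (C * logScale N) ^ ⌊√(logScale N)⌋₊ * (√(N : ℝ))⁻¹ := by
  intro m
  have h1 : ∀ᶠ t : ℝ in atTop, Real.log t ≤ 1 / 8 * √t := by
    have h := (isLittleO_log_rpow_atTop (r := 1 / 2) (by norm_num)).def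
      (c := 1 / 8) (by norm_num)
    filter_upwards [h, eventually_ge_atTop 0] with t ht ht0
    rw [← Real.sqrt_eq_rpow, Real.norm_of_nonneg (Real.sqrt_nonneg t)] at ht
    exact (le_abs_self _).trans ht
  have h2 : ∀ᶠ t : ℝ in atTop, m + 8 * Real.log C ≤ √t :=
    Real.tendsto_sqrt_atTop.eventually_ge_atTop _
  have hlim : Tendsto (fun t : ℝ => Real.exp (-(t / 4))) atTop (𝓝 0) :=
    Real.tendsto_exp_neg_atTop_nhds_zero.comp (tendsto_id.atTop_div_const (by norm_num))
  refine squeeze_zero' ?_ ?_ (hlim.comp tendsto_log_natCast)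
  · filter_upwards [tendsto_log_natCast.eventually_ge_atTop 0] with N hN
    have : 0 ≤ logScale N := hN
    positivity
  · filter_upwards [tendsto_log_natCast.eventually_ge_atTop 1, tendsto_log_natCast.eventually h1,
      tendsto_log_natCast.eventually h2, eventually_ge_atTop 1] with N hN hN1 hN2 hNpos
    have hN0 : (0 : ℝ) < N := by exact_mod_cast hNpos
    simp only [Function.comp_apply, logScale]
    set t := Real.log (N : ℝ) with ht
    have ht0 : 0 < t := by linarith
    have hC0 : 0 < C := by linarith
    set s := √t with hs
    have hs0 : 0 ≤ s := Real.sqrt_nonneg t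
    have hst : s * s = t := Real.mul_self_sqrt ht0.le
    have e1 : √(N : ℝ) = Real.exp (t / 2) := by rw [Real.exp_half, ht, Real.exp_log hN0]
    have e2 : t ^ m = Real.exp (m * Real.log t) := by
      rw [Real.exp_nat_mul, Real.exp_log ht0]
    have e3 : (C * t) ^ ⌊s⌋₊ = Real.exp (⌊s⌋₊ * (Real.log C + Real.log t)) := by
      rw [Real.exp_nat_mul, Real.exp_add, Real.exp_log ht0, Real.exp_log hC0]
    rw [e1, e2, e3, ← Real.exp_neg, ← Real.exp_add, ← Real.exp_add]
    refine Real.exp_le_exp.2 ?_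
    have hlC : 0 ≤ Real.log C := Real.log_nonneg hC
    have hlt : 0 ≤ Real.log t := Real.log_nonneg hN
    have hfl : (⌊s⌋₊ : ℝ) * (Real.log C + Real.log t) ≤ s * (Real.log C + Real.log t) :=
      mul_le_mul_of_nonneg_right (Nat.floor_le hs0) (by linarith)
    have a1 : (m : ℝ) * Real.log t ≤ m * (1 / 8 * s) :=
      mul_le_mul_of_nonneg_left hN1 (Nat.cast_nonneg m)
    have a2 : s * Real.log t ≤ s * (1 / 8 * s) := mul_le_mul_of_nonneg_left hN1 hs0
    have a3 : s * (m + 8 * Real.log C) ≤ s * s := mul_le_mul_of_nonneg_left hN2 hs0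
    nlinarith

variable {W : (N : ℕ) → Matrix (Fin N) (Fin N) ℝ}

lemma NetworkCondition.eventually_isStochastic (hW : NetworkCondition W) :
    ∀ᶠ N in atTop, IsStochastic (W N) :=
  hW.connectivity.1.mono fun _ h => h.1

lemma NetworkCondition.exists_norm_le (hW : NetworkCondition W) :
    ∃ C : ℝ, 1 ≤ C ∧ ∀ᶠ N in atTop, ‖W N‖ ≤ C * logScale N := by
  obtain ⟨C, hC⟩ := hW.uniformity.bound
  refine ⟨max 1 (2 * C), le_max_left _ _, ?_⟩
  filter_upwards [hC, hW.eventually_isStochastic,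
    tendsto_log_natCast.eventually_ge_atTop 0] with N h1 h2 h3
  rw [Real.norm_eq_abs, abs_abs, Real.norm_of_nonneg h3] at h1
  refine h2.norm_le.trans ?_
  have := mul_le_mul_of_nonneg_right (le_max_right 1 (2 * C)) h3
  simp only [logScale] at *
  linarith

lemma NetworkCondition.moderate_norm (hW : NetworkCondition W) :
    Moderate atTop logScale fun N => ‖W N‖ := by
  obtain ⟨C, -, hC⟩ := hW.exists_norm_le
  refine ⟨1, IsBigO.of_bound C ?_⟩
  filter_upwards [hC, tendsto_log_natCast.eventually_ge_atTop 0] with N h h0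
  rwa [norm_norm, pow_one, Real.norm_of_nonneg h0]

lemma NetworkCondition.decay_norm_S_inv (hW : NetworkCondition W) {ρ : ℝ} (hρ : |ρ| < 1) :
    SuperpolynomialDecay atTop logScale fun N => (√(N : ℝ))⁻¹ * ‖(S (W N) ρ)⁻¹‖ := by
  obtain ⟨C, hC1, hC⟩ := hW.exists_norm_le
  have hL : Moderate atTop logScale fun N => (⌊√(logScale N)⌋₊ : ℝ) := by
    refine Moderate.mono (g := logScale) ⟨1, by simpa using isBigO_refl _ _⟩ ?_
    filter_upwards [tendsto_log_natCast.eventually_ge_atTop 1] with N hN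
    have hN0 : 0 ≤ logScale N := zero_le_one.trans hN
    rw [abs_of_nonneg (Nat.cast_nonneg _), abs_of_nonneg hN0]
    exact (Nat.floor_le (Real.sqrt_nonneg _)).trans
      (Real.sqrt_le_iff.2 ⟨hN0, le_self_pow₀ hN two_ne_zero⟩)
  refine decay_of_abs_le ((moderate_mul_decay hL (decay_pow_div_sqrt hC1)).add
    ((decay_pow_floor_sqrt (abs_nonneg ρ) hρ).const_mul (1 - |ρ|)⁻¹)) ?_
  filter_upwards [hC, hW.eventually_isStochastic, tendsto_log_natCast.eventually_ge_atTop 1,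
    eventually_ge_atTop 1] with N h1 h2 h3 h4
  have hN0 : (0 : ℝ) < √(N : ℝ) := Real.sqrt_pos.2 (by exact_mod_cast h4)
  have h3' : 1 ≤ C * logScale N := one_le_mul_of_one_le_of_one_le hC1 h3
  have h := h2.norm_S_inv_le hρ h3' h1 ⌊√(logScale N)⌋₊
  rw [abs_of_nonneg (by positivity)]
  refine le_trans ?_ (le_abs_self _)
  rw [inv_mul_le_iff₀ hN0]
  refine h.trans (le_of_eq ?_)
  simp only [Pi.add_apply]
  field_simp

lemma NetworkCondition.moderate_frobSq_S_inv (hW : NetworkCondition W) {ρ : ℝ} (hρ : |ρ| < 1) :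
    Moderate atTop logScale fun N => (N : ℝ)⁻¹ * frobSq (S (W N) ρ)⁻¹ := by
  refine (moderate_const ((1 - |ρ|)⁻¹ ^ 2)).mono ?_
  filter_upwards [hW.eventually_isStochastic, eventually_ge_atTop 1] with N h h1
  have hN0 : (0 : ℝ) < N := by exact_mod_cast h1
  have := frobSq_nonneg (S (W N) ρ)⁻¹
  rw [abs_of_nonneg (by positivity)]
  refine le_trans ?_ (le_abs_self _)
  rw [inv_mul_le_iff₀ hN0]
  exact h.frobSq_S_inv_le hρ

end NetworkGrowth

section CloseNetwork

open scoped Matrix.Norms.L2Operator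

variable {Ω : Type*} [MeasurableSpace Ω] {P : Measure Ω}
  {W : (N : ℕ) → Matrix (Fin N) (Fin N) ℝ} {r : ℕ × Ω → ℝ} {ρ : ℝ}

/-- Closeness of two families of matrices whose sizes vary with `N`. -/
abbrev MatClose (P : Measure Ω) (A A' : ∀ q : ℕ × Ω, Matrix (Fin q.1) (Fin q.1) ℝ) : Prop :=
  Close (whp P) lg A A'

/-- Closeness of two families of vectors, in the norm in which `N^(-1/2) y` is of order one. -/
abbrev VecClose (P : Measure Ω) (y y' : ∀ q : ℕ × Ω, Fin q.1 → ℝ) : Prop :=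
  Close (whp P) lg (fun q => scaled (y q)) fun q => scaled (y' q)

lemma MatClose.transpose {A A' : ∀ q : ℕ × Ω, Matrix (Fin q.1) (Fin q.1) ℝ}
    (h : MatClose P A A') : MatClose P (fun q => (A q)ᵀ) fun q => (A' q)ᵀ :=
  h.map (fun _ M => Mᵀ) (fun _ _ _ => transpose_sub _ _) fun _ M => (norm_transpose M).le

lemma MatClose.normalized_trace {A A' : ∀ q : ℕ × Ω, Matrix (Fin q.1) (Fin q.1) ℝ}
    (h : MatClose P A A') :
    Close (whp P) lg (fun q => (q.1 : ℝ)⁻¹ * (A q).trace) fun q => (q.1 : ℝ)⁻¹ * (A' q).trace :=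
  h.map (fun q M => (q.1 : ℝ)⁻¹ * M.trace) (fun q a b => by rw [trace_sub, mul_sub])
    fun _ M => norm_normalized_trace_le M

lemma VecClose.mulVec {A A' : ∀ q : ℕ × Ω, Matrix (Fin q.1) (Fin q.1) ℝ}
    {y y' : ∀ q : ℕ × Ω, Fin q.1 → ℝ} (h : VecClose P y y') (hA : MatClose P A A') :
    VecClose P (fun q => A q *ᵥ y q) fun q => A' q *ᵥ y' q := by
  have e : ∀ (N : ℕ) (M : Matrix (Fin N) (Fin N) ℝ) (z : EuclideanSpace ℝ (Fin N)),
      WithLp.toLp 2 (M *ᵥ z.ofLp) = toEuclideanCLM (n := Fin N) (𝕜 := ℝ) M z := fun _ _ _ => rfl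
  have h' := hA.map₂ tendsto_lg h (fun q M z => WithLp.toLp 2 (M *ᵥ z.ofLp))
    (fun q a b c => by simp only [e, map_sub, _root_.sub_apply])
    (fun q a b c => by simp only [e, map_sub])
    (fun q a b => l2_opNorm_mulVec a b)
  refine h'.congr' (Eventually.of_forall fun q => ?_) (Eventually.of_forall fun q => ?_) <;>
  · simp only [scaled, WithLp.ofLp_smul, mulVec_smul, WithLp.toLp_smul]

lemma VecClose.sub {y y' z z' : ∀ q : ℕ × Ω, Fin q.1 → ℝ} (h : VecClose P y y')
    (h' : VecClose P z z') : VecClose P (fun q => y q - z q) fun q => y' q - z' q := by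
  simpa only [VecClose, scaled_sub] using Close.sub tendsto_lg h h'

lemma VecClose.smul {c c' : ℕ × Ω → ℝ} {y y' : ∀ q : ℕ × Ω, Fin q.1 → ℝ}
    (hc : Close (whp P) lg c c') (h : VecClose P y y') :
    VecClose P (fun q => c q • y q) fun q => c' q • y' q := by
  simpa only [VecClose, scaled_smul] using Close.smul tendsto_lg hc h

lemma VecClose.normalized_dotProduct {y y' z z' : ∀ q : ℕ × Ω, Fin q.1 → ℝ}
    (h : VecClose P y y') (h' : VecClose P z z') :
    Close (whp P) lg (fun q => (q.1 : ℝ)⁻¹ * (y q ⬝ᵥ z q))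
      fun q => (q.1 : ℝ)⁻¹ * (y' q ⬝ᵥ z' q) := by
  have := Close.map₂ tendsto_lg h h' (fun q a b => inner ℝ a b)
    (fun q a b c => inner_sub_left a b c) (fun q a b c => inner_sub_right a b c)
    (fun q a b => norm_inner_le_norm a b)
  simpa only [inner_scaled] using this

lemma matClose_W (hW : NetworkCondition W) : MatClose P (fun q => W q.1) fun q => W q.1 :=
  Close.refl (moderate_fst hW.moderate_norm)

lemma matClose_S (hW : NetworkCondition W) (hr : Close (whp P) lg r fun _ => ρ) :
    MatClose P (fun q => S (W q.1) (r q)) fun q => S (W q.1) ρ := by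
  refine Close.sub tendsto_lg (Close.refl ?_) (hr.smul tendsto_lg (matClose_W hW))
  exact (moderate_const 1).mono (Eventually.of_forall fun q => by simpa using norm_one_le)

lemma matClose_gram_diag (hW : NetworkCondition W) :
    MatClose P (fun q => diagonal (diag ((W q.1)ᵀ * W q.1)))
      fun q => diagonal (diag ((W q.1)ᵀ * W q.1)) := by
  have h := moderate_fst (P := P) hW.moderate_norm
  refine Close.refl ((h.mul h).mono (Eventually.of_forall fun q => ?_))
  rw [abs_of_nonneg (norm_nonneg _), abs_of_nonneg (by positivity)]
  exact norm_diagonal_gram_le _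

lemma matClose_D (hW : NetworkCondition W) (hr : Close (whp P) lg r fun _ => ρ) :
    MatClose P (fun q => D (W q.1) (r q)) fun q => D (W q.1) ρ := by
  refine ⟨(moderate_const 1).mono (Eventually.of_forall fun q => by simpa using norm_D_le _ _), ?_⟩
  have h2 : SuperpolynomialDecay (whp P) lg fun q => ‖ρ ^ 2 - r q ^ 2‖ := by
    have := ((close_const (E := ℝ) ρ).mul tendsto_lg (close_const ρ)).sub tendsto_lg
      (hr.mul tendsto_lg hr)
    simpa [sq] using this.decay
  refine decay_of_abs_le (decay_mul_moderate h2 (matClose_gram_diag hW).moderate)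
    (Eventually.of_forall fun q => ?_)
  rw [abs_of_nonneg (norm_nonneg _), abs_of_nonneg (by positivity), D_sub_D, norm_smul]
  refine mul_le_mul_of_nonneg_left ?_ (norm_nonneg _)
  refine (norm_mul_le _ _).trans ((mul_le_of_le_one_right (norm_nonneg _) (norm_D_le _ _)).trans ?_)
  exact (norm_mul_le _ _).trans (mul_le_of_le_one_left (norm_nonneg _) (norm_D_le _ _))

lemma matClose_Ddot (hW : NetworkCondition W) (hr : Close (whp P) lg r fun _ => ρ) :
    MatClose P (fun q => Ddot (W q.1) (r q)) fun q => Ddot (W q.1) ρ := by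
  have hD := matClose_D hW hr
  have h := (((close_const (E := ℝ) (-2)).mul tendsto_lg hr).smul tendsto_lg
    ((hD.mul tendsto_lg hD).mul tendsto_lg (matClose_gram_diag hW)))
  simpa only [Ddot, sq] using h

end CloseNetwork

/-! ### Second moments of bilinear forms in independent variables -/

section BilinearMoment

variable {Ω : Type*} [MeasurableSpace Ω] {μ : Measure Ω}

lemma integrable_mul_of_indep {α β : Type*} [MeasurableSpace α] [MeasurableSpace β]
    {U : Ω → α} {V : Ω → β} (h : IndepFun U V μ) {φ : α → ℝ} {ψ : β → ℝ} (hφ : Measurable φ)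
    (hψ : Measurable ψ) (hU : Integrable (fun ω => φ (U ω)) μ)
    (hV : Integrable (fun ω => ψ (V ω)) μ) :
    Integrable (fun ω => φ (U ω) * ψ (V ω)) μ ∧
      ∫ ω, φ (U ω) * ψ (V ω) ∂μ = (∫ ω, φ (U ω) ∂μ) * ∫ ω, ψ (V ω) ∂μ :=
  ⟨(h.comp hφ hψ).integrable_mul hU hV,
    (h.comp hφ hψ).integral_fun_mul_eq_mul_integral hU.aestronglyMeasurable
      hV.aestronglyMeasurable⟩

lemma integrable_mul_of_memLp_two {f g : Ω → ℝ} (hf : MemLp f 2 μ) (hg : MemLp g 2 μ) :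
    Integrable (fun ω => f ω * g ω) μ := hf.integrable_mul hg

/-- The second moment of `T + a ℓ + c ℓ' + q`, when the past `(T, ℓ, ℓ')` is independent of the
centred innovation `(a, c, q)` and the coefficients `ℓ`, `ℓ'` are centred. -/
lemma second_moment_step [IsProbabilityMeasure μ] {T ℓ ℓ' a c q : Ω → ℝ}
    (hT : MemLp T 2 μ) (hl : MemLp ℓ 2 μ) (hl' : MemLp ℓ' 2 μ)
    (ha : MemLp a 2 μ) (hc : MemLp c 2 μ) (hq : MemLp q 2 μ)
    (hind : IndepFun (fun ω => (T ω, ℓ ω, ℓ' ω)) (fun ω => (a ω, c ω, q ω)) μ)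
    (ha0 : ∫ ω, a ω ∂μ = 0) (hc0 : ∫ ω, c ω ∂μ = 0) (hq0 : ∫ ω, q ω ∂μ = 0)
    (hl0 : ∫ ω, ℓ ω ∂μ = 0) (hl0' : ∫ ω, ℓ' ω ∂μ = 0) :
    MemLp (fun ω => T ω + a ω * ℓ ω + c ω * ℓ' ω + q ω) 2 μ ∧
    ∫ ω, (T ω + a ω * ℓ ω + c ω * ℓ' ω + q ω) ∂μ = ∫ ω, T ω ∂μ ∧
    ∫ ω, (T ω + a ω * ℓ ω + c ω * ℓ' ω + q ω) ^ 2 ∂μ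
      = ∫ ω, T ω ^ 2 ∂μ + (∫ ω, ℓ ω ^ 2 ∂μ) * (∫ ω, a ω ^ 2 ∂μ)
        + (∫ ω, ℓ' ω ^ 2 ∂μ) * (∫ ω, c ω ^ 2 ∂μ) + ∫ ω, q ω ^ 2 ∂μ
        + 2 * ((∫ ω, ℓ ω * ℓ' ω ∂μ) * ∫ ω, a ω * c ω ∂μ) := by
  have i1 : ∀ {f : Ω → ℝ}, MemLp f 2 μ → Integrable f μ := fun h => h.integrable one_le_two
  have iadd : ∀ {f g : Ω → ℝ}, Integrable f μ → Integrable g μ →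
    Integrable (fun ω => f ω + g ω) μ := fun h h' => h.add h'
  have ind : ∀ {φ ψ : ℝ × ℝ × ℝ → ℝ}, Measurable φ → Measurable ψ →
      Integrable (fun ω => φ (T ω, ℓ ω, ℓ' ω)) μ → Integrable (fun ω => ψ (a ω, c ω, q ω)) μ → _ :=
    fun h1 h2 h3 h4 => integrable_mul_of_indep hind h1 h2 h3 h4
  have m1 : Measurable fun x : ℝ × ℝ × ℝ => x.1 := by fun_prop
  have m2 : Measurable fun x : ℝ × ℝ × ℝ => x.2.1 := by fun_prop
  have m3 : Measurable fun x : ℝ × ℝ × ℝ => x.2.2 := by fun_prop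
  obtain ⟨e1, f1⟩ := ind (m2.pow_const 2) (m1.pow_const 2) hl.integrable_sq ha.integrable_sq
  obtain ⟨e2, f2⟩ := ind (m3.pow_const 2) (m2.pow_const 2) hl'.integrable_sq hc.integrable_sq
  obtain ⟨e3, f3⟩ := ind (m1.mul m2) m1 (integrable_mul_of_memLp_two hT hl) (i1 ha)
  obtain ⟨e4, f4⟩ := ind (m1.mul m3) m2 (integrable_mul_of_memLp_two hT hl') (i1 hc)
  obtain ⟨e5, f5⟩ := ind m1 m3 (i1 hT) (i1 hq)
  obtain ⟨e6, f6⟩ := ind (m2.mul m3) (m1.mul m2) (integrable_mul_of_memLp_two hl hl')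
    (integrable_mul_of_memLp_two ha hc)
  obtain ⟨e7, f7⟩ := ind m2 (m1.mul m3) (i1 hl) (integrable_mul_of_memLp_two ha hq)
  obtain ⟨e8, f8⟩ := ind m3 (m2.mul m3) (i1 hl') (integrable_mul_of_memLp_two hc hq)
  obtain ⟨e9, f9⟩ := ind m2 m1 (i1 hl) (i1 ha)
  obtain ⟨e10, f10⟩ := ind m3 m2 (i1 hl') (i1 hc)
  simp only [Pi.mul_apply] at e1 f1 e2 f2 e3 f3 e4 f4 e5 f5 e6 f6 e7 f7 e8 f8 e9 f9 e10 f10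
  have mal : MemLp (fun ω => a ω * ℓ ω) 2 μ := by
    refine (memLp_two_iff_integrable_sq
      (ha.aestronglyMeasurable.mul hl.aestronglyMeasurable)).2 (e1.congr ?_)
    exact Eventually.of_forall fun ω => by simp only [Pi.mul_apply]; ring
  have mcl : MemLp (fun ω => c ω * ℓ' ω) 2 μ := by
    refine (memLp_two_iff_integrable_sq
      (hc.aestronglyMeasurable.mul hl'.aestronglyMeasurable)).2 (e2.congr ?_)
    exact Eventually.of_forall fun ω => by simp only [Pi.mul_apply]; ring
  refine ⟨((hT.add mal).add mcl).add hq, ?_, ?_⟩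
  · have h1 := i1 mal
    have h2 := i1 mcl
    rw [integral_add (iadd (iadd (i1 hT) h1) h2) (i1 hq), integral_add (iadd (i1 hT) h1) h2,
      integral_add (i1 hT) h1, hq0]
    simp only [mul_comm (a _), mul_comm (c _)]
    rw [f9, f10, ha0, hc0]
    ring
  · have expand : ∀ ω, (T ω + a ω * ℓ ω + c ω * ℓ' ω + q ω) ^ 2
        = T ω ^ 2 + ℓ ω ^ 2 * a ω ^ 2 + ℓ' ω ^ 2 * c ω ^ 2 + q ω ^ 2
          + 2 * (T ω * ℓ ω * a ω) + 2 * (T ω * ℓ' ω * c ω) + 2 * (T ω * q ω)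
          + 2 * (ℓ ω * ℓ' ω * (a ω * c ω)) + 2 * (ℓ ω * (a ω * q ω)) + 2 * (ℓ' ω * (c ω * q ω)) :=
      fun ω => by ring
    simp only [expand]
    have g0 := hT.integrable_sq
    have g1 := iadd g0 e1
    have g2 := iadd g1 e2
    have g3 := iadd g2 hq.integrable_sq
    have g4 := iadd g3 (e3.const_mul 2)
    have g5 := iadd g4 (e4.const_mul 2)
    have g6 := iadd g5 (e5.const_mul 2)
    have g7 := iadd g6 (e6.const_mul 2)
    have g8 := iadd g7 (e7.const_mul 2)
    rw [integral_add g8 (e8.const_mul 2), integral_add g7 (e7.const_mul 2),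
      integral_add g6 (e6.const_mul 2), integral_add g5 (e5.const_mul 2),
      integral_add g4 (e4.const_mul 2), integral_add g3 (e3.const_mul 2),
      integral_add g2 hq.integrable_sq, integral_add g1 e2, integral_add g0 e1]
    simp only [integral_const_mul]
    rw [f1, f2, f3, f4, f5, f6, f7, f8, ha0, hc0, hq0, hl0, hl0']
    ring

variable {ι : Type*}

lemma integral_sum_mul_sum [DecidableEq ι] {f g : ι → Ω → ℝ} {t : ℝ} (hf : ∀ i, MemLp (f i) 2 μ)
    (hg : ∀ i, MemLp (g i) 2 μ)
    (h : ∀ i j, ∫ ω, f i ω * g j ω ∂μ = if i = j then t else 0) (s : Finset ι) (x y : ι → ℝ) :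
    ∫ ω, (∑ i ∈ s, x i * f i ω) * (∑ j ∈ s, y j * g j ω) ∂μ = t * ∑ i ∈ s, x i * y i := by
  have e : ∀ ω, (∑ i ∈ s, x i * f i ω) * (∑ j ∈ s, y j * g j ω)
      = ∑ i ∈ s, ∑ j ∈ s, (x i * y j) * (f i ω * g j ω) := fun ω => by
    rw [Finset.sum_mul_sum]
    exact Finset.sum_congr rfl fun i _ => Finset.sum_congr rfl fun j _ => by ring
  have hi : ∀ i j, Integrable (fun ω => (x i * y j) * (f i ω * g j ω)) μ := fun i j =>
    (integrable_mul_of_memLp_two (hf i) (hg j)).const_mul _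
  simp only [e]
  rw [integral_finsetSum _ fun i _ => integrable_finsetSum _ fun j _ => hi i j, Finset.mul_sum]
  refine Finset.sum_congr rfl fun i hs => ?_
  rw [integral_finsetSum _ fun j _ => hi i j]
  simp only [integral_const_mul, h, mul_ite, mul_zero]
  rw [Finset.sum_ite_eq]
  simp [hs, mul_comm]

/-- The exact second moment of a bilinear form `∑ M i j a_i c_j` with vanishing diagonal plus a sum
`∑ q_i`, for independent centred triples `(a_i, c_i, q_i)`: adding one index at a time yields
orthogonal increments. -/
lemma second_moment_bilinear [IsProbabilityMeasure μ] [DecidableEq ι] {a c q : ι → Ω → ℝ}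
    (ha : ∀ i, MemLp (a i) 2 μ) (hc : ∀ i, MemLp (c i) 2 μ) (hq : ∀ i, MemLp (q i) 2 μ)
    (hind : iIndepFun (fun i ω => (a i ω, c i ω, q i ω)) μ)
    (ha0 : ∀ i, ∫ ω, a i ω ∂μ = 0) (hc0 : ∀ i, ∫ ω, c i ω ∂μ = 0)
    (hq0 : ∀ i, ∫ ω, q i ω ∂μ = 0) {A C t : ℝ} (hA : ∀ i, ∫ ω, a i ω ^ 2 ∂μ = A)
    (hC : ∀ i, ∫ ω, c i ω ^ 2 ∂μ = C) (ht : ∀ i, ∫ ω, a i ω * c i ω ∂μ = t)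
    (M : ι → ι → ℝ) (hM : ∀ i, M i i = 0) (s : Finset ι) :
    MemLp (fun ω => ∑ i ∈ s, ∑ j ∈ s, M i j * (a i ω * c j ω) + ∑ i ∈ s, q i ω) 2 μ ∧
    ∫ ω, (∑ i ∈ s, ∑ j ∈ s, M i j * (a i ω * c j ω) + ∑ i ∈ s, q i ω) ∂μ = 0 ∧
    ∫ ω, (∑ i ∈ s, ∑ j ∈ s, M i j * (a i ω * c j ω) + ∑ i ∈ s, q i ω) ^ 2 ∂μ
      = ∑ i ∈ s, ∑ j ∈ s, (A * C * M i j ^ 2 + t ^ 2 * (M i j * M j i))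
        + ∑ i ∈ s, ∫ ω, q i ω ^ 2 ∂μ := by
  have hmeas : ∀ i, AEMeasurable (fun ω => (a i ω, c i ω, q i ω)) μ := fun i =>
    (ha i).aestronglyMeasurable.aemeasurable.prodMk
      ((hc i).aestronglyMeasurable.aemeasurable.prodMk (hq i).aestronglyMeasurable.aemeasurable)
  have i1 : ∀ {f : Ω → ℝ}, MemLp f 2 μ → Integrable f μ := fun h => h.integrable one_le_two
  have m1 : Measurable fun x : ℝ × ℝ × ℝ => x.1 := by fun_prop
  have m2 : Measurable fun x : ℝ × ℝ × ℝ => x.2.1 := by fun_prop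
  have haa : ∀ i j, ∫ ω, a i ω * a j ω ∂μ = if i = j then A else 0 := fun i j => by
    split_ifs with h
    · rw [← h, ← hA i]; simp only [sq]
    · have := (integrable_mul_of_indep (hind.indepFun h) m1 m1 (i1 (ha i)) (i1 (ha j))).2
      simp only at this
      rw [this, ha0, zero_mul]
  have hcc : ∀ i j, ∫ ω, c i ω * c j ω ∂μ = if i = j then C else 0 := fun i j => by
    split_ifs with h
    · rw [← h, ← hC i]; simp only [sq]
    · have := (integrable_mul_of_indep (hind.indepFun h) m2 m2 (i1 (hc i)) (i1 (hc j))).2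
      simp only at this
      rw [this, hc0, zero_mul]
  have hca : ∀ i j, ∫ ω, c i ω * a j ω ∂μ = if i = j then t else 0 := fun i j => by
    split_ifs with h
    · rw [← h, ← ht i]; simp only [mul_comm]
    · have := (integrable_mul_of_indep (hind.indepFun h) m2 m1 (i1 (hc i)) (i1 (ha j))).2
      simp only at this
      rw [this, hc0, zero_mul]
  induction s using Finset.induction_on with
  | empty => simp
  | insert k s hk ih =>
    obtain ⟨ihL, ih0, ih2⟩ := ih
    set T : Ω → ℝ := fun ω => ∑ i ∈ s, ∑ j ∈ s, M i j * (a i ω * c j ω) + ∑ i ∈ s, q i ω with hT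
    set ℓ : Ω → ℝ := fun ω => ∑ j ∈ s, M k j * c j ω with hℓ
    set ℓ' : Ω → ℝ := fun ω => ∑ i ∈ s, M i k * a i ω with hℓ'
    have hl : MemLp ℓ 2 μ := memLp_finsetSum _ fun j _ => (hc j).const_mul _
    have hl' : MemLp ℓ' 2 μ := memLp_finsetSum _ fun j _ => (ha j).const_mul _
    have hl0 : ∫ ω, ℓ ω ∂μ = 0 := by
      rw [hℓ, integral_finsetSum _ fun j _ => (i1 (hc j)).const_mul _]
      simp [integral_const_mul, hc0]
    have hl0' : ∫ ω, ℓ' ω ∂μ = 0 := by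
      rw [hℓ', integral_finsetSum _ fun j _ => (i1 (ha j)).const_mul _]
      simp [integral_const_mul, ha0]
    have hI : IndepFun (fun ω => (T ω, ℓ ω, ℓ' ω)) (fun ω => (a k ω, c k ω, q k ω)) μ := by
      have h := hind.indepFun_finset₀ s {k} (by simpa using hk) hmeas
      have hφ : Measurable fun x : s → ℝ × ℝ × ℝ =>
          ((∑ i : s, ∑ j : s, M i j * ((x i).1 * (x j).2.1) + ∑ i : s, (x i).2.2,
            ∑ j : s, M k j * (x j).2.1, ∑ i : s, M i k * (x i).1) : ℝ × ℝ × ℝ) := by fun_prop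
      have hψ : Measurable fun x : ({k} : Finset ι) → ℝ × ℝ × ℝ =>
          x ⟨k, Finset.mem_singleton_self k⟩ := by fun_prop
      have h2 := h.comp hφ hψ
      refine IndepFun.congr h2 (Eventually.of_forall fun ω => ?_)
        (Eventually.of_forall fun ω => rfl)
      simp only [Function.comp_apply, hT, hℓ, hℓ']
      have e1 : ∀ F : ι → ℝ, ∑ i : s, F i = ∑ i ∈ s, F i := fun F => Finset.sum_coe_sort s F
      rw [← e1 fun i => M i k * a i ω, ← e1 fun j => M k j * c j ω, ← e1 fun i => q i ω,
        ← e1 fun i => ∑ j ∈ s, M i j * (a i ω * c j ω)]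
      simp only [← e1]
    have e : ∀ ω, ∑ i ∈ insert k s, ∑ j ∈ insert k s, M i j * (a i ω * c j ω)
        + ∑ i ∈ insert k s, q i ω = T ω + a k ω * ℓ ω + c k ω * ℓ' ω + q k ω := fun ω => by
      simp only [Finset.sum_insert hk, hM, hT, hℓ, hℓ', Finset.sum_add_distrib, Finset.mul_sum]
      have e1 : ∑ j ∈ s, M k j * (a k ω * c j ω) = ∑ j ∈ s, a k ω * (M k j * c j ω) :=
        Finset.sum_congr rfl fun j _ => by ring
      have e2 : ∑ j ∈ s, M j k * (a j ω * c k ω) = ∑ j ∈ s, c k ω * (M j k * a j ω) :=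
        Finset.sum_congr rfl fun j _ => by ring
      rw [e1, e2]
      ring
    simp only [e]
    obtain ⟨r1, r2, r3⟩ := second_moment_step ihL hl hl' (ha k) (hc k) (hq k) hI (ha0 k) (hc0 k)
      (hq0 k) hl0 hl0'
    refine ⟨r1, r2.trans ih0, r3.trans ?_⟩
    have s1 : ∫ ω, ℓ ω ^ 2 ∂μ = C * ∑ j ∈ s, M k j * M k j := by
      simp only [sq]
      exact integral_sum_mul_sum hc hc hcc s _ _
    have s2 : ∫ ω, ℓ' ω ^ 2 ∂μ = A * ∑ j ∈ s, M j k * M j k := by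
      simp only [sq]
      exact integral_sum_mul_sum ha ha haa s _ _
    have s3 : ∫ ω, ℓ ω * ℓ' ω ∂μ = t * ∑ j ∈ s, M k j * M j k :=
      integral_sum_mul_sum hc ha hca s _ _
    rw [ih2, s1, s2, s3, hA, hC, ht, Finset.sum_insert hk, Finset.sum_insert hk,
      Finset.sum_insert hk]
    simp_rw [Finset.sum_insert hk]
    rw [Finset.sum_add_distrib (f := fun i => A * C * M i k ^ 2 + t ^ 2 * (M i k * M k i))]
    have e1 : ∑ j ∈ s, (A * C * M k j ^ 2 + t ^ 2 * (M k j * M j k))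
        = A * C * ∑ j ∈ s, M k j * M k j + t ^ 2 * ∑ j ∈ s, M k j * M j k := by
      rw [Finset.mul_sum, Finset.mul_sum, ← Finset.sum_add_distrib]
      exact Finset.sum_congr rfl fun j _ => by ring
    have e2 : ∑ j ∈ s, (A * C * M j k ^ 2 + t ^ 2 * (M j k * M k j))
        = A * C * ∑ j ∈ s, M j k * M j k + t ^ 2 * ∑ j ∈ s, M k j * M j k := by
      rw [Finset.mul_sum, Finset.mul_sum, ← Finset.sum_add_distrib]
      exact Finset.sum_congr rfl fun j _ => by ring
    rw [e1, e2, hM]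
    ring

end BilinearMoment

/-! ### Quadratic forms: concentration and Gaussian covariances -/

section GaussianMoments

/-- The derivatives at `0` of the moment generating function `exp (v t² / 2)`. -/
lemma integral_pow_gaussianReal (v : ℝ≥0) :
    ∫ x, x ∂(gaussianReal 0 v) = 0 ∧ ∫ x, x ^ 2 ∂(gaussianReal 0 v) = v ∧
    ∫ x, x ^ 3 ∂(gaussianReal 0 v) = 0 ∧ ∫ x, x ^ 4 ∂(gaussianReal 0 v) = 3 * (v : ℝ) ^ 2 := by
  set f : ℝ → ℝ := fun t => Real.exp (v * t ^ 2 / 2) with hf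
  have hmgf : mgf id (gaussianReal 0 v) = f := by
    ext t
    rw [mgf_gaussianReal (Measure.map_id : Measure.map id (gaussianReal 0 v) = _)]
    simp [hf]
  have hint : (0 : ℝ) ∈ interior (integrableExpSet id (gaussianReal 0 v)) := by
    have : integrableExpSet id (gaussianReal 0 v) = Set.univ :=
      Set.eq_univ_of_forall fun t => integrable_exp_mul_gaussianReal t
    rw [this]
    simp
  have hm : ∀ n : ℕ, ∫ x, x ^ n ∂(gaussianReal 0 v) = iteratedDeriv n f 0 := fun n => by
    rw [← hmgf, iteratedDeriv_mgf_zero hint]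
    simp
  have hd : ∀ t, HasDerivAt f (v * t * f t) t := fun t => by
    have h := (((hasDerivAt_pow 2 t).const_mul (v : ℝ)).div_const 2).exp
    refine h.congr_deriv ?_
    simp only [hf]
    push_cast
    ring
  have hp : ∀ (g g' : ℝ → ℝ), (∀ t, HasDerivAt g (g' t) t) →
      deriv (fun t => g t * f t) = fun t => (g' t + v * t * g t) * f t := fun g g' hg => by
    ext t
    refine ((hg t).mul (hd t)).deriv.trans ?_
    ring
  have d1 : iteratedDeriv 1 f = fun t => (v * t) * f t := by
    rw [iteratedDeriv_one]
    exact funext fun t => (hd t).deriv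
  have d2 : iteratedDeriv 2 f = fun t => (v + v * t * (v * t)) * f t := by
    rw [iteratedDeriv_succ, d1]
    exact hp _ (fun _ => v) fun t => by simpa using (hasDerivAt_id t).const_mul (v : ℝ)
  have d3 : iteratedDeriv 3 f
      = fun t => (2 * v ^ 2 * t + v * t * (v + v * t * (v * t))) * f t := by
    rw [iteratedDeriv_succ, d2]
    refine hp _ (fun t => 2 * v ^ 2 * t) fun t => ?_
    have h := (((hasDerivAt_pow 2 t).const_mul ((v : ℝ) ^ 2)).const_add (v : ℝ))
    refine (h.congr_of_eventuallyEq (Eventually.of_forall fun x => by ring)).congr_deriv ?_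
    push_cast
    ring
  have d4 : iteratedDeriv 4 f
      = fun t => ((3 * v ^ 2 + 3 * v ^ 3 * t ^ 2)
        + v * t * (2 * v ^ 2 * t + v * t * (v + v * t * (v * t)))) * f t := by
    rw [iteratedDeriv_succ, d3]
    refine hp _ (fun t => 3 * v ^ 2 + 3 * v ^ 3 * t ^ 2) fun t => ?_
    have h := ((hasDerivAt_id t).const_mul (3 * (v : ℝ) ^ 2)).add
      ((hasDerivAt_pow 3 t).const_mul ((v : ℝ) ^ 3))
    refine (h.congr_of_eventuallyEq (Eventually.of_forall fun x => ?_)).congr_deriv ?_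
    · simp only [Pi.add_apply, id]; ring
    · push_cast; ring
  have h1 := hm 1
  have h2 := hm 2
  have h3 := hm 3
  have h4 := hm 4
  rw [d1] at h1
  rw [d2] at h2
  rw [d3] at h3
  rw [d4] at h4
  simp only [pow_one, hf] at h1 h2 h3 h4
  refine ⟨by rw [h1]; simp, by rw [h2]; simp, by rw [h3]; simp, by rw [h4]; simp⟩

end GaussianMoments

section QuadraticForms

variable {Ω : Type*} [MeasurableSpace Ω] {μ : Measure Ω} {N : ℕ}

lemma memLp_two_mul {f g : Ω → ℝ} (hf : MemLp f 4 μ) (hg : MemLp g 4 μ) :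
    MemLp (fun ω => f ω * g ω) 2 μ := by
  have : ENNReal.HolderTriple 4 4 2 := ⟨by
    rw [← two_mul]
    have h4 : (4 : ℝ≥0∞) = 2 * 2 := by norm_num
    rw [h4, ENNReal.mul_inv (by simp) (by simp), ← mul_assoc,
      ENNReal.mul_inv_cancel (by simp) (by simp), one_mul]⟩
  exact hg.mul hf

/-- The matrix with its diagonal replaced by zero. -/
def offDiag (M : Matrix (Fin N) (Fin N) ℝ) (i j : Fin N) : ℝ := if i = j then 0 else M i j

lemma offDiag_self (M : Matrix (Fin N) (Fin N) ℝ) (i : Fin N) : offDiag M i i = 0 := if_pos rfl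

lemma dotProduct_mulVec_eq_offDiag (M : Matrix (Fin N) (Fin N) ℝ) (x y : Fin N → ℝ) :
    x ⬝ᵥ M *ᵥ y = ∑ i, ∑ j, offDiag M i j * (x i * y j) + ∑ i, M i i * (x i * y i) := by
  simp only [dotProduct, mulVec, Finset.mul_sum, ← Finset.sum_add_distrib]
  refine Finset.sum_congr rfl fun i _ => ?_
  have h : ∀ j, x i * (M i j * y j)
      = offDiag M i j * (x i * y j) + if i = j then M i i * (x i * y i) else 0 := fun j => by
    unfold offDiag
    split_ifs with hij
    · subst hij; ring
    · ring
  simp [h, Finset.sum_add_distrib]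

/-- Concentration of a bilinear form in independent centred pairs with finite fourth moments. -/
lemma second_moment_bilinear_le [IsProbabilityMeasure μ] {a c : Fin N → Ω → ℝ}
    (ha : ∀ i, MemLp (a i) 4 μ) (hc : ∀ i, MemLp (c i) 4 μ)
    (hind : iIndepFun (fun i ω => (a i ω, c i ω)) μ)
    (ha0 : ∀ i, ∫ ω, a i ω ∂μ = 0) (hc0 : ∀ i, ∫ ω, c i ω ∂μ = 0) {A C t V : ℝ}
    (hA : ∀ i, ∫ ω, a i ω ^ 2 ∂μ = A)
    (hC : ∀ i, ∫ ω, c i ω ^ 2 ∂μ = C) (ht : ∀ i, ∫ ω, a i ω * c i ω ∂μ = t)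
    (hV : ∀ i, ∫ ω, (a i ω * c i ω - t) ^ 2 ∂μ = V)
    (M : Matrix (Fin N) (Fin N) ℝ) :
    MemLp (fun ω => (fun i => a i ω) ⬝ᵥ M *ᵥ (fun i => c i ω) - t * M.trace) 2 μ ∧
    ∫ ω, ((fun i => a i ω) ⬝ᵥ M *ᵥ (fun i => c i ω) - t * M.trace) ∂μ = 0 ∧
    ∫ ω, ((fun i => a i ω) ⬝ᵥ M *ᵥ (fun i => c i ω) - t * M.trace) ^ 2 ∂μ
      ≤ (A * C + t ^ 2 + V) * frobSq M := by
  have h42 : ∀ {f : Ω → ℝ}, MemLp f 4 μ → MemLp f 2 μ := fun h => h.mono_exponent (by norm_num)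
  have hac : ∀ i, MemLp (fun ω => a i ω * c i ω) 2 μ := fun i => memLp_two_mul (ha i) (hc i)
  have e : ∀ ω, (fun i => a i ω) ⬝ᵥ M *ᵥ (fun i => c i ω) - t * M.trace
      = ∑ i, ∑ j, offDiag M i j * (a i ω * c j ω) + ∑ i, M i i * (a i ω * c i ω - t) := fun ω => by
    rw [dotProduct_mulVec_eq_offDiag, trace, Finset.mul_sum, add_sub_assoc,
      ← Finset.sum_sub_distrib]
    congr 1
    exact Finset.sum_congr rfl fun i _ => by rw [diag_apply]; ring
  simp only [e]
  have hq : ∀ i, MemLp (fun ω => M i i * (a i ω * c i ω - t)) 2 μ := fun i =>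
    ((hac i).sub (memLp_const t)).const_mul _
  have hq0 : ∀ i, ∫ ω, M i i * (a i ω * c i ω - t) ∂μ = 0 := fun i => by
    rw [integral_const_mul, integral_sub ((hac i).integrable one_le_two) (integrable_const _), ht]
    simp
  have hind' : iIndepFun (fun i ω => (a i ω, c i ω, M i i * (a i ω * c i ω - t))) μ :=
    hind.comp (fun i (x : ℝ × ℝ) => (x.1, x.2, M i i * (x.1 * x.2 - t))) fun i => by fun_prop
  obtain ⟨h1, h2, h3⟩ := second_moment_bilinear (fun i => h42 (ha i)) (fun i => h42 (hc i)) hq hind'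
    ha0 hc0 hq0 hA hC ht (offDiag M) (offDiag_self M) Finset.univ
  refine ⟨h1, h2, h3.le.trans ?_⟩
  cases isEmpty_or_nonempty (Fin N) with
  | inl h => simp [frobSq]
  | inr h =>
    obtain ⟨i₀⟩ := h
    have hA0 : 0 ≤ A := hA i₀ ▸ integral_nonneg fun _ => sq_nonneg _
    have hC0 : 0 ≤ C := hC i₀ ▸ integral_nonneg fun _ => sq_nonneg _
    have hV0 : 0 ≤ V := hV i₀ ▸ integral_nonneg fun _ => sq_nonneg _
    have hof : ∀ i j, offDiag M i j ^ 2 ≤ M i j ^ 2 := fun i j => by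
      unfold offDiag
      split_ifs
      · simpa using sq_nonneg _
      · exact le_rfl
    have b1 : ∑ i, ∑ j, (A * C * offDiag M i j ^ 2 + t ^ 2 * (offDiag M i j * offDiag M j i))
        ≤ (A * C + t ^ 2) * frobSq M := by
      have : (A * C + t ^ 2) * frobSq M
          = ∑ i, ∑ j, (A * C * M i j ^ 2 + t ^ 2 * ((M i j ^ 2 + M j i ^ 2) / 2)) := by
        have hs : ∑ i, ∑ j, M j i ^ 2 = frobSq M := Finset.sum_comm
        have e0 : ∀ i j, A * C * M i j ^ 2 + t ^ 2 * ((M i j ^ 2 + M j i ^ 2) / 2)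
            = (A * C + t ^ 2 / 2) * M i j ^ 2 + t ^ 2 / 2 * M j i ^ 2 := fun i j => by ring
        simp only [e0, Finset.sum_add_distrib, ← Finset.mul_sum]
        rw [hs, ← frobSq]
        ring
      rw [this]
      refine Finset.sum_le_sum fun i _ => Finset.sum_le_sum fun j _ => add_le_add
        (mul_le_mul_of_nonneg_left (hof i j) (mul_nonneg hA0 hC0))
        (mul_le_mul_of_nonneg_left ?_ (sq_nonneg t))
      nlinarith [sq_nonneg (offDiag M i j - offDiag M j i), hof i j, hof j i]
    have b2 : ∑ i, ∫ ω, (M i i * (a i ω * c i ω - t)) ^ 2 ∂μ ≤ V * frobSq M := by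
      rw [frobSq, Finset.mul_sum]
      refine Finset.sum_le_sum fun i _ => ?_
      simp only [mul_pow, integral_const_mul, hV]
      rw [mul_comm]
      exact mul_le_mul_of_nonneg_left
        (Finset.single_le_sum (f := fun j => M i j ^ 2) (fun _ _ => sq_nonneg _)
          (Finset.mem_univ i)) hV0
    linarith

end QuadraticForms

section GaussianQuadratic

variable {N : ℕ}

/-- The quadratic polynomial `eᵀ A e + dᵀ e`. -/
def quad (A : Matrix (Fin N) (Fin N) ℝ) (d e : Fin N → ℝ) : ℝ := e ⬝ᵥ A *ᵥ e + d ⬝ᵥ e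

/-- The law of `N` independent centred normal errors with variance `v`. -/
abbrev gaussianPi (N : ℕ) (v : ℝ≥0) : Measure (Fin N → ℝ) :=
  Measure.pi fun _ : Fin N => gaussianReal 0 v

lemma memLp_eval_gaussianPi (v : ℝ≥0) (i : Fin N) (r : ℝ≥0) :
    MemLp (fun e : Fin N → ℝ => e i) r (gaussianPi N v) :=
  (memLp_id_gaussianReal r).comp_measurePreserving
    (measurePreserving_eval (fun _ : Fin N => gaussianReal 0 v) i)

lemma integral_eval_gaussianPi (v : ℝ≥0) (i : Fin N) {f : ℝ → ℝ} (hf : Continuous f) :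
    ∫ e, f (e i) ∂(gaussianPi N v) = ∫ x, f x ∂(gaussianReal 0 v) := by
  have h := measurePreserving_eval (fun _ : Fin N => gaussianReal 0 v) i
  rw [← h.map_eq, integral_map h.measurable.aemeasurable hf.aestronglyMeasurable]

/-- Mean and variance of a quadratic polynomial in independent normal variables; the linear and the
quadratic part are uncorrelated because third moments vanish. -/
lemma memLp_quad_and_moments (v : ℝ≥0) (A : Matrix (Fin N) (Fin N) ℝ) (d : Fin N → ℝ) :
    MemLp (quad A d) 2 (gaussianPi N v) ∧
    ∫ e, quad A d e ∂(gaussianPi N v) = v * A.trace ∧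
    Var[quad A d; gaussianPi N v]
      = (v : ℝ) ^ 2 * ((A * A).trace + (A * Aᵀ).trace) + v * (d ⬝ᵥ d) := by
  set μ := gaussianPi N v
  obtain ⟨g1, g2, g3, g4⟩ := integral_pow_gaussianReal v
  have hx : ∀ i, MemLp (fun e : Fin N → ℝ => e i) 4 μ := fun i => by
    simpa using memLp_eval_gaussianPi v i 4
  have hx2 : ∀ i, MemLp (fun e : Fin N → ℝ => e i) 2 μ := fun i => by
    simpa using memLp_eval_gaussianPi v i 2
  have hxx : ∀ i, MemLp (fun e : Fin N → ℝ => e i * e i) 2 μ := fun i => memLp_two_mul (hx i) (hx i)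
  have hxn : ∀ (i : Fin N) (n : ℕ), Integrable (fun e : Fin N → ℝ => e i ^ n) μ := fun i n => by
    have h : MemLp (fun e : Fin N → ℝ => e i) n μ := by
      simpa using memLp_eval_gaussianPi v i n
    refine (h.integrable_norm_pow').mono'
      ((measurable_pi_apply i).pow_const n).aestronglyMeasurable (Eventually.of_forall fun e => ?_)
    rw [norm_pow]
  have m1 : ∀ i : Fin N, ∫ e, e i ∂μ = 0 := fun i =>
    (integral_eval_gaussianPi v i continuous_id).trans g1
  have m2 : ∀ i : Fin N, ∫ e, e i ^ 2 ∂μ = v := fun i =>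
    (integral_eval_gaussianPi v i (continuous_pow 2)).trans g2
  have m3 : ∀ i : Fin N, ∫ e, e i ^ 3 ∂μ = 0 := fun i =>
    (integral_eval_gaussianPi v i (continuous_pow 3)).trans g3
  have m4 : ∀ i : Fin N, ∫ e, e i ^ 4 ∂μ = 3 * (v : ℝ) ^ 2 := fun i =>
    (integral_eval_gaussianPi v i (continuous_pow 4)).trans g4
  have e : ∀ ε, quad A d ε = (∑ i, ∑ j, offDiag A i j * (ε i * ε j)
      + ∑ i, (A i i * (ε i * ε i - v) + d i * ε i)) + v * A.trace := fun ε => by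
    have e1 : ∑ i, (A i i * (ε i * ε i - v) + d i * ε i)
        = ∑ i, A i i * (ε i * ε i) + d ⬝ᵥ ε - v * A.trace := by
      rw [trace, Finset.mul_sum, dotProduct, ← Finset.sum_add_distrib, ← Finset.sum_sub_distrib]
      exact Finset.sum_congr rfl fun i _ => by rw [diag_apply]; ring
    rw [quad, dotProduct_mulVec_eq_offDiag, e1]
    ring
  have hq : ∀ i, MemLp (fun ε : Fin N → ℝ => A i i * (ε i * ε i - v) + d i * ε i) 2 μ := fun i =>
    (((hxx i).sub (memLp_const (v : ℝ))).const_mul _).add ((hx2 i).const_mul _)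
  have hq0 : ∀ i, ∫ ε, (A i i * (ε i * ε i - v) + d i * ε i) ∂μ = 0 := fun i => by
    have i1 : Integrable (fun ε : Fin N → ℝ => A i i * (ε i * ε i - v)) μ :=
      (((hxx i).sub (memLp_const (v : ℝ))).const_mul _).integrable one_le_two
    rw [integral_add i1 (((hx2 i).const_mul _).integrable one_le_two), integral_const_mul,
      integral_const_mul, integral_sub ((hxx i).integrable one_le_two) (integrable_const _), m1]
    simp only [← sq, m2]
    simp
  have hq2 : ∀ i, ∫ ε, (A i i * (ε i * ε i - v) + d i * ε i) ^ 2 ∂μ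
      = 2 * (v : ℝ) ^ 2 * A i i ^ 2 + v * d i ^ 2 := fun i => by
    have ex : ∀ ε : Fin N → ℝ, (A i i * (ε i * ε i - v) + d i * ε i) ^ 2
        = A i i ^ 2 * ε i ^ 4 + 2 * A i i * d i * ε i ^ 3 + (d i ^ 2 - 2 * A i i ^ 2 * v) * ε i ^ 2
          + (- 2 * A i i * d i * v) * ε i ^ 1 + A i i ^ 2 * v ^ 2 := fun ε => by ring
    simp only [ex]
    have j4 := (hxn i 4).const_mul (A i i ^ 2)
    have j3 := (hxn i 3).const_mul (2 * A i i * d i)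
    have j2 := (hxn i 2).const_mul (d i ^ 2 - 2 * A i i ^ 2 * v)
    have j1 := (hxn i 1).const_mul (- 2 * A i i * d i * v)
    have iadd : ∀ {f g : (Fin N → ℝ) → ℝ}, Integrable f μ → Integrable g μ →
      Integrable (fun ω => f ω + g ω) μ := fun h h' => h.add h'
    rw [integral_add (iadd (iadd (iadd j4 j3) j2) j1) (integrable_const _),
      integral_add (iadd (iadd j4 j3) j2) j1, integral_add (iadd j4 j3) j2, integral_add j4 j3]
    simp only [integral_const_mul, m4, m3, m2, pow_one, m1]
    simp
    ring
  have hind : iIndepFun (fun (i : Fin N) (ε : Fin N → ℝ) =>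
      (ε i, ε i, A i i * (ε i * ε i - v) + d i * ε i)) μ :=
    iIndepFun_pi (X := fun (i : Fin N) (x : ℝ) => (x, x, A i i * (x * x - v) + d i * x))
      fun i => by fun_prop
  obtain ⟨h1, h2, h3⟩ := second_moment_bilinear hx2 hx2 hq hind m1 m1 hq0 m2 m2
    (t := v) (fun i => by simpa only [sq] using m2 i) (offDiag A) (offDiag_self A) Finset.univ
  set Z : (Fin N → ℝ) → ℝ := fun ε => ∑ i, ∑ j, offDiag A i j * (ε i * ε j)
      + ∑ i, (A i i * (ε i * ε i - v) + d i * ε i) with hZ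
  have eq : quad A d = fun ε => Z ε + v * A.trace := funext e
  rw [eq]
  refine ⟨h1.add (memLp_const _), ?_, ?_⟩
  · rw [integral_add (h1.integrable one_le_two) (integrable_const _), h2]
    simp
  · rw [variance_add_const h1.aestronglyMeasurable, variance_eq_sub h1, h2]
    simp only [Pi.pow_apply]
    rw [h3]
    simp only [hq2]
    have t1 : (A * A).trace = ∑ i, ∑ j, A i j * A j i := rfl
    have t2 : (A * Aᵀ).trace = ∑ i, ∑ j, A i j * A i j := rfl
    rw [t1, t2, dotProduct]
    have split : ∀ f : Fin N → Fin N → ℝ, ∑ i, ∑ j, f i j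
        = ∑ i, ∑ j, (if i = j then 0 else f i j) + ∑ i, f i i := fun f => by
      rw [← Finset.sum_add_distrib]
      refine Finset.sum_congr rfl fun i _ => ?_
      have : ∀ j, f i j = (if i = j then 0 else f i j) + if i = j then f i i else 0 := fun j => by
        split_ifs with h
        · subst h; simp
        · simp
      rw [Finset.sum_congr rfl fun j _ => this j, Finset.sum_add_distrib]
      simp
    rw [split fun i j => A i j * A j i, split fun i j => A i j * A i j]
    have e1 : ∀ i j, (v : ℝ) * v * offDiag A i j ^ 2 + (v : ℝ) ^ 2 * (offDiag A i j * offDiag A j i)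
        = (v : ℝ) ^ 2 * ((if i = j then 0 else A i j * A j i)
          + if i = j then 0 else A i j * A i j) := fun i j => by
      unfold offDiag
      by_cases h : i = j
      · simp [h]
      · simp only [h, Ne.symm h, if_false]; ring
    simp only [e1, ← Finset.mul_sum, Finset.sum_add_distrib]
    have e2 : ∑ i, A i i ^ 2 = ∑ i, A i i * A i i := by simp only [sq]
    have e3 : ∑ i, d i ^ 2 = ∑ i, d i * d i := by simp only [sq]
    rw [e2, e3]
    ring

/-- Covariances of quadratic polynomials, by polarization of the variance. -/
lemma covariance_quad (v : ℝ≥0) (A B : Matrix (Fin N) (Fin N) ℝ) (d d' : Fin N → ℝ) :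
    cov[quad A d, quad B d'; gaussianPi N v]
      = (v : ℝ) ^ 2 * ((A * B).trace + (A * Bᵀ).trace) + v * (d ⬝ᵥ d') := by
  obtain ⟨hA, -, vA⟩ := memLp_quad_and_moments v A d
  obtain ⟨hB, -, vB⟩ := memLp_quad_and_moments v B d'
  obtain ⟨-, -, vAB⟩ := memLp_quad_and_moments v (A + B) (d + d')
  have h := variance_add hA hB
  have e : quad A d + quad B d' = quad (A + B) (d + d') := by
    ext ε
    simp only [Pi.add_apply, quad, add_mulVec, dotProduct_add, add_dotProduct]
    ring
  have c1 : (B * A).trace = (A * B).trace := trace_mul_comm B A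
  have c2 : (B * Aᵀ).trace = (A * Bᵀ).trace := by
    rw [← trace_transpose, transpose_mul, transpose_transpose]
  rw [e, vA, vB, vAB] at h
  simp only [add_mul, mul_add, transpose_add, trace_add, c1, c2, dotProduct_add,
    add_dotProduct] at h
  rw [dotProduct_comm d' d] at h
  linarith

end GaussianQuadratic

/-! ### The score of the local objectives -/

section Gradient

variable {N p K : ℕ}

lemma F_apply (W : Matrix (Fin N) (Fin N) ℝ) (y : Fin N → ℝ) (X : Matrix (Fin N) (Fin p) ℝ)
    (θ : Idx p → ℝ) (i : Fin N) :
    F W y X θ i = (1 + rho θ ^ 2 * (Wᵀ * W) i i)⁻¹ *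
      ((y i - rho θ * (W *ᵥ y) i - (X *ᵥ beta θ) i)
        - rho θ * ((Wᵀ *ᵥ y) i - rho θ * (Wᵀ *ᵥ W *ᵥ y) i - (Wᵀ *ᵥ X *ᵥ beta θ) i)) := by
  simp only [F, S, D]
  rw [← mulVec_mulVec, mulVec_diagonal, transpose_sub, transpose_one, transpose_smul]
  simp only [sub_mulVec, one_mulVec, smul_mulVec, mulVec_sub, mulVec_smul, Pi.sub_apply,
    Pi.smul_apply, smul_eq_mul]
  ring

lemma Ddot_mulVec (W : Matrix (Fin N) (Fin N) ℝ) (ρ : ℝ) (z : Fin N → ℝ) (i : Fin N) :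
    (Ddot W ρ *ᵥ z) i
      = -2 * ρ * (((1 + ρ ^ 2 * (Wᵀ * W) i i)⁻¹) ^ 2 * (Wᵀ * W) i i) * z i := by
  rw [Ddot, D, diagonal_pow, diagonal_mul_diagonal, smul_mulVec, Pi.smul_apply, mulVec_diagonal,
    smul_eq_mul, diag_apply, Pi.pow_apply]
  ring

lemma differentiable_F (W : Matrix (Fin N) (Fin N) ℝ) (y : Fin N → ℝ)
    (X : Matrix (Fin N) (Fin p) ℝ) (i : Fin N) :
    Differentiable ℝ fun θ => F W y X θ i := by
  have h : ∀ ρ : ℝ, 1 + ρ ^ 2 * (Wᵀ * W) i i ≠ 0 := fun ρ => by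
    have := gram_diag_nonneg W i
    positivity
  simp only [F_apply, mulVec_mulVec]
  simp only [mulVec, dotProduct, rho, beta]
  fun_prop (disch := exact fun θ => h _)

/-- The derivative of the vector `F` in the direction of a parameter coordinate. -/
def gradF (W : Matrix (Fin N) (Fin N) ℝ) (y : Fin N → ℝ) (X : Matrix (Fin N) (Fin p) ℝ)
    (θ : Idx p → ℝ) : Idx p → Fin N → ℝ
  | Sum.inl _ => (Ddot W (rho θ) * (S W (rho θ))ᵀ - D W (rho θ) * Wᵀ) *ᵥ
      (S W (rho θ) *ᵥ y - X *ᵥ beta θ) - (D W (rho θ) * (S W (rho θ))ᵀ * W) *ᵥ y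
  | Sum.inr j => -((D W (rho θ) * (S W (rho θ))ᵀ) *ᵥ fun i => X i j)

lemma hasLineDerivAt_F (W : Matrix (Fin N) (Fin N) ℝ) (y : Fin N → ℝ)
    (X : Matrix (Fin N) (Fin p) ℝ) (θ : Idx p → ℝ) (a : Idx p) (i : Fin N) :
    HasLineDerivAt ℝ (fun θ => F W y X θ i) (gradF W y X θ a i) θ (Pi.single a 1) := by
  rw [HasLineDerivAt]
  have hid := hasDerivAt_id (0 : ℝ)
  cases a with
  | inl u =>
    have hr : ∀ t : ℝ, rho (θ + t • Pi.single (Sum.inl u) 1 : Idx p → ℝ) = rho θ + t := fun t => by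
      simp [rho]
    have hb : ∀ t : ℝ, beta (θ + t • Pi.single (Sum.inl u) 1 : Idx p → ℝ) = beta θ := fun t => by
      ext j; simp [beta]
    simp only [F_apply, hr, hb]
    have h0 : 1 + rho θ ^ 2 * (Wᵀ * W) i i ≠ 0 := by
      have := gram_diag_nonneg W i
      positivity
    simp only [gradF]
    rw [Pi.sub_apply, sub_mulVec, Pi.sub_apply, ← mulVec_mulVec, Ddot_mulVec, ← mulVec_mulVec,
      ← mulVec_mulVec, ← mulVec_mulVec, D, S, mulVec_diagonal, mulVec_diagonal,
      transpose_sub, transpose_one, transpose_smul]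
    simp only [sub_mulVec, one_mulVec, smul_mulVec, mulVec_sub, mulVec_smul, Pi.sub_apply,
      Pi.smul_apply, smul_eq_mul]
    generalize rho θ = ρ at h0
    generalize (Wᵀ * W) i i = g at h0
    have h1 : HasDerivAt (fun t : ℝ => (1 + (ρ + t) ^ 2 * g)⁻¹)
        (-2 * ρ * (((1 + ρ ^ 2 * g)⁻¹) ^ 2 * g)) 0 := by
      have h := ((((hid.const_add ρ).fun_pow 2).mul_const g).const_add 1).fun_inv
        (by simpa using h0)
      refine h.congr_deriv ?_
      simp only [id, add_zero]
      rw [div_eq_mul_inv, inv_pow]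
      push_cast
      ring
    have h2 := (((hid.const_add ρ).mul_const ((W *ᵥ y) i)).const_sub (y i)).sub_const
      ((X *ᵥ beta θ) i)
    have h3 := (((hid.const_add ρ).mul_const ((Wᵀ *ᵥ W *ᵥ y) i)).const_sub
      ((Wᵀ *ᵥ y) i)).sub_const ((Wᵀ *ᵥ X *ᵥ beta θ) i)
    refine (h1.fun_mul (h2.fun_sub ((hid.const_add ρ).fun_mul h3))).congr_deriv ?_
    simp only [id, add_zero]
    ring
  | inr j =>
    have hr : ∀ t : ℝ, rho (θ + t • Pi.single (Sum.inr j) 1 : Idx p → ℝ) = rho θ := fun t => by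
      simp [rho]
    have hb : ∀ t : ℝ, beta (θ + t • Pi.single (Sum.inr j) 1 : Idx p → ℝ)
        = beta θ + t • Pi.single j 1 := fun t => by
      ext j'
      simp only [beta, Pi.add_apply, Pi.smul_apply, smul_eq_mul, Pi.single_apply, Sum.inr.injEq]
    simp only [F_apply, hr, hb, mulVec_add, mulVec_smul, mulVec_single_one, Pi.add_apply,
      Pi.smul_apply, smul_eq_mul]
    set ρ := rho θ
    have h2 := ((hid.mul_const (X.col j i)).const_add ((X *ᵥ beta θ) i)).const_sub
      (y i - ρ * (W *ᵥ y) i)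
    have h3 := ((hid.mul_const ((Wᵀ *ᵥ X.col j) i)).const_add ((Wᵀ *ᵥ X *ᵥ beta θ) i)).const_sub
      ((Wᵀ *ᵥ y) i - ρ * (Wᵀ *ᵥ W *ᵥ y) i)
    refine ((h2.sub (h3.const_mul ρ)).const_mul (1 + ρ ^ 2 * (Wᵀ * W) i i)⁻¹).congr_deriv ?_
    simp only [gradF, D, S]
    rw [← mulVec_mulVec, transpose_sub, transpose_one, transpose_smul]
    simp only [sub_mulVec, one_mulVec, smul_mulVec, Pi.sub_apply, Pi.neg_apply,
      Pi.smul_apply, smul_eq_mul, mulVec_diagonal]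
    change _ = -((1 + ρ ^ 2 * (Wᵀ * W) i i)⁻¹ * (X.col j i - ρ * (Wᵀ *ᵥ X.col j) i))
    ring

lemma Qdot_eq (W : Matrix (Fin N) (Fin N) ℝ) (part : Fin N → Fin K) (k : Fin K) (y : Fin N → ℝ)
    (X : Matrix (Fin N) (Fin p) ℝ) (θ : Idx p → ℝ) (a : Idx p) :
    Qdot W part k y X θ a
      = (size part k)⁻¹ * ∑ i ∈ nodes part k, 2 * (F W y X θ i * gradF W y X θ a i) := by
  have hd : DifferentiableAt ℝ (Q W part k y X) θ := by
    unfold Q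
    have h := fun i => differentiable_F W y X i
    fun_prop
  rw [Qdot, ← hd.lineDeriv_eq_fderiv]
  refine HasLineDerivAt.lineDeriv ?_
  have h : HasDerivAt (fun t : ℝ => ∑ i ∈ nodes part k,
      F W y X (θ + t • (Pi.single a 1 : Idx p → ℝ)) i ^ 2)
      (∑ i ∈ nodes part k, 2 * (F W y X θ i * gradF W y X θ a i)) 0 := by
    refine HasDerivAt.fun_sum fun i _ => ?_
    have h1 : HasDerivAt (fun t : ℝ => F W y X (θ + t • (Pi.single a 1 : Idx p → ℝ)) i)
      (gradF W y X θ a i) 0 := hasLineDerivAt_F W y X θ a i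
    refine (h1.pow 2).congr_deriv ?_
    simp only [zero_smul, add_zero]
    push_cast
    ring
  exact h.const_mul _

lemma size_pos {part : Fin N → Fin K} (hpart : Function.Surjective part) (k : Fin K) :
    0 < size part k := by
  obtain ⟨i, hi⟩ := hpart k
  rw [size, Nat.cast_pos, Finset.card_pos]
  exact ⟨i, by simp [nodes, hi]⟩

lemma sum_sum_nodes (part : Fin N → Fin K) (f : Fin N → ℝ) :
    ∑ k, ∑ i ∈ nodes part k, f i = ∑ i, f i := by
  simp only [nodes]
  exact Finset.sum_fiberwise _ _ _

/-- The workers are recombined: the local gradients, weighted by the numbers of nodes, add up to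
the gradient of the global least squares objective. -/
lemma sum_size_mul_Qdot (W : Matrix (Fin N) (Fin N) ℝ) {part : Fin N → Fin K}
    (hpart : Function.Surjective part) (y : Fin N → ℝ)
    (X : Matrix (Fin N) (Fin p) ℝ) (θ : Idx p → ℝ) (a : Idx p) :
    ∑ k, size part k * Qdot W part k y X θ a = 2 * (F W y X θ ⬝ᵥ gradF W y X θ a) := by
  have h : ∀ k, size part k * Qdot W part k y X θ a
      = ∑ i ∈ nodes part k, 2 * (F W y X θ i * gradF W y X θ a i) := fun k => by
    rw [Qdot_eq, mul_inv_cancel_left₀ (size_pos hpart k).ne']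
  simp only [h]
  rw [sum_sum_nodes, dotProduct, Finset.mul_sum]

/-- The matrix `H = S D² Sᵀ`. -/
def H (W : Matrix (Fin N) (Fin N) ℝ) (ρ : ℝ) : Matrix (Fin N) (Fin N) ℝ :=
  S W ρ * D W ρ * D W ρ * (S W ρ)ᵀ

/-- The covariate vectors that drive the score: `X β` for `ρ`, the columns of `X` for `β`. -/
def regressor (θ : Idx p → ℝ) (X : Matrix (Fin N) (Fin p) ℝ) : Idx p → Fin N → ℝ
  | Sum.inl _ => X *ᵥ beta θ
  | Sum.inr j => fun i => X i j

/-- The matrices through which the covariate vectors enter the score: `W S⁻¹` for `ρ`, the identity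
for `β`. -/
def loading (W : Matrix (Fin N) (Fin N) ℝ) (ρ : ℝ) : Idx p → Matrix (Fin N) (Fin N) ℝ
  | Sum.inl _ => W * (S W ρ)⁻¹
  | Sum.inr _ => 1

/-- The matrix of the quadratic part of the score for `ρ`, up to the factor `2`:
`S D (Ḋ Sᵀ - D Wᵀ - D Sᵀ W S⁻¹)`. -/
def scoreMat (W : Matrix (Fin N) (Fin N) ℝ) (ρ : ℝ) : Matrix (Fin N) (Fin N) ℝ :=
  S W ρ * D W ρ *
    (Ddot W ρ * (S W ρ)ᵀ - D W ρ * Wᵀ - D W ρ * (S W ρ)ᵀ * W * (S W ρ)⁻¹)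

/-- The matrix of the quadratic part of the score, which vanishes for the coordinates of `β`. -/
def scoreQuad (W : Matrix (Fin N) (Fin N) ℝ) (ρ : ℝ) : Idx p → Matrix (Fin N) (Fin N) ℝ
  | Sum.inl _ => (2 : ℝ) • scoreMat W ρ
  | Sum.inr _ => 0

/-- The coefficient vector of the part of the score that is linear in the errors. -/
def scoreLin (W : Matrix (Fin N) (Fin N) ℝ) (θ : Idx p → ℝ) (X : Matrix (Fin N) (Fin p) ℝ)
    (a : Idx p) : Fin N → ℝ :=
  (-2 : ℝ) • (H W (rho θ) * loading W (rho θ) a) *ᵥ regressor θ X a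

lemma D_transpose (W : Matrix (Fin N) (Fin N) ℝ) (ρ : ℝ) : (D W ρ)ᵀ = D W ρ :=
  diagonal_transpose _

lemma Ddot_transpose (W : Matrix (Fin N) (Fin N) ℝ) (ρ : ℝ) : (Ddot W ρ)ᵀ = Ddot W ρ := by
  rw [Ddot, transpose_smul, transpose_mul, transpose_pow, D_transpose, diagonal_transpose, D,
    diagonal_pow, diagonal_mul_diagonal, diagonal_mul_diagonal]
  simp only [mul_comm]

lemma S_mulVec_response {W : Matrix (Fin N) (Fin N) ℝ} (hW : IsStochastic W) {θ : Idx p → ℝ}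
    (hρ : |rho θ| < 1) (X : Matrix (Fin N) (Fin p) ℝ) (e : Fin N → ℝ) :
    S W (rho θ) *ᵥ response W θ X e = X *ᵥ beta θ + e := by
  rw [response, mulVec_mulVec, hW.S_mul_inv hρ, one_mulVec]

lemma F_response {W : Matrix (Fin N) (Fin N) ℝ} (hW : IsStochastic W) {θ : Idx p → ℝ}
    (hρ : |rho θ| < 1) (X : Matrix (Fin N) (Fin p) ℝ) (e : Fin N → ℝ) :
    F W (response W θ X e) X θ = (D W (rho θ) * (S W (rho θ))ᵀ) *ᵥ e := by
  rw [F, S_mulVec_response hW hρ, add_sub_cancel_left]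

/-- At the true parameter the score is a quadratic polynomial of the errors. -/
lemma score_eq_quad {W : Matrix (Fin N) (Fin N) ℝ} (hW : IsStochastic W) {θ : Idx p → ℝ}
    (hρ : |rho θ| < 1) (X : Matrix (Fin N) (Fin p) ℝ) (e : Fin N → ℝ) (a : Idx p) :
    2 * (F W (response W θ X e) X θ ⬝ᵥ gradF W (response W θ X e) X θ a)
      = quad (scoreQuad W (rho θ) a) (scoreLin W θ X a) e := by
  rw [F_response hW hρ]
  have key : ∀ z : Fin N → ℝ, (D W (rho θ) * (S W (rho θ))ᵀ) *ᵥ e ⬝ᵥ z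
      = e ⬝ᵥ (S W (rho θ) * D W (rho θ)) *ᵥ z := fun z => by
    rw [dotProduct_mulVec, ← mulVec_transpose, transpose_mul, D_transpose]
  rw [key]
  cases a with
  | inl u =>
    simp only [gradF, S_mulVec_response hW hρ, add_sub_cancel_left, scoreQuad, scoreLin, quad,
      loading, regressor, scoreMat, H]
    rw [response, smul_mulVec, dotProduct_smul, smul_dotProduct, dotProduct_comm _ e]
    simp only [mulVec_add, mulVec_sub, mulVec_mulVec, dotProduct_add, dotProduct_sub, mul_sub,
      sub_mulVec, smul_eq_mul, Matrix.mul_assoc]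
    ring
  | inr j =>
    simp only [gradF, scoreQuad, scoreLin, quad, loading, regressor, H]
    rw [mulVec_neg, dotProduct_neg, mulVec_mulVec, zero_mulVec, dotProduct_zero,
      smul_dotProduct, dotProduct_comm _ e, mul_one]
    simp only [mul_assoc, smul_eq_mul]
    ring

end Gradient

/-! ### The asymptotic covariance matrix of the score in closed form -/

section Sigma

variable {N p K : ℕ} {Ω : Type*} [MeasurableSpace Ω] {P : Measure Ω}

lemma memLp_mulVec {q : ℝ≥0∞} {n : ℕ} {z : Ω → Fin n → ℝ} (hz : ∀ j, MemLp (fun ω => z ω j) q P)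
    (M : Matrix (Fin N) (Fin n) ℝ) (i : Fin N) : MemLp (fun ω => (M *ᵥ z ω) i) q P := by
  simp only [mulVec, dotProduct]
  exact memLp_finsetSum _ fun j _ => (hz j).const_mul _

lemma memLp_row_mulVec {q : ℝ≥0∞} {X : Ω → Matrix (Fin N) (Fin p) ℝ}
    (hX : ∀ i j, MemLp (fun ω => X ω i j) q P) (b : Fin p → ℝ) (i : Fin N) :
    MemLp (fun ω => (X ω *ᵥ b) i) q P := by
  simp only [mulVec, dotProduct]
  exact memLp_finsetSum _ fun j _ => (hX i j).mul_const _

lemma memLp_Qdot {W : Matrix (Fin N) (Fin N) ℝ} (hW : IsStochastic W) {θ : Idx p → ℝ}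
    (hρ : |rho θ| < 1) (part : Fin N → Fin K) {X : Ω → Matrix (Fin N) (Fin p) ℝ}
    {e : Ω → Fin N → ℝ} (hX : ∀ i j, MemLp (fun ω => X ω i j) 4 P)
    (he : ∀ i, MemLp (fun ω => e ω i) 4 P) (k : Fin K) (a : Idx p) :
    MemLp (fun ω => Qdot W part k (response W θ (X ω) (e ω)) (X ω) θ a) 2 P := by
  simp only [Qdot_eq]
  refine (memLp_finsetSum _ fun i _ => (memLp_two_mul ?_ ?_).const_mul 2).const_mul _
  · simp only [F_response hW hρ]
    exact memLp_mulVec he _ i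
  · cases a with
    | inl u =>
      have e1 : ∀ ω, gradF W (response W θ (X ω) (e ω)) (X ω) θ (Sum.inl u) i
          = ((Ddot W (rho θ) * (S W (rho θ))ᵀ - D W (rho θ) * Wᵀ) *ᵥ e ω) i
            - ((D W (rho θ) * (S W (rho θ))ᵀ * W * (S W (rho θ))⁻¹) *ᵥ
              (X ω *ᵥ beta θ + e ω)) i := fun ω => by
        rw [gradF, S_mulVec_response hW hρ, add_sub_cancel_left, response,
          mulVec_mulVec (X ω *ᵥ beta θ + e ω), Pi.sub_apply]
      simp only [e1]
      have h : ∀ j, MemLp (fun ω => (X ω *ᵥ beta θ + e ω) j) 4 P := fun j =>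
        (memLp_row_mulVec hX (beta θ) j).add (he j)
      exact (memLp_mulVec he _ i).sub (memLp_mulVec h _ i)
    | inr j =>
      simp only [gradF]
      exact (memLp_mulVec (fun i => hX i j) _ i).neg

lemma score_eq_sum_Qdot {W : Matrix (Fin N) (Fin N) ℝ} (hW : IsStochastic W)
    {θ : Idx p → ℝ} (hρ : |rho θ| < 1) {part : Fin N → Fin K} (hpart : Function.Surjective part)
    (X : Matrix (Fin N) (Fin p) ℝ) (e : Fin N → ℝ) (a : Idx p) :
    quad (scoreQuad W (rho θ) a) (scoreLin W θ X a) e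
      = ∑ k, size part k * Qdot W part k (response W θ X e) X θ a := by
  rw [sum_size_mul_Qdot W hpart, score_eq_quad hW hρ]

/-- The double sum over the workers collapses to the covariances of the global score. -/
lemma Sigma1_apply [IsProbabilityMeasure P] {W : Matrix (Fin N) (Fin N) ℝ} (hW : IsStochastic W)
    {θ : Idx p → ℝ} (hρ : |rho θ| < 1) {part : Fin N → Fin K} (hpart : Function.Surjective part)
    {X : Ω → Matrix (Fin N) (Fin p) ℝ} {e : Ω → Fin N → ℝ}
    (hX : ∀ i j, MemLp (fun ω => X ω i j) 4 P) (he : ∀ i, MemLp (fun ω => e ω i) 4 P)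
    (a b : Idx p) :
    Sigma1 W part θ P X e a b = (N : ℝ)⁻¹ *
      cov[fun ω => quad (scoreQuad W (rho θ) a) (scoreLin W θ (X ω) a) (e ω),
        fun ω => quad (scoreQuad W (rho θ) b) (scoreLin W θ (X ω) b) (e ω); P] := by
  have hL := fun k a => memLp_Qdot hW hρ part hX he k a
  have hsum : ∀ a, (fun ω => quad (scoreQuad W (rho θ) a) (scoreLin W θ (X ω) a) (e ω))
      = fun ω => ∑ k, size part k * Qdot W part k (response W θ (X ω) (e ω)) (X ω) θ a :=
    fun a => funext fun ω => score_eq_sum_Qdot hW hρ hpart _ _ a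
  rw [hsum, hsum, covariance_fun_sum_fun_sum (fun k => (hL k a).const_mul _)
    (fun k => (hL k b).const_mul _), Sigma1, Finset.mul_sum, Matrix.sum_apply]
  refine Finset.sum_congr rfl fun k _ => ?_
  rw [Matrix.sum_apply, Finset.mul_sum]
  refine Finset.sum_congr rfl fun l _ => ?_
  rw [covariance_const_mul_left, covariance_const_mul_right, Matrix.smul_apply, Sigma1kl,
    of_apply, smul_eq_mul, ← mul_assoc]
  have hk := size_pos hpart k
  have hl := size_pos hpart l
  have e1 : weight part k * weight part l
      = (size part k * size part l) * ((N : ℝ)⁻¹ * (N : ℝ)⁻¹) := by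
    simp only [weight]; ring
  rw [e1, Real.sqrt_mul (by positivity), Real.sqrt_mul_self (by positivity)]
  have e2 := Real.mul_self_sqrt (mul_nonneg hk.le hl.le)
  have e3 : √(size part k * size part l) * (N : ℝ)⁻¹ * √(size part k * size part l)
      = (N : ℝ)⁻¹ * (size part k * size part l) := by
    rw [← e2]; ring_nf; rw [Real.sq_sqrt (by positivity)]
  rw [e3]
  ring

/-- `Σ₁` for given covariates. -/
lemma Sigma1Given_apply {W : Matrix (Fin N) (Fin N) ℝ} (hW : IsStochastic W)
    {θ : Idx p → ℝ} (hρ : |rho θ| < 1) {part : Fin N → Fin K} (hpart : Function.Surjective part)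
    (v : ℝ≥0) (x : Matrix (Fin N) (Fin p) ℝ) (a b : Idx p) :
    Sigma1Given W part θ v x a b = (N : ℝ)⁻¹ *
      ((v : ℝ) ^ 2 * ((scoreQuad W (rho θ) a * scoreQuad W (rho θ) b).trace
          + (scoreQuad W (rho θ) a * (scoreQuad W (rho θ) b)ᵀ).trace)
        + v * (scoreLin W θ x a ⬝ᵥ scoreLin W θ x b)) := by
  rw [← covariance_quad]
  exact Sigma1_apply (X := fun _ => x) (e := fun e => e) hW hρ hpart (fun i j => memLp_const _)
    (fun i => by simpa using memLp_eval_gaussianPi v i 4) a b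

lemma measurable_regressor (θ : Idx p → ℝ) (a : Idx p) :
    Measurable fun x : Fin N → Fin p → ℝ => regressor θ (Matrix.of x) a := by
  refine measurable_pi_lambda _ fun i => ?_
  cases a with
  | inl u =>
    simp only [regressor, mulVec, dotProduct, of_apply]
    fun_prop
  | inr j =>
    simp only [regressor, of_apply]
    fun_prop

lemma measurable_quad_score (W : Matrix (Fin N) (Fin N) ℝ) (θ : Idx p → ℝ) (a : Idx p) :
    Measurable fun z : (Fin N → Fin p → ℝ) × (Fin N → ℝ) =>
      quad (scoreQuad W (rho θ) a) (scoreLin W θ (Matrix.of z.1) a) z.2 := by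
  have h' : ∀ i, Measurable fun z : (Fin N → Fin p → ℝ) × (Fin N → ℝ) =>
    regressor θ (Matrix.of z.1) a i := fun i =>
      (measurable_pi_apply i).comp ((measurable_regressor θ a).comp measurable_fst)
  simp only [quad, scoreLin, dotProduct, Pi.smul_apply, smul_eq_mul, mulVec]
  fun_prop

/-- The unconditional `Σ₁` is the mean of `Σ₁` for given covariates: given the covariates, the
score has the constant mean `v tr A`. -/
lemma Sigma1_eq_integral [IsProbabilityMeasure P] {W : Matrix (Fin N) (Fin N) ℝ}
    (hW : IsStochastic W)
    {θ : Idx p → ℝ} (hρ : |rho θ| < 1) {part : Fin N → Fin K} (hpart : Function.Surjective part)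
    {v : ℝ≥0} {X : Fin N → Ω → Fin p → ℝ} {e : Fin N → Ω → ℝ}
    {ν : Measure (Fin N → Fin p → ℝ)} [SFinite ν]
    (hlaw : HasLaw (fun ω => (fun i => X i ω, fun i => e i ω)) (ν.prod (gaussianPi N v)) P)
    (hX : ∀ i j, MemLp (fun ω => X i ω j) 4 P) (he : ∀ i, MemLp (fun ω => e i ω) 4 P)
    (a b : Idx p) :
    Sigma1 W part θ P (fun ω => Matrix.of fun i => X i ω) (fun ω i => e i ω) a b
      = ∫ x, Sigma1Given W part θ v (Matrix.of x) a b ∂ν := by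
  set f : Idx p → (Fin N → Fin p → ℝ) × (Fin N → ℝ) → ℝ := fun a z =>
    quad (scoreQuad W (rho θ) a) (scoreLin W θ (Matrix.of z.1) a) z.2 with hf
  have hfm : ∀ a, Measurable (f a) := measurable_quad_score W θ
  have hfL : ∀ a, MemLp (f a) 2 (ν.prod (gaussianPi N v)) := fun a => by
    rw [← hlaw.map_eq, memLp_map_measure_iff (hfm a).aestronglyMeasurable hlaw.aemeasurable]
    have hL := fun k => memLp_Qdot hW hρ part (X := fun ω => Matrix.of fun i => X i ω)
      (e := fun ω i => e i ω) hX he k a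
    have := memLp_finsetSum Finset.univ fun k _ => (hL k).const_mul (size part k)
    refine this.ae_eq (Eventually.of_forall fun ω => ?_)
    exact (score_eq_sum_Qdot hW hρ hpart _ _ a).symm
  have : IsProbabilityMeasure (ν.prod (gaussianPi N v)) := by
    rw [← hlaw.map_eq]
    exact Measure.isProbabilityMeasure_map hlaw.aemeasurable
  have hmean : ∀ a, ∫ z, f a z ∂(ν.prod (gaussianPi N v))
      = v * (scoreQuad W (rho θ) a).trace := fun a => by
    have : IsProbabilityMeasure ν := by
      rw [← Measure.fst_prod (μ := ν) (ν := gaussianPi N v)]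
      infer_instance
    rw [integral_prod _ ((hfL a).integrable one_le_two)]
    simp only [hf, (memLp_quad_and_moments v _ _).2.1]
    simp
  rw [Sigma1_apply (X := fun ω => Matrix.of fun i => X i ω) (e := fun ω i => e i ω) hW hρ hpart
    hX he]
  have h1 : cov[fun ω => f a (fun i => X i ω, fun i => e i ω),
      fun ω => f b (fun i => X i ω, fun i => e i ω); P] = cov[f a, f b; ν.prod (gaussianPi N v)] :=
    hlaw.covariance_fun_comp (hfm a).aemeasurable (hfm b).aemeasurable
  refine (congrArg (fun c => (N : ℝ)⁻¹ * c) h1).trans ?_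
  rw [covariance, hmean, hmean, integral_prod, ← integral_const_mul]
  · refine integral_congr_ae (Eventually.of_forall fun x => ?_)
    simp only
    rw [Sigma1Given_apply hW hρ hpart, ← covariance_quad, covariance]
    rw [(memLp_quad_and_moments v _ _).2.1, (memLp_quad_and_moments v _ _).2.1]
  · exact ((hfL a).sub (memLp_const _)).integrable_mul ((hfL b).sub (memLp_const _))

end Sigma

/-! ### The estimator with the workers recombined -/

section Estimator

variable {N p K : ℕ}

lemma sum_J (part : Fin N → Fin K) : ∑ k, J part k = 1 := by
  ext i j
  rw [Matrix.sum_apply]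
  by_cases h : i = j
  · subst h; simp [J]
  · simp [J, h]

lemma sqrt_weight_mul_div {part : Fin N → Fin K} (hpart : Function.Surjective part) (k l : Fin K)
    (t : ℝ) : √(weight part k * weight part l) * (t / √(size part k * size part l))
      = t * (N : ℝ)⁻¹ := by
  have hk := size_pos hpart k
  have hl := size_pos hpart l
  have e1 : weight part k * weight part l
      = (size part k * size part l) * ((N : ℝ)⁻¹ * (N : ℝ)⁻¹) := by
    simp only [weight]; ring
  have h0 : √(size part k * size part l) ≠ 0 := (Real.sqrt_pos.2 (mul_pos hk hl)).ne'
  rw [e1, Real.sqrt_mul (by positivity), Real.sqrt_mul_self (by positivity)]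
  field_simp

/-- `Ξ† = (Sᵀ S Ḋ - Sᵀ W D - Wᵀ S D) D`, the sum of the `Ξ†_k`. -/
def XiSum (W : Matrix (Fin N) (Fin N) ℝ) (ρ : ℝ) : Matrix (Fin N) (Fin N) ℝ :=
  ((S W ρ)ᵀ * S W ρ * Ddot W ρ - (S W ρ)ᵀ * W * D W ρ - Wᵀ * S W ρ * D W ρ) * D W ρ

/-- `V₁ᵀ V₂`, for the sums `V₁ = D Sᵀ` and `V₂ = M̃ D Sᵀ` over the workers. -/
def VSum (W : Matrix (Fin N) (Fin N) ℝ) (ρ : ℝ) : Matrix (Fin N) (Fin N) ℝ :=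
  (D W ρ * (S W ρ)ᵀ)ᵀ * (Mtilde W ρ * D W ρ * (S W ρ)ᵀ)

/-- The vectors whose images under `H` are the sums of the `T₁ₖ` and of the rows of the `T₃ₖ`. -/
def hatRegressor (W : Matrix (Fin N) (Fin N) ℝ) (y : Fin N → ℝ) (X : Matrix (Fin N) (Fin p) ℝ) :
    Idx p → Fin N → ℝ
  | Sum.inl _ => W *ᵥ y
  | Sum.inr j => fun i => X i j

/-- The sum of the `T₂ₖ`, as a column vector `S D² Wᵀ S y`. -/
def T2Sum (W : Matrix (Fin N) (Fin N) ℝ) (y : Fin N → ℝ) (ρ : ℝ) : Fin N → ℝ :=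
  (S W ρ * D W ρ * D W ρ * Wᵀ) *ᵥ S W ρ *ᵥ y

lemma H_transpose (W : Matrix (Fin N) (Fin N) ℝ) (ρ : ℝ) : (H W ρ)ᵀ = H W ρ := by
  simp only [H, transpose_mul, transpose_transpose, D_transpose, mul_assoc]

lemma sum_XiDag (W : Matrix (Fin N) (Fin N) ℝ) (part : Fin N → Fin K) (ρ : ℝ) :
    ∑ k, XiDag W part k ρ = XiSum W ρ := by
  simp only [XiDag, XiSum, ← Finset.sum_mul, ← Finset.mul_sum, sum_J, mul_one]

lemma sum_V1 (W : Matrix (Fin N) (Fin N) ℝ) (part : Fin N → Fin K) (ρ : ℝ) :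
    ∑ k, V1 W part k ρ = D W ρ * (S W ρ)ᵀ := by
  simp only [V1, ← Finset.mul_sum, sum_J, mul_one]

lemma sum_V2 (W : Matrix (Fin N) (Fin N) ℝ) (part : Fin N → Fin K) (ρ : ℝ) :
    ∑ k, V2 W part k ρ = Mtilde W ρ * D W ρ * (S W ρ)ᵀ := by
  simp only [V2, ← Finset.sum_mul, ← Finset.mul_sum, sum_J, mul_one]

lemma sum_T1 (W : Matrix (Fin N) (Fin N) ℝ) (part : Fin N → Fin K) (y : Fin N → ℝ) (ρ : ℝ) :
    ∑ k, T1 W part k y ρ = H W ρ *ᵥ W *ᵥ y := by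
  simp only [T1, ← vecMul_sum, ← Finset.sum_mul, ← Finset.mul_sum, sum_J, mul_one]
  rw [← mulVec_transpose, mulVec_mulVec]
  simp only [H, transpose_mul, transpose_transpose, D_transpose, mul_assoc]

lemma sum_T2 (W : Matrix (Fin N) (Fin N) ℝ) (part : Fin N → Fin K) (y : Fin N → ℝ) (ρ : ℝ) :
    ∑ k, T2 W part k y ρ = T2Sum W y ρ := by
  simp only [T2, ← vecMul_sum, ← Finset.sum_mul, ← Finset.mul_sum, sum_J, mul_one]
  rw [← mulVec_transpose, T2Sum, mulVec_mulVec]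
  simp only [transpose_mul, transpose_transpose, D_transpose, mul_assoc]

lemma T3_row (W : Matrix (Fin N) (Fin N) ℝ) (part : Fin N → Fin K) (k : Fin K)
    (X : Matrix (Fin N) (Fin p) ℝ) (ρ : ℝ) (j : Fin p) :
    T3 W part k X ρ j
      = (fun i => X i j) ᵥ* (S W ρ * D W ρ * J part k * D W ρ * (S W ρ)ᵀ) := by
  simp only [T3, Matrix.mul_assoc]
  rfl

lemma sum_T3_row (W : Matrix (Fin N) (Fin N) ℝ) (part : Fin N → Fin K)
    (X : Matrix (Fin N) (Fin p) ℝ) (ρ : ℝ) (j : Fin p) :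
    ∑ k, T3 W part k X ρ j = H W ρ *ᵥ fun i => X i j := by
  simp only [T3_row, ← vecMul_sum, ← Finset.sum_mul, ← Finset.mul_sum, sum_J, mul_one]
  rw [← mulVec_transpose]
  simp only [H, transpose_mul, transpose_transpose, D_transpose, mul_assoc]

lemma sum_sum_dotProduct (f g : Fin K → Fin N → ℝ) :
    ∑ k, ∑ l, f k ⬝ᵥ g l = (∑ k, f k) ⬝ᵥ ∑ l, g l := by
  simp only [sum_dotProduct, dotProduct_sum]
  exact Finset.sum_comm

lemma sum_sum_trace_mul (f g : Fin K → Matrix (Fin N) (Fin N) ℝ) :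
    ∑ k, ∑ l, (f k * g l).trace = ((∑ k, f k) * ∑ l, g l).trace := by
  simp only [Finset.sum_mul_sum, trace_sum]

/-- The part of the estimator that is specific to the entry of `ρ`. -/
def hatQuad (W : Matrix (Fin N) (Fin N) ℝ) (y : Fin N → ℝ) (X : Matrix (Fin N) (Fin p) ℝ)
    (θ : Idx p → ℝ) : Idx p → Idx p → ℝ
  | Sum.inl _, Sum.inl _ => 4 * (sigmaEpsSq W y X θ * sigmaEpsSq W y X θ *
      ((N : ℝ)⁻¹ * (XiSum W (rho θ) * XiSum W (rho θ)).trace + (N : ℝ)⁻¹ * (VSum W (rho θ)).trace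
        + 2 * ((sigmaSq W y θ)⁻¹ *
          ((N : ℝ)⁻¹ * (H W (rho θ) *ᵥ W *ᵥ y ⬝ᵥ T2Sum W y (rho θ))))))
  | _, _ => 0

lemma hatSigma1_apply (W : Matrix (Fin N) (Fin N) ℝ) {part : Fin N → Fin K}
    (hpart : Function.Surjective part) (y : Fin N → ℝ) (X : Matrix (Fin N) (Fin p) ℝ)
    (θ : Idx p → ℝ) (a b : Idx p) :
    hatSigma1 W part y X θ a b = 4 * (sigmaEpsSq W y X θ *
      ((N : ℝ)⁻¹ * (H W (rho θ) *ᵥ hatRegressor W y X a ⬝ᵥ H W (rho θ) *ᵥ hatRegressor W y X b)))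
      + hatQuad W y X θ a b := by
  have hdot : ∀ (t : ℝ) (f g : Fin K → Fin N → ℝ),
      ∑ k, ∑ l, √(weight part k * weight part l) *
        (t / √(size part k * size part l) * (f k ⬝ᵥ g l))
      = t * (N : ℝ)⁻¹ * ((∑ k, f k) ⬝ᵥ ∑ l, g l) := fun t f g => by
    simp only [← mul_assoc, sqrt_weight_mul_div hpart, ← Finset.mul_sum, sum_sum_dotProduct]
  have happ : hatSigma1 W part y X θ a b = ∑ k, ∑ l, √(weight part k * weight part l) *
      hatSigma1kl W part y X θ k l a b := by
    simp only [hatSigma1, Matrix.sum_apply, Matrix.smul_apply, smul_eq_mul]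
  rw [happ]
  cases a with
  | inl u =>
    cases b with
    | inl u' =>
      simp only [hatSigma1kl, fromBlocks_apply₁₁, of_apply, hatRho, ← mul_assoc,
        sqrt_weight_mul_div hpart, ← Finset.mul_sum, Finset.sum_add_distrib, sum_sum_dotProduct,
        sum_sum_trace_mul, ← transpose_sum, sum_XiDag, sum_V1, sum_V2, sum_T1, sum_T2, hatQuad,
        hatRegressor, VSum]
      rw [dotProduct_comm (T2Sum W y (rho θ))]
      ring
    | inr j =>
      simp only [hatSigma1kl, fromBlocks_apply₁₂, of_apply, hatRhoBeta, Pi.smul_apply, smul_eq_mul,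
        hatRegressor, hatQuad]
      refine (hdot _ (fun k => T1 W part k y (rho θ)) fun l => T3 W part l X (rho θ) j).trans ?_
      rw [sum_T1, sum_T3_row]
      ring
  | inr j =>
    cases b with
    | inl u' =>
      simp only [hatSigma1kl, fromBlocks_apply₂₁, of_apply, hatRhoBeta, Pi.smul_apply, smul_eq_mul,
        hatRegressor, hatQuad]
      rw [Finset.sum_comm]
      simp only [mul_comm (weight part _) (weight part _)]
      refine (hdot _ (fun k => T1 W part k y (rho θ)) fun l => T3 W part l X (rho θ) j).trans ?_
      rw [sum_T1, sum_T3_row, dotProduct_comm]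
      ring
    | inr j' =>
      simp only [hatSigma1kl, fromBlocks_apply₂₂, hatBeta, Matrix.smul_apply, smul_eq_mul,
        hatRegressor, hatQuad]
      refine (hdot _ (fun k => T3 W part k X (rho θ) j) fun l => T3 W part l X (rho θ) j').trans ?_
      rw [sum_T3_row, sum_T3_row]
      ring

end Estimator

/-! ### Trace identities for the score and the estimator -/

section TraceIdentities

open scoped Matrix.Norms.L2Operator

variable {N : ℕ}

/-- The transposed score matrix is similar to `Ξ†`. -/
lemma scoreMat_transpose {W : Matrix (Fin N) (Fin N) ℝ} (hW : IsStochastic W) {ρ : ℝ}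
    (hρ : |ρ| < 1) : (scoreMat W ρ)ᵀ = ((S W ρ)⁻¹)ᵀ * XiSum W ρ * (S W ρ)ᵀ := by
  have h : ((S W ρ)⁻¹)ᵀ * (S W ρ)ᵀ = 1 := by
    rw [← transpose_mul, hW.S_mul_inv hρ, transpose_one]
  have h' : ∀ M : Matrix (Fin N) (Fin N) ℝ, ((S W ρ)⁻¹)ᵀ * ((S W ρ)ᵀ * M) = M := fun M => by
    rw [← mul_assoc, h, one_mul]
  simp only [scoreMat, XiSum, transpose_mul, transpose_sub, transpose_transpose, D_transpose,
    Ddot_transpose, mul_sub, sub_mul, mul_assoc, h']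

lemma trace_scoreMat_mul_self {W : Matrix (Fin N) (Fin N) ℝ} (hW : IsStochastic W) {ρ : ℝ}
    (hρ : |ρ| < 1) :
    (scoreMat W ρ * scoreMat W ρ).trace = (XiSum W ρ * XiSum W ρ).trace := by
  have h : (S W ρ)ᵀ * ((S W ρ)⁻¹)ᵀ = 1 := by
    rw [← transpose_mul, hW.S_inv_mul hρ, transpose_one]
  rw [← trace_transpose, transpose_mul, scoreMat_transpose hW hρ]
  calc (((S W ρ)⁻¹)ᵀ * XiSum W ρ * (S W ρ)ᵀ * (((S W ρ)⁻¹)ᵀ * XiSum W ρ * (S W ρ)ᵀ)).trace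
      = ((((S W ρ)⁻¹)ᵀ * XiSum W ρ * ((S W ρ)ᵀ * ((S W ρ)⁻¹)ᵀ) * XiSum W ρ) * (S W ρ)ᵀ).trace := by
        simp only [mul_assoc]
    _ = ((S W ρ)ᵀ * (((S W ρ)⁻¹)ᵀ * XiSum W ρ * ((S W ρ)ᵀ * ((S W ρ)⁻¹)ᵀ) * XiSum W ρ)).trace :=
        trace_mul_comm _ _
    _ = (((S W ρ)ᵀ * ((S W ρ)⁻¹)ᵀ) * XiSum W ρ * ((S W ρ)ᵀ * ((S W ρ)⁻¹)ᵀ) * XiSum W ρ).trace := by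
        simp only [mul_assoc]
    _ = (XiSum W ρ * XiSum W ρ).trace := by rw [h, one_mul, mul_one]

/-- The matrix `(W S⁻¹)ᵀ H S D² Wᵀ`, whose normalized trace is the limit of `T₁ T₂ᵀ / (N σ²)`. -/
def crossMat (W : Matrix (Fin N) (Fin N) ℝ) (ρ : ℝ) : Matrix (Fin N) (Fin N) ℝ :=
  (W * (S W ρ)⁻¹)ᵀ * ((H W ρ)ᵀ * (S W ρ * D W ρ * D W ρ * Wᵀ)) * 1

/-- The decomposition of `tr (A Aᵀ)` behind the terms `V₁ᵀ V₂`, `T₁ T₂ᵀ` and `T₁ T₁ᵀ` of the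
estimator. -/
lemma trace_scoreMat_mul_transpose {W : Matrix (Fin N) (Fin N) ℝ} (hW : IsStochastic W) {ρ : ℝ}
    (hρ : |ρ| < 1) :
    (scoreMat W ρ * (scoreMat W ρ)ᵀ).trace = (VSum W ρ).trace + 2 * (crossMat W ρ).trace
      + ((W * (S W ρ)⁻¹)ᵀ * ((H W ρ)ᵀ * H W ρ) * (W * (S W ρ)⁻¹)).trace := by
  have h : (S W ρ)ᵀ * ((S W ρ)⁻¹)ᵀ = 1 := by
    rw [← transpose_mul, hW.S_inv_mul hρ, transpose_one]
  have h' : ∀ M : Matrix (Fin N) (Fin N) ℝ, (S W ρ)ᵀ * (((S W ρ)⁻¹)ᵀ * M) = M := fun M => by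
    rw [← mul_assoc, h, one_mul]
  have h'' : ∀ M : Matrix (Fin N) (Fin N) ℝ, (S W ρ)⁻¹ * (S W ρ * M) = M := fun M => by
    rw [← mul_assoc, hW.S_inv_mul hρ, one_mul]
  set E : Matrix (Fin N) (Fin N) ℝ :=
    S W ρ * D W ρ * (D W ρ * Wᵀ * ((S W ρ)⁻¹)ᵀ * Wᵀ * S W ρ * D W ρ) * (D W ρ * (S W ρ)ᵀ) with hE
  set B := W * (S W ρ)⁻¹ with hB
  have e1 : scoreMat W ρ * (scoreMat W ρ)ᵀ
      = VSum W ρ + (E + Eᵀ) + (H W ρ * B) * (H W ρ * B)ᵀ := by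
    simp only [scoreMat, VSum, Mtilde, hE, hB, H, transpose_mul, transpose_sub, transpose_transpose,
      D_transpose, Ddot_transpose, mul_sub, sub_mul, mul_add, add_mul, mul_assoc, h', h'']
    abel
  have e2 : E.trace = (crossMat W ρ).trace := by
    have : E = (S W ρ * D W ρ * D W ρ * Wᵀ) * (((S W ρ)⁻¹)ᵀ * Wᵀ * H W ρ) := by
      simp only [hE, H, mul_assoc]
    rw [this, trace_mul_comm, crossMat, H_transpose, mul_one, transpose_mul]
    simp only [mul_assoc]
  have e3 : ((H W ρ * B) * (H W ρ * B)ᵀ).trace = (Bᵀ * ((H W ρ)ᵀ * H W ρ) * B).trace := by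
    rw [trace_mul_comm, transpose_mul]
    simp only [mul_assoc]
  rw [e1, trace_add, trace_add, trace_add, trace_transpose, e2, e3]
  ring

end TraceIdentities

/-! ### Bilinear forms with negligible fluctuations -/

section Thin

open scoped Matrix.Norms.L2Operator

variable {W : (N : ℕ) → Matrix (Fin N) (Fin N) ℝ}

/-- Matrices with operator norm much smaller than `√N` and squared Frobenius norm essentially of
order `N`. Bilinear forms `xᵀ Bᵀ A C y` in them concentrate. -/
structure Thin (B : (N : ℕ) → Matrix (Fin N) (Fin N) ℝ) : Prop where
  decay_norm : SuperpolynomialDecay atTop logScale fun N => (√(N : ℝ))⁻¹ * ‖B N‖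
  moderate_frobSq : Moderate atTop logScale fun N => (N : ℝ)⁻¹ * frobSq (B N)

lemma thin_one : Thin fun N => (1 : Matrix (Fin N) (Fin N) ℝ) := by
  refine ⟨decay_of_abs_le (decay_rpow_neg (κ := 1 / 2) (by norm_num))
    (Eventually.of_forall fun N => ?_),
    (moderate_const 1).mono (Eventually.of_forall fun N => ?_)⟩
  · rw [Real.rpow_neg (Nat.cast_nonneg _), ← Real.sqrt_eq_rpow, abs_of_nonneg (by positivity),
      abs_of_nonneg (by positivity)]
    exact mul_le_of_le_one_right (by positivity) norm_one_le
  · rw [frobSq_one]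
    obtain h | h := eq_or_ne (N : ℝ) 0
    · simp [h]
    · simp [inv_mul_cancel₀ h]

lemma Thin.mul_left {A B : (N : ℕ) → Matrix (Fin N) (Fin N) ℝ}
    (hA : Moderate atTop logScale fun N => ‖A N‖) (hB : Thin B) : Thin fun N => A N * B N := by
  refine ⟨decay_of_abs_le (decay_mul_moderate hB.decay_norm hA) (Eventually.of_forall fun N => ?_),
    (hB.moderate_frobSq.mul (hA.mul hA)).mono (Eventually.of_forall fun N => ?_)⟩
  · rw [abs_of_nonneg (by positivity), abs_of_nonneg (by positivity), mul_assoc]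
    refine mul_le_mul_of_nonneg_left ?_ (by positivity)
    rw [mul_comm ‖B N‖]
    exact norm_mul_le _ _
  · have h1 := frobSq_nonneg (A N * B N)
    have h2 := frobSq_nonneg (B N)
    rw [abs_of_nonneg (by positivity), abs_of_nonneg (by positivity), mul_assoc]
    refine mul_le_mul_of_nonneg_left ?_ (by positivity)
    rw [mul_comm (frobSq (B N)), ← sq]
    exact frobSq_mul_le _ _

lemma NetworkCondition.thin_S_inv (hW : NetworkCondition W) {ρ : ℝ} (hρ : |ρ| < 1) :
    Thin fun N => (S (W N) ρ)⁻¹ :=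
  ⟨hW.decay_norm_S_inv hρ, hW.moderate_frobSq_S_inv hρ⟩

/-- The normalized squared Frobenius norm of `Bᵀ A C` decays. -/
lemma Thin.decay_frobSq {A B C : (N : ℕ) → Matrix (Fin N) (Fin N) ℝ}
    (hB : Thin B) (hA : Moderate atTop logScale fun N => ‖A N‖) (hC : Thin C) :
    SuperpolynomialDecay atTop logScale fun N =>
      ((N : ℝ)⁻¹ * (N : ℝ)⁻¹) * frobSq ((B N)ᵀ * A N * C N) := by
  refine decay_of_abs_le (decay_mul_moderate (hB.decay_norm.mul hB.decay_norm)
    ((hA.mul hA).mul hC.moderate_frobSq)) (Eventually.of_forall fun N => ?_)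
  have h1 := frobSq_nonneg ((B N)ᵀ * A N * C N)
  have h2 := frobSq_nonneg (C N)
  simp only [Pi.mul_apply]
  rw [abs_of_nonneg (by positivity), abs_of_nonneg (by positivity)]
  have hs : (√(N : ℝ))⁻¹ * (√(N : ℝ))⁻¹ = (N : ℝ)⁻¹ := by
    rw [← mul_inv, Real.mul_self_sqrt (Nat.cast_nonneg _)]
  have e : (√(N : ℝ))⁻¹ * ‖B N‖ * ((√(N : ℝ))⁻¹ * ‖B N‖)
      * (‖A N‖ * ‖A N‖ * ((N : ℝ)⁻¹ * frobSq (C N)))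
      = (N : ℝ)⁻¹ * (N : ℝ)⁻¹ * ((‖B N‖ * ‖A N‖) ^ 2 * frobSq (C N)) := by
    rw [← hs]; ring
  rw [e]
  refine mul_le_mul_of_nonneg_left ((frobSq_mul_le _ _).trans ?_) (by positivity)
  refine mul_le_mul_of_nonneg_right (pow_le_pow_left₀ (norm_nonneg _) ?_ 2) h2
  exact (norm_mul_le _ _).trans (by rw [norm_transpose])

end Thin

/-! ### Concentration of bilinear forms in independent, identically distributed variables -/

section Concentration

open scoped Matrix.Norms.L2Operator

variable {α : Type*} [MeasurableSpace α] {m : Measure α} {φ ψ : α → ℝ}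

lemma second_moment_bilinear_iid {Ω : Type*} [MeasurableSpace Ω] {P : Measure Ω}
    [IsProbabilityMeasure P] {N : ℕ} {z : Fin N → Ω → α} (hz : ∀ i, HasLaw (z i) m P)
    (hind : iIndepFun z P) (hφm : Measurable φ) (hψm : Measurable ψ) (hφ : MemLp φ 4 m)
    (hψ : MemLp ψ 4 m) (hφ0 : ∫ x, φ x ∂m = 0) (hψ0 : ∫ x, ψ x ∂m = 0)
    (M : Matrix (Fin N) (Fin N) ℝ) :
    MemLp (fun ω => (fun i => φ (z i ω)) ⬝ᵥ M *ᵥ (fun i => ψ (z i ω))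
      - (∫ x, φ x * ψ x ∂m) * M.trace) 2 P ∧
    ∫ ω, ((fun i => φ (z i ω)) ⬝ᵥ M *ᵥ (fun i => ψ (z i ω))
      - (∫ x, φ x * ψ x ∂m) * M.trace) ∂P = 0 ∧
    ∫ ω, ((fun i => φ (z i ω)) ⬝ᵥ M *ᵥ (fun i => ψ (z i ω))
      - (∫ x, φ x * ψ x ∂m) * M.trace) ^ 2 ∂P
      ≤ ((∫ x, φ x ^ 2 ∂m) * (∫ x, ψ x ^ 2 ∂m) + (∫ x, φ x * ψ x ∂m) ^ 2
        + ∫ x, (φ x * ψ x - ∫ x, φ x * ψ x ∂m) ^ 2 ∂m) * frobSq M := by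
  have hint : ∀ {f : α → ℝ}, Measurable f → ∀ i, ∫ ω, f (z i ω) ∂P = ∫ x, f x ∂m := fun hf i =>
    (hz i).integral_comp hf.aestronglyMeasurable
  have hL : ∀ {f : α → ℝ}, Measurable f → MemLp f 4 m → ∀ i, MemLp (fun ω => f (z i ω)) 4 P :=
    fun hf h i => by
      rw [← (hz i).map_eq, memLp_map_measure_iff hf.aestronglyMeasurable (hz i).aemeasurable] at h
      exact h
  exact second_moment_bilinear_le (hL hφm hφ) (hL hψm hψ)
    (hind.comp (fun _ x => (φ x, ψ x)) fun _ => hφm.prodMk hψm)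
    (fun i => (hint hφm i).trans hφ0) (fun i => (hint hψm i).trans hψ0)
    (hint (hφm.pow_const 2)) (hint (hψm.pow_const 2)) (hint (hφm.mul hψm))
    (hint (((hφm.mul hψm).sub_const _).pow_const 2)) M

/-- For thin `B`, `C` and moderate `A`, the normalized form `N⁻¹ xᵀ Bᵀ A C y` in the vectors
`x_i = φ (z_i)`, `y_i = ψ (z_i)` agrees with its mean up to a superpolynomially small error. -/
lemma decay_bilinear_iid {Ω : Type*} [MeasurableSpace Ω] {P : Measure Ω}
    [IsProbabilityMeasure P] {z : (N : ℕ) → Fin N → Ω → α} (hz : ∀ N i, HasLaw (z N i) m P)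
    (hind : ∀ N, iIndepFun (z N) P) (hφm : Measurable φ) (hψm : Measurable ψ) (hφ : MemLp φ 4 m)
    (hψ : MemLp ψ 4 m) (hφ0 : ∫ x, φ x ∂m = 0) (hψ0 : ∫ x, ψ x ∂m = 0)
    {A B C : (N : ℕ) → Matrix (Fin N) (Fin N) ℝ}
    (hB : Thin B) (hA : Moderate atTop logScale fun N => ‖A N‖) (hC : Thin C) :
    SuperpolynomialDecay (whp P) lg fun q : ℕ × Ω =>
      (q.1 : ℝ)⁻¹ * ((fun i => φ (z q.1 i q.2)) ⬝ᵥ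
        ((B q.1)ᵀ * A q.1 * C q.1) *ᵥ (fun i => ψ (z q.1 i q.2)))
      - (∫ x, φ x * ψ x ∂m) * ((q.1 : ℝ)⁻¹ * ((B q.1)ᵀ * A q.1 * C q.1).trace) := by
  set c := (∫ x, φ x ^ 2 ∂m) * (∫ x, ψ x ^ 2 ∂m) + (∫ x, φ x * ψ x ∂m) ^ 2
        + ∫ x, (φ x * ψ x - ∫ x, φ x * ψ x ∂m) ^ 2 ∂m with hc
  have key := decay_of_second_moment (P := P) (Z := fun N ω => (N : ℝ)⁻¹ *
    ((fun i => φ (z N i ω)) ⬝ᵥ ((B N)ᵀ * A N * C N) *ᵥ (fun i => ψ (z N i ω))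
      - (∫ x, φ x * ψ x ∂m) * ((B N)ᵀ * A N * C N).trace))
    ((hB.decay_frobSq hA hC).const_mul c) (Eventually.of_forall fun N => ?_)
  · refine key.congr fun q => ?_
    ring
  · obtain ⟨h1, -, h3⟩ := second_moment_bilinear_iid (hz N) (hind N) hφm hψm hφ hψ hφ0 hψ0
      ((B N)ᵀ * A N * C N)
    refine ⟨h1.const_mul _, ?_⟩
    simp only [mul_pow]
    rw [integral_const_mul]
    refine (mul_le_mul_of_nonneg_left h3 (by positivity)).trans (le_of_eq ?_)
    rw [← hc]
    ring

end Concentration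

/-! ### Closeness of the matrices in the estimator -/

section CloseMatrices

open scoped Matrix.Norms.L2Operator

variable {Ω : Type*} [MeasurableSpace Ω] {P : Measure Ω}
  {W : (N : ℕ) → Matrix (Fin N) (Fin N) ℝ} {r : ℕ × Ω → ℝ} {ρ : ℝ}

/-- A nonrandom sequence that is moderate with high probability is moderate. -/
lemma moderate_of_fst [IsProbabilityMeasure P] {f : ℕ → ℝ}
    (h : Moderate (whp P) lg fun q : ℕ × Ω => f q.1) : Moderate atTop logScale f := by
  obtain ⟨m, hm⟩ := h
  obtain ⟨C, hC⟩ := hm.bound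
  refine ⟨m, IsBigO.of_bound C ?_⟩
  rw [eventually_whp] at hC
  filter_upwards [(tendsto_order.1 hC).2 1 one_pos] with N hN
  by_contra hcon
  refine hN.ne ?_
  have : {ω : Ω | ¬ ‖f (N, ω).1‖ ≤ C * ‖lg (N, ω) ^ m‖} = Set.univ :=
    Set.eq_univ_of_forall fun ω => hcon
  rw [this, measure_univ]

lemma matClose_H (hW : NetworkCondition W) (hr : Close (whp P) lg r fun _ => ρ) :
    MatClose P (fun q => H (W q.1) (r q)) fun q => H (W q.1) ρ := by
  have hS := matClose_S hW hr
  have hD := matClose_D hW hr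
  exact ((hS.mul tendsto_lg hD).mul tendsto_lg hD).mul tendsto_lg hS.transpose

lemma matClose_XiSum (hW : NetworkCondition W) (hr : Close (whp P) lg r fun _ => ρ) :
    MatClose P (fun q => XiSum (W q.1) (r q)) fun q => XiSum (W q.1) ρ := by
  have hS := matClose_S hW hr
  have hD := matClose_D hW hr
  have hD' := matClose_Ddot hW hr
  have hWW := matClose_W (P := P) hW
  have h1 := (hS.transpose.mul tendsto_lg hS).mul tendsto_lg hD'
  have h2 := (hS.transpose.mul tendsto_lg hWW).mul tendsto_lg hD
  have h3 := (hWW.transpose.mul tendsto_lg hS).mul tendsto_lg hD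
  exact ((h1.sub tendsto_lg h2).sub tendsto_lg h3).mul tendsto_lg hD

lemma matClose_VSum (hW : NetworkCondition W) (hr : Close (whp P) lg r fun _ => ρ) :
    MatClose P (fun q => VSum (W q.1) (r q)) fun q => VSum (W q.1) ρ := by
  have hS := matClose_S hW hr
  have hD := matClose_D hW hr
  have hD' := matClose_Ddot hW hr
  have hWW := matClose_W (P := P) hW
  have mul : ∀ {A A' B B' : ∀ q : ℕ × Ω, Matrix (Fin q.1) (Fin q.1) ℝ}, MatClose P A A' →
    MatClose P B B' → MatClose P (fun q => A q * B q) fun q => A' q * B' q :=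
    fun h h' => h.mul tendsto_lg h'
  have h1 := mul (mul (mul hD' hS.transpose) hS) hD'
  have h2 := mul (mul (mul hD' hS.transpose) hWW) hD
  have h3 := mul (mul (mul hD' hWW.transpose) hS) hD
  have h4 := mul (mul (mul hD hWW.transpose) hS) hD'
  have h5 := mul (mul (mul hD hWW.transpose) hWW) hD
  have h6 := mul (mul (mul hD hS.transpose) hWW) hD'
  have hM := ((((h1.sub tendsto_lg h2).sub tendsto_lg h3).sub tendsto_lg h4).add tendsto_lg
    h5).sub tendsto_lg h6
  exact mul (mul hD hS.transpose).transpose (mul (mul hM hD) hS.transpose)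

lemma matClose_T2 (hW : NetworkCondition W) (hr : Close (whp P) lg r fun _ => ρ) :
    MatClose P (fun q => S (W q.1) (r q) * D (W q.1) (r q) * D (W q.1) (r q) * (W q.1)ᵀ)
      fun q => S (W q.1) ρ * D (W q.1) ρ * D (W q.1) ρ * (W q.1)ᵀ := by
  have hS := matClose_S hW hr
  have hD := matClose_D hW hr
  have hWW := matClose_W (P := P) hW
  exact ((hS.mul tendsto_lg hD).mul tendsto_lg hD).mul tendsto_lg hWW.transpose

lemma VecClose.sum {κ : Type*} (s : Finset κ) {y y' : κ → ∀ q : ℕ × Ω, Fin q.1 → ℝ}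
    (h : ∀ j ∈ s, VecClose P (y j) (y' j)) :
    VecClose P (fun q => ∑ j ∈ s, y j q) fun q => ∑ j ∈ s, y' j q := by
  have e : ∀ (N : ℕ) (f : κ → Fin N → ℝ), scaled (∑ j ∈ s, f j) = ∑ j ∈ s, scaled (f j) :=
    fun N f => by simp [scaled, WithLp.toLp_sum, Finset.smul_sum]
  simp only [VecClose, e]
  exact Close.sum tendsto_lg s h

end CloseMatrices

/-! ### The sampling model -/

section Sampling

open scoped Matrix.Norms.L2Operator

variable {p : ℕ} {Ω : Type*} [MeasurableSpace Ω]

/-- Independent centred normal errors with variance `v`, and independent covariates with the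
centred law `μX` with finite fourth moments, which are independent of the errors. -/
structure Sampling (P : Measure Ω) (v : ℝ≥0) (ε : (N : ℕ) → Fin N → Ω → ℝ)
    (μX : Measure (Fin p → ℝ)) (X : (N : ℕ) → Fin N → Ω → Fin p → ℝ) : Prop where
  eps_law : ∀ N i, HasLaw (ε N i) (gaussianReal 0 v) P
  eps_indep : ∀ N, iIndepFun (ε N) P
  mean : ∀ j, ∫ x, x j ∂μX = 0
  mom : ∀ j, MemLp (fun x : Fin p → ℝ => x j) 4 μX
  X_law : ∀ N i, HasLaw (X N i) μX P
  X_indep : ∀ N, iIndepFun (X N) P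
  indep : ∀ N, IndepFun (fun ω i => X N i ω) (fun ω i => ε N i ω) P

/-- The linear functional `(x, e) ↦ xᵀ b + c e` of a covariate row and an error. -/
def lin (b : Fin p → ℝ) (c : ℝ) (z : (Fin p → ℝ) × ℝ) : ℝ := z.1 ⬝ᵥ b + c * z.2

lemma measurable_lin (b : Fin p → ℝ) (c : ℝ) : Measurable (lin b c) := by
  unfold lin dotProduct
  fun_prop

/-- The coefficient vector `b` for which `X b` is the covariate vector of a parameter coordinate. -/
def coef (θ : Idx p → ℝ) : Idx p → Fin p → ℝ
  | Sum.inl _ => beta θ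
  | Sum.inr j => Pi.single j 1

/-- The weight of the errors in the response, `1` for the coordinate `ρ`, or in a covariate. -/
def noise : Idx p → ℝ
  | Sum.inl _ => 1
  | Sum.inr _ => 0

lemma regressor_eq {N : ℕ} (θ : Idx p → ℝ) (X : Matrix (Fin N) (Fin p) ℝ) (a : Idx p) :
    regressor θ X a = X *ᵥ coef θ a := by
  cases a with
  | inl u => rfl
  | inr j => simp only [regressor, coef, mulVec_single_one]; rfl

/-- The second moments of linear functionals of a covariate row. -/
def covX (μX : Measure (Fin p → ℝ)) (b b' : Fin p → ℝ) : ℝ := ∫ x, (x ⬝ᵥ b) * (x ⬝ᵥ b') ∂μX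

section Moments

variable {μX : Measure (Fin p → ℝ)} {v : ℝ≥0}

lemma memLp_dotProduct (hmom : ∀ j, MemLp (fun x : Fin p → ℝ => x j) 4 μX) (b : Fin p → ℝ) :
    MemLp (fun x : Fin p → ℝ => x ⬝ᵥ b) 4 μX := by
  simp only [dotProduct]
  exact memLp_finsetSum _ fun j _ => (hmom j).mul_const _

lemma integral_dotProduct [IsProbabilityMeasure μX] (hmean : ∀ j, ∫ x, x j ∂μX = 0)
    (hmom : ∀ j, MemLp (fun x : Fin p → ℝ => x j) 4 μX) (b : Fin p → ℝ) :
    ∫ x, x ⬝ᵥ b ∂μX = 0 := by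
  simp only [dotProduct]
  rw [integral_finsetSum _ fun j _ => ((hmom j).integrable (by norm_num)).mul_const _]
  simp [integral_mul_const, hmean]

lemma memLp_lin [IsProbabilityMeasure μX]
    (hmom : ∀ j, MemLp (fun x : Fin p → ℝ => x j) 4 μX) (b : Fin p → ℝ) (c : ℝ) :
    MemLp (lin b c) 4 (μX.prod (gaussianReal 0 v)) := by
  have h1 : MemLp (fun x : ℝ => x) 4 (gaussianReal 0 v) := by
    simpa using! memLp_id_gaussianReal (μ := 0) (v := v) 4
  exact ((memLp_dotProduct hmom b).comp_measurePreserving measurePreserving_fst).add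
    ((h1.comp_measurePreserving measurePreserving_snd).const_mul c)

lemma integral_lin [IsProbabilityMeasure μX] (hmean : ∀ j, ∫ x, x j ∂μX = 0)
    (hmom : ∀ j, MemLp (fun x : Fin p → ℝ => x j) 4 μX) (b : Fin p → ℝ) (c : ℝ) :
    ∫ z, lin b c z ∂(μX.prod (gaussianReal 0 v)) = 0 := by
  have h1 : Integrable (fun x : ℝ => x) (gaussianReal 0 v) :=
    (memLp_id_gaussianReal (μ := 0) (v := v) 1).integrable (by simp)
  simp only [lin]
  rw [integral_add (((memLp_dotProduct hmom b).integrable (by norm_num)).comp_fst _)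
    ((h1.comp_snd _).const_mul c), integral_const_mul,
    integral_fun_fst (fun x : Fin p → ℝ => x ⬝ᵥ b), integral_fun_snd (fun x : ℝ => x),
    integral_dotProduct hmean hmom, (integral_pow_gaussianReal v).1]
  simp

lemma integral_lin_mul_lin [IsProbabilityMeasure μX]
    (hmom : ∀ j, MemLp (fun x : Fin p → ℝ => x j) 4 μX) (b b' : Fin p → ℝ) (c c' : ℝ) :
    ∫ z, lin b c z * lin b' c' z ∂(μX.prod (gaussianReal 0 v)) = covX μX b b' + c * c' * v := by
  obtain ⟨g1, g2, -, -⟩ := integral_pow_gaussianReal v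
  have h1 : MemLp (fun x : ℝ => x) 2 (gaussianReal 0 v) := by
    simpa using! memLp_id_gaussianReal (μ := 0) (v := v) 2
  have hb : ∀ b : Fin p → ℝ, MemLp (fun x : Fin p → ℝ => x ⬝ᵥ b) 2 μX := fun b =>
    (memLp_dotProduct hmom b).mono_exponent (by norm_num)
  have i1 : Integrable (fun z : (Fin p → ℝ) × ℝ => (z.1 ⬝ᵥ b) * (z.1 ⬝ᵥ b'))
      (μX.prod (gaussianReal 0 v)) := (integrable_mul_of_memLp_two (hb b) (hb b')).comp_fst _
  have i2 : Integrable (fun z : (Fin p → ℝ) × ℝ => (z.1 ⬝ᵥ (c' • b + c • b')) * z.2)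
      (μX.prod (gaussianReal 0 v)) :=
    ((hb (c' • b + c • b')).integrable one_le_two).mul_prod (h1.integrable one_le_two)
  have i3 : Integrable (fun z : (Fin p → ℝ) × ℝ => (c * c') * z.2 ^ 2)
      (μX.prod (gaussianReal 0 v)) := (h1.integrable_sq.comp_snd _).const_mul _
  have e : ∀ z : (Fin p → ℝ) × ℝ, lin b c z * lin b' c' z = (z.1 ⬝ᵥ b) * (z.1 ⬝ᵥ b')
      + (z.1 ⬝ᵥ (c' • b + c • b')) * z.2 + (c * c') * z.2 ^ 2 := fun z => by
    simp only [lin, dotProduct_add, dotProduct_smul, smul_eq_mul]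
    ring
  have i12 : Integrable (fun z : (Fin p → ℝ) × ℝ => (z.1 ⬝ᵥ b) * (z.1 ⬝ᵥ b')
      + (z.1 ⬝ᵥ (c' • b + c • b')) * z.2) (μX.prod (gaussianReal 0 v)) := i1.add i2
  simp only [e]
  rw [integral_add i12 i3, integral_add i1 i2, integral_const_mul,
    integral_prod_mul (fun x : Fin p → ℝ => x ⬝ᵥ (c' • b + c • b')) (fun x : ℝ => x),
    integral_fun_fst (fun x : Fin p → ℝ => (x ⬝ᵥ b) * (x ⬝ᵥ b')),
    integral_fun_snd (fun x : ℝ => x ^ 2), g1, g2]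
  simp [covX]

end Moments

variable {P : Measure Ω} {v : ℝ≥0} {ε : (N : ℕ) → Fin N → Ω → ℝ}
  {μX : Measure (Fin p → ℝ)} {X : (N : ℕ) → Fin N → Ω → Fin p → ℝ}

lemma Sampling.isProbabilityMeasure [IsProbabilityMeasure P] (h : Sampling P v ε μX X) :
    IsProbabilityMeasure μX :=
  (h.X_law 1 0).isProbabilityMeasure_iff.1 inferInstance

lemma Sampling.hasLaw_prod [IsProbabilityMeasure P] (h : Sampling P v ε μX X) (N : ℕ) :
    HasLaw (fun ω => (fun i => X N i ω, fun i => ε N i ω))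
      ((Measure.pi fun _ : Fin N => μX).prod (gaussianPi N v)) P :=
  (indepFun_iff_hasLaw_prodMk_prod ((h.X_indep N).hasLaw_pi (h.X_law N))
    ((h.eps_indep N).hasLaw_pi (h.eps_law N))).1 (h.indep N)

lemma Sampling.hasLaw_pi [IsProbabilityMeasure P] (h : Sampling P v ε μX X) (N : ℕ) :
    HasLaw (fun ω i => (X N i ω, ε N i ω))
      (Measure.pi fun _ : Fin N => μX.prod (gaussianReal 0 v)) P := by
  have := h.isProbabilityMeasure
  exact (measurePreserving_arrowProdEquivProdArrow (Fin p → ℝ) ℝ (Fin N) (fun _ => μX)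
    fun _ => gaussianReal 0 v).symm.comp_hasLaw (h.hasLaw_prod N)

lemma Sampling.pair_law [IsProbabilityMeasure P] (h : Sampling P v ε μX X) (N : ℕ) (i : Fin N) :
    HasLaw (fun ω => (X N i ω, ε N i ω)) (μX.prod (gaussianReal 0 v)) P := by
  have := h.isProbabilityMeasure
  exact (measurePreserving_eval (fun _ : Fin N => μX.prod (gaussianReal 0 v)) i).comp_hasLaw
    (h.hasLaw_pi N)

lemma Sampling.pair_indep [IsProbabilityMeasure P] (h : Sampling P v ε μX X) (N : ℕ) :
    iIndepFun (fun i ω => (X N i ω, ε N i ω)) P :=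
  (iIndepFun_iff_hasLaw_pi_pi (h.pair_law N)).2 (h.hasLaw_pi N)

/-- The vector `X b + c ε`. -/
def sample (X : (N : ℕ) → Fin N → Ω → Fin p → ℝ) (ε : (N : ℕ) → Fin N → Ω → ℝ) (b : Fin p → ℝ)
    (c : ℝ) (q : ℕ × Ω) : Fin q.1 → ℝ := fun i => lin b c (X q.1 i q.2, ε q.1 i q.2)

lemma Sampling.decay_bilinear [IsProbabilityMeasure P] (h : Sampling P v ε μX X)
    (b b' : Fin p → ℝ) (c c' : ℝ)
    {A B C : (N : ℕ) → Matrix (Fin N) (Fin N) ℝ}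
    (hB : Thin B) (hA : Moderate atTop logScale fun N => ‖A N‖) (hC : Thin C) :
    SuperpolynomialDecay (whp P) lg fun q : ℕ × Ω =>
      (q.1 : ℝ)⁻¹ * (sample X ε b c q ⬝ᵥ ((B q.1)ᵀ * A q.1 * C q.1) *ᵥ sample X ε b' c' q)
      - (covX μX b b' + c * c' * v) * ((q.1 : ℝ)⁻¹ * ((B q.1)ᵀ * A q.1 * C q.1).trace) := by
  have := h.isProbabilityMeasure
  have key := decay_bilinear_iid h.pair_law h.pair_indep (measurable_lin b c) (measurable_lin b' c')
    (memLp_lin h.mom b c) (memLp_lin h.mom b' c') (integral_lin h.mean h.mom b c)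
    (integral_lin h.mean h.mom b' c') hB hA hC
  rw [integral_lin_mul_lin h.mom] at key
  exact key

lemma moderate_norm_one :
    Moderate atTop logScale fun N => ‖(1 : Matrix (Fin N) (Fin N) ℝ)‖ :=
  (moderate_const 1).mono (Eventually.of_forall fun N => by simpa using norm_one_le)

/-- A thin matrix maps the sample vectors to vectors of moderate normalized length. -/
lemma Sampling.vecClose_mulVec [IsProbabilityMeasure P] (h : Sampling P v ε μX X)
    (b : Fin p → ℝ) (c : ℝ) {B : (N : ℕ) → Matrix (Fin N) (Fin N) ℝ} (hB : Thin B) :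
    VecClose P (fun q => B q.1 *ᵥ sample X ε b c q) fun q => B q.1 *ᵥ sample X ε b c q := by
  have h1 := h.decay_bilinear b b c c hB moderate_norm_one hB
  have h2 : Moderate (whp P) lg fun q : ℕ × Ω => (covX μX b b + c * c * v) *
      ((q.1 : ℝ)⁻¹ * ((B q.1)ᵀ * 1 * B q.1).trace) := by
    simp only [mul_one, trace_transpose_mul_self]
    exact (moderate_const _).mul (moderate_fst hB.moderate_frobSq)
  have h3 := ((decay_moderate h1).add tendsto_lg h2).add tendsto_lg (moderate_const 1)
  refine Close.refl (h3.mono (Eventually.of_forall fun q => ?_))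
  have e : sample X ε b c q ⬝ᵥ ((B q.1)ᵀ * 1 * B q.1) *ᵥ sample X ε b c q
      = (B q.1 *ᵥ sample X ε b c q) ⬝ᵥ (B q.1 *ᵥ sample X ε b c q) := by
    rw [mul_one, ← mulVec_mulVec, dotProduct_mulVec, vecMul_transpose]
  rw [sub_add_cancel, e, ← norm_scaled_sq, abs_of_nonneg (norm_nonneg _),
    abs_of_nonneg (by positivity)]
  nlinarith [sq_nonneg (‖scaled (B q.1 *ᵥ sample X ε b c q)‖ - 1)]

lemma Sampling.vecClose [IsProbabilityMeasure P] (h : Sampling P v ε μX X)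
    (b : Fin p → ℝ) (c : ℝ) : VecClose P (sample X ε b c) (sample X ε b c) := by
  simpa only [one_mulVec] using h.vecClose_mulVec b c thin_one

/-- Sample second moments converge to their means. -/
lemma Sampling.close_normalized_sq [IsProbabilityMeasure P] (h : Sampling P v ε μX X)
    (b : Fin p → ℝ) (c : ℝ) :
    Close (whp P) lg (fun q => (q.1 : ℝ)⁻¹ * (sample X ε b c q ⬝ᵥ sample X ε b c q))
      fun _ => covX μX b b + c * c * v := by
  refine close_of_decay ?_
  refine (h.decay_bilinear b b c c thin_one moderate_norm_one thin_one).congr' ?_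
  filter_upwards [tendsto_fst_whp.eventually_ge_atTop 1] with q hq
  have hq0 : (q.1 : ℝ) ≠ 0 := by
    have : 0 < q.1 := hq
    positivity
  simp [inv_mul_cancel₀ hq0]

end Sampling

/-! ### The common limit of the estimator and of its targets -/

section Limit

open scoped Matrix.Norms.L2Operator

variable {N p : ℕ}

/-- The normalized trace `N⁻¹ tr (B_aᵀ Hᵀ H B_b)` for the loadings `B_a`, `B_b`. -/
def gramTrace (W : Matrix (Fin N) (Fin N) ℝ) (ρ : ℝ) (a b : Idx p) : ℝ :=
  (N : ℝ)⁻¹ * ((loading W ρ a)ᵀ * ((H W ρ)ᵀ * H W ρ) * loading W ρ b).trace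

/-- The contribution of the quadratic part of the score to the entry of `ρ`. -/
def quadVar (W : Matrix (Fin N) (Fin N) ℝ) (ρ : ℝ) (v : ℝ) : Idx p → Idx p → ℝ
  | Sum.inl _, Sum.inl _ => 4 * (v * v * ((N : ℝ)⁻¹ * (scoreMat W ρ * scoreMat W ρ).trace
      + (N : ℝ)⁻¹ * (scoreMat W ρ * (scoreMat W ρ)ᵀ).trace))
  | _, _ => 0

/-- The nonrandom matrix that `Σ̂₁` and both versions of `Σ₁` approach. -/
def limitSigma (W : Matrix (Fin N) (Fin N) ℝ) (θ : Idx p → ℝ) (v : ℝ) (μX : Measure (Fin p → ℝ))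
    (a b : Idx p) : ℝ :=
  4 * (v * (covX μX (coef θ a) (coef θ b) * gramTrace W (rho θ) a b)) + quadVar W (rho θ) v a b

lemma mulVec_dotProduct_mulVec (M M' : Matrix (Fin N) (Fin N) ℝ) (u u' : Fin N → ℝ) :
    M *ᵥ u ⬝ᵥ M' *ᵥ u' = u ⬝ᵥ (Mᵀ * M') *ᵥ u' := by
  rw [← mulVec_mulVec, dotProduct_mulVec u, vecMul_transpose]

lemma dotProduct_H_loading (W : Matrix (Fin N) (Fin N) ℝ) (ρ : ℝ) (a b : Idx p)
    (u u' : Fin N → ℝ) :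
    H W ρ *ᵥ loading W ρ a *ᵥ u ⬝ᵥ H W ρ *ᵥ loading W ρ b *ᵥ u'
      = u ⬝ᵥ ((loading W ρ a)ᵀ * ((H W ρ)ᵀ * H W ρ) * loading W ρ b) *ᵥ u' := by
  rw [mulVec_mulVec, mulVec_mulVec, mulVec_dotProduct_mulVec, transpose_mul]
  simp only [mul_assoc]

/-- `Σ₁` for given covariates, as a function of the regressors. -/
lemma Sigma1Given_eq {K : ℕ} {W : Matrix (Fin N) (Fin N) ℝ} (hW : IsStochastic W)
    {θ : Idx p → ℝ} (hρ : |rho θ| < 1) {part : Fin N → Fin K} (hpart : Function.Surjective part)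
    (v : ℝ≥0) (x : Matrix (Fin N) (Fin p) ℝ) (a b : Idx p) :
    Sigma1Given W part θ v x a b = 4 * (v * ((N : ℝ)⁻¹ * (x *ᵥ coef θ a ⬝ᵥ
      ((loading W (rho θ) a)ᵀ * ((H W (rho θ))ᵀ * H W (rho θ)) * loading W (rho θ) b) *ᵥ
        (x *ᵥ coef θ b)))) + quadVar W (rho θ) v a b := by
  have hq : (N : ℝ)⁻¹ * ((v : ℝ) ^ 2 * ((scoreQuad W (rho θ) a * scoreQuad W (rho θ) b).trace
      + (scoreQuad W (rho θ) a * (scoreQuad W (rho θ) b)ᵀ).trace)) = quadVar W (rho θ) v a b := by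
    cases a <;> cases b <;> simp [scoreQuad, quadVar]
    ring
  rw [Sigma1Given_apply hW hρ hpart, mul_add, hq, ← dotProduct_H_loading, scoreLin, scoreLin,
    regressor_eq, regressor_eq, smul_dotProduct, dotProduct_smul, ← mulVec_mulVec, ← mulVec_mulVec,
    smul_eq_mul, smul_eq_mul]
  ring

end Limit

section Consistency

open scoped Matrix.Norms.L2Operator

variable {p : ℕ} {Ω : Type*} [MeasurableSpace Ω] {P : Measure Ω} [IsProbabilityMeasure P]
  {W : (N : ℕ) → Matrix (Fin N) (Fin N) ℝ} {K : ℕ → ℕ} {part : (N : ℕ) → Fin N → Fin (K N)}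
  {θ₀ : Idx p → ℝ} {v : ℝ≥0} {ε : (N : ℕ) → Fin N → Ω → ℝ}
  {μX : Measure (Fin p → ℝ)} {X : (N : ℕ) → Fin N → Ω → Fin p → ℝ}

/-- The unconditional `Σ₁` is equal to the common limit: bilinear forms in independent centred
covariates have traces as means. -/
lemma Sampling.Sigma1_eq_limitSigma (h : Sampling P v ε μX X) {N : ℕ} {K : ℕ}
    {W : Matrix (Fin N) (Fin N) ℝ} (hW : IsStochastic W) (hρ : |rho θ₀| < 1)
    {part : Fin N → Fin K} (hpart : Function.Surjective part) (a b : Idx p) :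
    Sigma1 W part θ₀ P (fun ω => Matrix.of fun i => X N i ω) (fun ω i => ε N i ω) a b
      = limitSigma W θ₀ v μX a b := by
  have := h.isProbabilityMeasure
  have hX : ∀ i j, MemLp (fun ω => X N i ω j) 4 P := fun i j => by
    have := h.mom j
    rw [← (h.X_law N i).map_eq, memLp_map_measure_iff (measurable_pi_apply j).aestronglyMeasurable
      (h.X_law N i).aemeasurable]
      at this
    exact this
  have he : ∀ i, MemLp (fun ω => ε N i ω) 4 P := fun i => by
    have : MemLp (fun x : ℝ => x) 4 (gaussianReal 0 v) := by
      simpa using! memLp_id_gaussianReal (μ := 0) (v := v) 4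
    rw [← (h.eps_law N i).map_eq, memLp_map_measure_iff (by fun_prop) (h.eps_law N i).aemeasurable]
      at this
    exact this
  rw [Sigma1_eq_integral hW hρ hpart (h.hasLaw_prod N) hX he]
  simp only [Sigma1Given_eq hW hρ hpart]
  set M := (loading W (rho θ₀) a)ᵀ * ((H W (rho θ₀))ᵀ * H W (rho θ₀)) * loading W (rho θ₀) b
    with hM
  have hm : ∀ b : Fin p → ℝ, Measurable fun x : Fin p → ℝ => x ⬝ᵥ b := fun b => by
    unfold dotProduct
    fun_prop
  obtain ⟨h1, h2, -⟩ := second_moment_bilinear_iid (P := Measure.pi fun _ : Fin N => μX)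
    (z := fun i x => x i) (m := μX)
    (fun i => (measurePreserving_eval (fun _ : Fin N => μX) i).hasLaw)
    (iIndepFun_pi (X := fun _ => id) fun _ => aemeasurable_id) (hm (coef θ₀ a)) (hm (coef θ₀ b))
    (memLp_dotProduct h.mom _) (memLp_dotProduct h.mom _) (integral_dotProduct h.mean h.mom _)
    (integral_dotProduct h.mean h.mom _) M
  have hi := h1.integrable one_le_two
  set c := (∫ x, (x ⬝ᵥ coef θ₀ a) * (x ⬝ᵥ coef θ₀ b) ∂μX) * M.trace with hc
  have e : ∀ x : Fin N → Fin p → ℝ, 4 * ((v : ℝ) * ((N : ℝ)⁻¹ *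
      (Matrix.of x *ᵥ coef θ₀ a ⬝ᵥ M *ᵥ (Matrix.of x *ᵥ coef θ₀ b)))) + quadVar W (rho θ₀) v a b
      = 4 * (v * (N : ℝ)⁻¹) * (((fun i => x i ⬝ᵥ coef θ₀ a) ⬝ᵥ M *ᵥ fun i => x i ⬝ᵥ coef θ₀ b) - c)
        + limitSigma W θ₀ v μX a b := fun x => by
    have e1 : ∀ b, Matrix.of x *ᵥ b = fun i => x i ⬝ᵥ b := fun b => rfl
    rw [e1, e1, limitSigma, gramTrace, ← hM, hc, covX]
    ring
  simp only [e]
  rw [integral_add (hi.const_mul _) (integrable_const _), integral_const_mul, h2]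
  simp

lemma thin_loading (hW : NetworkCondition W) {ρ : ℝ} (hρ : |ρ| < 1) (a : Idx p) :
    Thin fun N => loading (W N) ρ a := by
  cases a with
  | inl u => exact Thin.mul_left hW.moderate_norm (hW.thin_S_inv hρ)
  | inr j => exact thin_one

lemma Sampling.decay_gram (h : Sampling P v ε μX X) (hW : NetworkCondition W) {ρ : ℝ}
    (hρ : |ρ| < 1) (b b' : Fin p → ℝ) (c c' : ℝ) (a a' : Idx p) :
    SuperpolynomialDecay (whp P) lg fun q : ℕ × Ω => (q.1 : ℝ)⁻¹ * (sample X ε b c q ⬝ᵥ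
        ((loading (W q.1) ρ a)ᵀ * ((H (W q.1) ρ)ᵀ * H (W q.1) ρ) * loading (W q.1) ρ a') *ᵥ
          sample X ε b' c' q)
      - (covX μX b b' + c * c' * v) * gramTrace (W q.1) ρ a a' := by
  have hH := matClose_H (P := P) hW (close_const ρ)
  have hA : Moderate atTop logScale fun N => ‖(H (W N) ρ)ᵀ * H (W N) ρ‖ :=
    moderate_of_fst (P := P) (f := fun N => ‖(H (W N) ρ)ᵀ * H (W N) ρ‖)
      (hH.transpose.mul tendsto_lg hH).moderate
  have key := h.decay_bilinear b b' c c' (thin_loading hW hρ a) hA (thin_loading hW hρ a')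
  exact key

/-- For given covariates, `Σ₁` is the bilinear form in the covariates whose mean is the limit. -/
lemma Sampling.decay_Sigma1Given (h : Sampling P v ε μX X) (hW : NetworkCondition W)
    (hρ : |rho θ₀| < 1) (hpart : ∀ N, Function.Surjective (part N)) (a b : Idx p) :
    SuperpolynomialDecay (whp P) lg fun q : ℕ × Ω =>
      Sigma1Given (W q.1) (part q.1) θ₀ v (Matrix.of fun i => X q.1 i q.2) a b
        - limitSigma (W q.1) θ₀ v μX a b := by
  have key := (h.decay_gram hW hρ (coef θ₀ a) (coef θ₀ b) 0 0 a b).const_mul (4 * v)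
  refine key.congr' ?_
  filter_upwards [tendsto_fst_whp.eventually hW.eventually_isStochastic] with q hq
  have e : ∀ b, Matrix.of (fun i => X q.1 i q.2) *ᵥ b = sample X ε b 0 q := fun b => by
    ext i
    simp [sample, lin, mulVec]
  rw [Sigma1Given_eq hq hρ (hpart q.1), limitSigma, e, e]
  ring

/-- The estimator approaches the common limit at any parameter estimate with negligible error.
Every block is a polynomial in network matrices, the data vectors, `σ̂_ε²` and
`σ̂⁻²`, so it is close to its value at `θ₀`, where `S y = X β₀ + ε` and concentration applies. -/
lemma Sampling.decay_hatSigma1 (h : Sampling P v ε μX X) (hW : NetworkCondition W)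
    (hρ : |rho θ₀| < 1) (hv : v ≠ 0) (hpart : ∀ N, Function.Surjective (part N))
    {θ : ℕ × Ω → Idx p → ℝ} (hθ : ∀ a, Close (whp P) lg (fun q => θ q a) fun _ => θ₀ a)
    (a b : Idx p) :
    SuperpolynomialDecay (whp P) lg fun q : ℕ × Ω =>
      hatSigma1 (W q.1) (part q.1)
          (response (W q.1) θ₀ (Matrix.of fun i => X q.1 i q.2) fun i => ε q.1 i q.2)
          (Matrix.of fun i => X q.1 i q.2) (θ q) a b
        - limitSigma (W q.1) θ₀ v μX a b := by
  have hmu := h.isProbabilityMeasure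
  set Xm : ∀ q : ℕ × Ω, Matrix (Fin q.1) (Fin p) ℝ := fun q => Matrix.of fun i => X q.1 i q.2
    with hXm
  set y : ∀ q : ℕ × Ω, Fin q.1 → ℝ := fun q => response (W q.1) θ₀ (Xm q) fun i => ε q.1 i q.2
    with hy
  have hst := tendsto_fst_whp (P := P) |>.eventually hW.eventually_isStochastic
  have hr : Close (whp P) lg (fun q => rho (θ q)) fun _ => rho θ₀ := hθ _
  have hu : ∀ q, Xm q *ᵥ beta θ₀ + (fun i => ε q.1 i q.2) = sample X ε (beta θ₀) 1 q := fun q => by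
    ext i
    simp [sample, lin, mulVec, hXm]
  have hycol : ∀ q, y q = (S (W q.1) (rho θ₀))⁻¹ *ᵥ sample X ε (beta θ₀) 1 q := fun q => by
    rw [← hu]
    rfl
  have hXcol : ∀ j q, (fun i => Xm q i j) = sample X ε (Pi.single j 1) 0 q := fun j q => by
    ext i
    simp [sample, lin, hXm]
  have yC : VecClose P y y := by
    have := h.vecClose_mulVec (beta θ₀) 1 (hW.thin_S_inv hρ)
    simpa only [← hycol] using this
  have xC : ∀ j, VecClose P (fun q i => Xm q i j) fun q i => Xm q i j := fun j => by
    have := h.vecClose (Pi.single j 1) 0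
    rwa [← show (fun q i => Xm q i j) = sample X ε (Pi.single j 1) 0 from funext (hXcol j)] at this
  have SyC : VecClose P (fun q => S (W q.1) (rho (θ q)) *ᵥ y q)
      fun q => S (W q.1) (rho θ₀) *ᵥ y q := yC.mulVec (matClose_S hW hr)
  have XbC : VecClose P (fun q => Xm q *ᵥ beta (θ q)) fun q => Xm q *ᵥ beta θ₀ := by
    have := VecClose.sum Finset.univ fun j _ => VecClose.smul (hθ (Sum.inr j)) (xC j)
    have e : ∀ q (b : Fin p → ℝ), Xm q *ᵥ b = ∑ j, b j • fun i => Xm q i j := fun q b => by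
      ext i
      simp [mulVec, dotProduct, mul_comm]
    simp only [e]
    exact this
  have rC := SyC.sub XbC
  -- the variance estimates
  have sE : Close (whp P) lg (fun q => sigmaEpsSq (W q.1) (y q) (Xm q) (θ q)) fun _ => (v : ℝ) := by
    have h1 := rC.normalized_dotProduct rC
    have h2 := h.close_normalized_sq 0 1
    have h3 := (h1.congr' (y' := fun q => (q.1 : ℝ)⁻¹ * (sample X ε 0 1 q ⬝ᵥ sample X ε 0 1 q))
      (Eventually.of_forall fun q => rfl) ?_).trans h2
    · refine h3.congr' (Eventually.of_forall fun q => ?_) (Eventually.of_forall fun q => ?_)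
      · simp only [sigmaEpsSq, dotProduct, sq]
      · simp [covX]
    · filter_upwards [hst] with q hq
      have e : S (W q.1) (rho θ₀) *ᵥ y q - Xm q *ᵥ beta θ₀ = sample X ε 0 1 q := by
        rw [hy, S_mulVec_response hq hρ, add_sub_cancel_left]
        ext i
        simp [sample, lin]
      rw [e]
  have hpos : 0 < covX μX (beta θ₀) (beta θ₀) + v := by
    have h1 : 0 ≤ covX μX (beta θ₀) (beta θ₀) := integral_nonneg fun x => mul_self_nonneg _
    have h2 : (0 : ℝ) < v := by exact_mod_cast pos_iff_ne_zero.2 hv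
    linarith
  have sY : Close (whp P) lg (fun q => sigmaSq (W q.1) (y q) (θ q))
      fun _ => covX μX (beta θ₀) (beta θ₀) + v := by
    have h1 := SyC.normalized_dotProduct SyC
    have h2 := h.close_normalized_sq (beta θ₀) 1
    have h3 := (h1.congr' (y' := fun q => (q.1 : ℝ)⁻¹ *
      (sample X ε (beta θ₀) 1 q ⬝ᵥ sample X ε (beta θ₀) 1 q))
      (Eventually.of_forall fun q => rfl) ?_).trans h2
    · refine h3.congr' (Eventually.of_forall fun q => ?_) (Eventually.of_forall fun q => ?_)
      · simp only [sigmaSq, dotProduct, sq]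
      · simp
    · filter_upwards [hst] with q hq
      rw [hy, S_mulVec_response hq hρ, hu]
  have hHC := matClose_H hW hr
  -- up to a loading, each regressor is a sample vector `X b + c ε`
  have regC : ∀ a, VecClose P (fun q => hatRegressor (W q.1) (y q) (Xm q) a)
      fun q => loading (W q.1) (rho θ₀) a *ᵥ sample X ε (coef θ₀ a) (noise a) q := fun a => by
    cases a with
    | inl u =>
      refine (yC.mulVec (matClose_W hW)).congr' (Eventually.of_forall fun q => rfl)
        (Eventually.of_forall fun q => congrArg scaled ?_)
      change W q.1 *ᵥ y q = (W q.1 * (S (W q.1) (rho θ₀))⁻¹) *ᵥ sample X ε (beta θ₀) 1 q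
      rw [hycol, mulVec_mulVec]
    | inr j =>
      refine (xC j).congr' (Eventually.of_forall fun q => rfl)
        (Eventually.of_forall fun q => congrArg scaled ?_)
      exact (hXcol j q).trans (one_mulVec _).symm
  have gC := (((regC a).mulVec hHC).normalized_dotProduct ((regC b).mulVec hHC)).trans_decay
    tendsto_lg (x' := fun q => (covX μX (coef θ₀ a) (coef θ₀ b) + noise a * noise b * v)
        * gramTrace (W q.1) (rho θ₀) a b) (by
      simp only [dotProduct_H_loading]
      exact h.decay_gram hW hρ _ _ _ _ a b)
  have gC' := (close_const (E := ℝ) 4).mul tendsto_lg (sE.mul tendsto_lg gC)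
  -- the linear part exceeds its target by `4 v² gramTrace` at `ρ`, since `W y` carries the errors
  have quadC : Close (whp P) lg (fun q => hatQuad (W q.1) (y q) (Xm q) (θ q) a b) fun q =>
      quadVar (W q.1) (rho θ₀) v a b
        - 4 * (v * (noise a * noise b * v * gramTrace (W q.1) (rho θ₀) a b)) := by
    cases a with
    | inr j => simpa [hatQuad, quadVar, noise] using close_const (E := ℝ) (l := whp P) (k := lg) 0
    | inl u =>
    cases b with
    | inr j => simpa [hatQuad, quadVar, noise] using close_const (E := ℝ) (l := whp P) (k := lg) 0
    | inl u' =>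
    have tC := ((((regC (Sum.inl u)).mulVec hHC).normalized_dotProduct
      (SyC.mulVec (matClose_T2 hW hr)))).trans_decay tendsto_lg
      (x' := fun q => (covX μX (beta θ₀) (beta θ₀) + v) *
        ((q.1 : ℝ)⁻¹ * (crossMat (W q.1) (rho θ₀)).trace)) (by
      have hA : Moderate atTop logScale fun N => ‖(H (W N) (rho θ₀))ᵀ * (S (W N) (rho θ₀) *
          D (W N) (rho θ₀) * D (W N) (rho θ₀) * (W N)ᵀ)‖ :=
        moderate_of_fst (P := P) (f := fun N => ‖(H (W N) (rho θ₀))ᵀ * (S (W N) (rho θ₀) *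
          D (W N) (rho θ₀) * D (W N) (rho θ₀) * (W N)ᵀ)‖)
          ((matClose_H hW (close_const _)).transpose.mul tendsto_lg
            (matClose_T2 hW (close_const _))).moderate
      have key := h.decay_bilinear (beta θ₀) (beta θ₀) 1 1
        (thin_loading hW hρ (Sum.inl () : Idx p)) hA thin_one
      refine key.congr' ?_
      filter_upwards [hst] with q hq
      rw [hy, S_mulVec_response hq hρ, hu, mulVec_mulVec, mulVec_dotProduct_mulVec, crossMat]
      simp only [loading, coef, noise, transpose_mul, mul_assoc, mul_one, one_mul])
    have qC := (close_const (E := ℝ) 4).mul tendsto_lg ((sE.mul tendsto_lg sE).mul tendsto_lg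
      (((MatClose.normalized_trace ((matClose_XiSum hW hr).mul tendsto_lg
        (matClose_XiSum hW hr))).add tendsto_lg
        (matClose_VSum hW hr).normalized_trace).add tendsto_lg
        ((close_const (E := ℝ) 2).mul tendsto_lg ((sY.inv hpos).mul tendsto_lg tC))))
    refine qC.congr' (Eventually.of_forall fun q => rfl) ?_
    filter_upwards [hst] with q hq
    simp only [quadVar, noise, gramTrace, trace_scoreMat_mul_self hq hρ,
      trace_scoreMat_mul_transpose hq hρ, loading]
    rw [inv_mul_cancel_left₀ hpos.ne']
    ring
  refine ((gC'.add tendsto_lg quadC).decay_sub).congr fun q => ?_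
  rw [hatSigma1_apply (W q.1) (hpart q.1), limitSigma]
  ring

end Consistency

end SAR

end

theorem theorem3 {p : ℕ} {Ω : Type*} [MeasurableSpace Ω] (P : Measure Ω) [IsProbabilityMeasure P]
    -- the networks
    (W : (N : ℕ) → Matrix (Fin N) (Fin N) ℝ) (hW : SAR.NetworkCondition W)
    -- the assignment of the nodes to the workers, none of which is empty
    (K : ℕ → ℕ) (part : (N : ℕ) → Fin N → Fin (K N))
    (hpart : ∀ N, Function.Surjective (part N))
    -- the true parameter
    (θ₀ : SAR.Idx p → ℝ) (hρ : |SAR.rho θ₀| < 1)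
    -- the errors: independent, centred normal with common variance
    (v : ℝ≥0) (hv : v ≠ 0) (ε : (N : ℕ) → Fin N → Ω → ℝ)
    (hε_law : ∀ N i, HasLaw (ε N i) (gaussianReal 0 v) P)
    (hε_indep : ∀ N, iIndepFun (ε N) P)
    -- the covariates: independent with a common centred law with finite fourth moments
    (μX : Measure (Fin p → ℝ)) (hμX_mean : ∀ j, ∫ x, x j ∂μX = 0)
    (hμX_mom : ∀ j, MemLp (fun x : Fin p → ℝ => x j) 4 μX)
    (X : (N : ℕ) → Fin N → Ω → Fin p → ℝ)
    (hX_law : ∀ N i, HasLaw (X N i) μX P)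
    (hX_indep : ∀ N, iIndepFun (X N) P)
    -- the covariates are independent of the errors
    (hXε : ∀ N, IndepFun (fun ω i => X N i ω) (fun ω i => ε N i ω) P)
    -- the parameter estimator that is plugged in, with a polynomial rate of consistency
    (θhat : ℕ → Ω → SAR.Idx p → ℝ) (κ : ℝ) (hκ : 0 < κ)
    (hθ : ∀ a, SAR.BoundedInProb P fun N ω => (N : ℝ) ^ κ * (θhat N ω a - θ₀ a)) :
    (∀ a b, TendstoInMeasure P
      (fun (N : ℕ) ω =>
        SAR.hatSigma1 (W N) (part N)
            (SAR.response (W N) θ₀ (Matrix.of fun i => X N i ω) (fun i => ε N i ω))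
            (Matrix.of fun i => X N i ω) (θhat N ω) a b
          - SAR.Sigma1Given (W N) (part N) θ₀ v (Matrix.of fun i => X N i ω) a b)
      atTop (fun _ => 0)) ∧
    (∀ a b, TendstoInMeasure P
      (fun (N : ℕ) ω =>
        SAR.hatSigma1 (W N) (part N)
            (SAR.response (W N) θ₀ (Matrix.of fun i => X N i ω) (fun i => ε N i ω))
            (Matrix.of fun i => X N i ω) (θhat N ω) a b
          - SAR.Sigma1 (W N) (part N) θ₀ P (fun ω' => Matrix.of fun i => X N i ω')
              (fun ω' i => ε N i ω') a b)
      atTop (fun _ => 0)) := by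
  have h : SAR.Sampling P v ε μX X :=
    ⟨hε_law, hε_indep, hμX_mean, hμX_mom, hX_law, hX_indep, hXε⟩
  have hθ' : ∀ a, SAR.Close (SAR.whp P) SAR.lg (fun q : ℕ × Ω => θhat q.1 q.2 a)
      fun _ => θ₀ a := fun a => SAR.close_of_decay
    (SAR.decay_of_boundedInProb (Z := fun N ω => θhat N ω a - θ₀ a) hκ (hθ a))
  have hhat := h.decay_hatSigma1 (θ₀ := θ₀) (K := K) (part := part) hW hρ hv hpart
    (θ := fun q => θhat q.1 q.2) hθ'
  refine ⟨fun a b => ?_, fun a b => ?_⟩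
  · have key := SAR.tendstoInMeasure_of_decay (SAR.decay_sub (hhat a b)
      (h.decay_Sigma1Given (K := K) (part := part) hW hρ hpart a b))
    simpa only [sub_sub_sub_cancel_right] using key
  · have key := SAR.tendstoInMeasure_of_decay (hhat a b)
    refine key.congr' ?_ (Eventually.of_forall fun ω => rfl)
    filter_upwards [hW.eventually_isStochastic] with N hN
    refine Eventually.of_forall fun ω => ?_
    simp only [h.Sigma1_eq_limitSigma hN hρ (hpart N)]
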